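/- Let $1\le M\le N$ and $l\ge 0$. Write a state of the $2\times M\times N$ system as a pair $(\Gamma_1,\Gamma_2)$ of complex $M\times N$ matrices. Two pairs are SLOCC equivalent if there are invertible complex matrices $T$ ($2\times2$), $P$ ($M\times M$), $Q$ ($N\times N$) with $\Gamma_i'=\sum_j T_{ij}\,P\Gamma_jQ$ for $i=1,2$. Let $C_{M-1,l}$ be the set of pairs for which the rank of $\alpha\Gamma_1+\beta\Gamma_2$, $(\alpha,\beta)\in\mathbb{C}^2\setminus\{0\}$, has maximum $M-1$ and minimum $l$. Let $\Lambda$ be the $M\times N$ matrix with ones on the first $M-1$ diagonal positions and zeros elsewhere. For integers $\varepsilon_1\ge\dots\ge\varepsilon_q\ge0$, $q=N-M+1$, and $\eta\ge0$ put $t_j=\sum_i\max(\varepsilon_i+1-j,0)+\min(\eta,\max(\eta+1-j,0))$ for $j\ge0$. Let $B=B(\varepsilon,\eta)$ be the $\left(\sum_i\varepsilon_i+\eta+1\right)\times\left(\sum_i\varepsilon_i+\eta+q\right)$ matrix of zeros and ones, with rows and columns numbered from $1$, whose ones are exactly at the positions $(t_{j+1}+1-i,\;t_j+1-i)$ for $1\le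 i\le q$, $0\le j<\varepsilon_i$, and $(t_{j+1}+1,\;t_{j+2}+1)$ for $0\le j<\eta$. Let $c_{M-1,l}$ be the set of pairs $(\Lambda,\Gamma)\in C_{M-1,l}$ with $\operatorname{rank}\Gamma=l$ and $\Gamma=\begin{pmatrix}J&0\\0&B\end{pmatrix}$, where $J$ is a (possibly empty) complex square matrix in Jordan canonical form and $B=B(\varepsilon,\eta)$ for some $\varepsilon,\eta$ with sizes that fit. Call two Jordan matrices $J,J'$ equivalent if there are $a,b,c,d\in\mathbb{C}$ with $ad-bc\ne0$ such that $a+b\lambda\neq0$ for every eigenvalue $\lambda$ of $J$ and such that $\lambda\mapsto(c+d\lambda)/(a+b\lambda)$ carries the Jordan blocks of $J$ onto those of $J'$, preserving their sizes, up to the order of the blocks. Then $c_{M-1,l}$ classifies $C_{M-1,l}$ up to SLOCC equivalence. Every pair in $C_{M-1,l}$ is SLOCC equivalent to some $(\Lambda,\Gamma)\in c_{M-1,l}$, which can be chosen so that the pair is truly entangled (all three reduced density matrices are nonsingular) if and only if $\varepsilon_i\ge1$ for all $i$ and $\eta\ge1$. Moreover: (i) two pairs in $C_{M-1,l}$ are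 SLOCC equivalent if and only if they are SLOCC equivalent to a common element of $c_{M-1,l}$; (ii) two elements $(\Lambda,\operatorname{diag}(J,B(\varepsilon,\eta)))$ and $(\Lambda,\operatorname{diag}(J',B(\varepsilon',\eta')))$ of $c_{M-1,l}$ are SLOCC equivalent if and only if $\varepsilon=\varepsilon'$ and $\eta=\eta'$ (so that $B=B'$) and $J$ and $J'$ are equivalent. -/

import Mathlib

noncomputable section

namespace Slocc

/-- A (not necessarily normalised) pure state of the `2 × M × N` system, written as the pair
`(Γ₁, Γ₂) = (ψ 0, ψ 1)` of its complex `M × N` coefficient matrices. -/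
abbrev State (M N : ℕ) : Type := Fin 2 → Matrix (Fin M) (Fin N) ℂ

/-- SLOCC equivalence: `φ = T ⊗ P ⊗ Q ψ` for invertible complex matrices `T`, `P`, `Q`;
in terms of coefficient matrices `φ i = ∑ j, T i j • (P * ψ j * Q)`. -/
def Equivalent {M N : ℕ} (ψ φ : State M N) : Prop :=
  ∃ (T : GL (Fin 2) ℂ) (P : GL (Fin M) ℂ) (Q : GL (Fin N) ℂ),
    ∀ i, φ i = ∑ j, T.val i j • (P.val * ψ j * Q.val)

/-- The ranks of the nontrivial linear combinations `α Γ₁ + β Γ₂`. -/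
def combRanks {M N : ℕ} (ψ : State M N) : Set ℕ :=
  {r | ∃ α β : ℂ, (α ≠ 0 ∨ β ≠ 0) ∧ r = (α • ψ 0 + β • ψ 1).rank}

/-- The set `C_{n,l}`: the maximal rank of the combinations is `n`, the minimal one is `l`. -/
def C (M N n l : ℕ) : Set (State M N) :=
  {ψ | IsGreatest (combRanks ψ) n ∧ IsLeast (combRanks ψ) l}

/-- Genuine tripartite entanglement: the three reduced density matrices (of the party of
dimension `2`, of the one of dimension `M` and of the one of dimension `N`) are nonsingular. -/
def TrulyEntangled {M N : ℕ} (ψ : State M N) : Prop :=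
  (Matrix.of fun i i' : Fin 2 => (ψ i * (ψ i').conjTranspose).trace).det ≠ 0 ∧
  (∑ i, ψ i * (ψ i).conjTranspose).det ≠ 0 ∧
  (∑ i, (ψ i).conjTranspose * ψ i).det ≠ 0

/-- The Jordan block of size `s` with eigenvalue `x`. -/
def jordanBlock (s : ℕ) (x : ℂ) : Matrix (Fin s) (Fin s) ℂ :=
  Matrix.of fun i j => if i = j then x else if i.val + 1 = j.val then 1 else 0

/-- The matrix in Jordan canonical form with the given blocks along the diagonal. -/
def jordanMatrix {b : ℕ} (eig : Fin b → ℂ) (size : Fin b → ℕ) :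
    Matrix (Fin (∑ i, size i)) (Fin (∑ i, size i)) ℂ :=
  Matrix.reindex finSigmaFinEquiv finSigmaFinEquiv
    (Matrix.blockDiagonal' fun i => jordanBlock (size i) (eig i))

/-- The corners of the staircase of ones in the block `B`
(subtraction is truncated on purpose: a chain that has ended contributes nothing). -/
def corner {q : ℕ} (ε : Fin q → ℕ) (η j : ℕ) : ℕ :=
  (∑ i, (ε i + 1 - j)) + min η (η + 1 - j)

/-- The combinatorial block `B`, a matrix of zeros and ones. Relative to the matrix of the same
shape whose ones are on the first `∑ i, ε i + η` diagonal positions, its ones form, for every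
`i`, a chain that gives an `ε i × (ε i + 1)` row-chain block, and one chain that gives an
`(η + 1) × η` column-chain block. -/
def blockB {q : ℕ} (ε : Fin q → ℕ) (η : ℕ) :
    Matrix (Fin (∑ i, ε i + η + 1)) (Fin (∑ i, ε i + η + q)) ℂ :=
  open Classical in
  Matrix.of fun r c =>
    if (∃ i : Fin q, ∃ j < ε i,
          r.val + i.val + 1 = corner ε η (j + 1) ∧ c.val + i.val + 1 = corner ε η j) ∨
        (∃ j < η, r.val = corner ε η (j + 1) ∧ c.val = corner ε η (j + 2))
    then 1 else 0

/-- The `M × N` matrix with ones on the first `M - 1` diagonal positions, zeros elsewhere. -/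
def Lam (M N : ℕ) : Matrix (Fin M) (Fin N) ℂ :=
  Matrix.of fun r c => if r.val = c.val ∧ r.val + 1 < M then 1 else 0

/-- The data of a normal form `(Λ, diag(J, B))`: the blocks of the Jordan form `J`, the
`N - M + 1` lengths of the row chains of `B` in decreasing order, and the length of the column
chain of `B`. -/
structure NormalForm (M N : ℕ) where
  b : ℕ
  eig : Fin b → ℂ
  size : Fin b → ℕ
  size_pos : ∀ i, 0 < size i
  ε : Fin (N + 1 - M) → ℕ
  ε_anti : Antitone ε
  η : ℕ
  rows : ∑ i, size i + (∑ i, ε i + η + 1) = M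
  cols : ∑ i, size i + (∑ i, ε i + η + (N + 1 - M)) = N

namespace NormalForm

variable {M N : ℕ}

/-- `J`. -/
def J (F : NormalForm M N) : Matrix (Fin (∑ i, F.size i)) (Fin (∑ i, F.size i)) ℂ :=
  jordanMatrix F.eig F.size

/-- `Γ = diag(J, B)`, an `M × N` matrix. -/
def Gam (F : NormalForm M N) : Matrix (Fin M) (Fin N) ℂ :=
  Matrix.reindex (finSumFinEquiv.trans (finCongr F.rows)) (finSumFinEquiv.trans (finCongr F.cols))
    (Matrix.fromBlocks F.J 0 0 (blockB F.ε F.η))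

/-- The pair `(Λ, Γ)`. -/
def state (F : NormalForm M N) : State M N := ![Lam M N, F.Gam]

/-- The Jordan forms of `F` and `F'` are equivalent: there is an invertible fractional linear
transformation, finite at the eigenvalues of the first, which carries the Jordan blocks of the
first onto those of the second, preserving their sizes, up to the order of the blocks. -/
def JordanEquivalent (F F' : NormalForm M N) : Prop :=
  ∃ (T : GL (Fin 2) ℂ) (σ : Fin F.b ≃ Fin F'.b), ∀ i,
    F'.size (σ i) = F.size i ∧
    T.val 0 0 + T.val 0 1 * F.eig i ≠ 0 ∧
    F'.eig (σ i) = (T.val 1 0 + T.val 1 1 * F.eig i) / (T.val 0 0 + T.val 0 1 * F.eig i)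

end NormalForm

/-- The set `c_{M-1,l}` of the normal forms with `r(Γ) = l` that lie in `C_{M-1,l}`. -/
def normalForms (M N l : ℕ) : Set (NormalForm M N) :=
  {F | F.Gam.rank = l ∧ F.state ∈ C M N (M - 1) l}

end Slocc

end

/-! SLOCC equivalence is strict equivalence of pencils `(A, B)` of linear maps together with an
invertible change of the two generators (`equivalent_iff_pairEquiv`). The theorem is thus
Kronecker's theory of pencils for maximal rank one less than the number of rows. The generators can
be chosen so that `A` has the maximal and `B` the minimal rank (`exists_comb_rank_eq`); `A` becomes
Λ and `B` becomes Γ.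

Existence. Let U be the limit of the iterates of 0 under the linear relation A⁻¹B, and O the limit
of the iterates of the whole space V under B⁻¹A. Then U ≤ O ≤ V: U carries the row chains, V/O the
column chain, and on O/U the relation A⁻¹B is an endomorphism, whose Jordan form is `J`. Maximality
of the rank of `A` enters through `apply_mem_range_of_mem_relIter_bot`: B maps U into the range of
A. This excludes infinite eigenvalues and allows the chains in U to be counted
(`exists_row_chains`). The range of `A` is a hyperplane, so there is exactly one column chain,
possibly of length zero (`exists_col_chain`). Jordan chains of O/U lift to V because B - cA can be
inverted against A inside U (`exists_jordan_lift`), and `iso_of_chains` turns all chains into bases.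

Uniqueness. Dimensions of iterates are invariants of strict equivalence (`Iso.invariants`).
Iterating from 0 under A⁻¹B gives ε; iterating from V under B⁻¹A gives η; iterating from 0 with (B -
cA, A) gives, after the equal contributions of the chains cancel, dim ker (J - c)^j, hence the
Jordan blocks. A change of generators does not affect the chains (`iso_chain_comb`): a column chain
is multiplication by X and by 1 on polynomials of bounded degree, so replacing X and 1 by two
independent linear polynomials only changes bases, and row chains are transposes. On `J` the change
acts as a fractional linear map (`exists_iso_mobius`), finite at the eigenvalues because the new
first generator must again be of corank one (`pairEquiv_normal_form_iff`).

The staircase in `blockB` is the numbering of the chain bases for which the first map is diagonal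
(`iso_state`). Nonsingularity of the reduced density matrices means linear independence of the pair,
ranges that span, and kernels that meet trivially; the last two are read off the chains, and they
imply the first (`trulyEntangled_iff`). -/

noncomputable section

namespace Pencil

open Module Polynomial

/-! ### Existence of Jordan bases -/

section JordanExistence

universe u v

variable {K : Type u} {E : Type v} [Field K] [AddCommGroup E] [Module K E]

/-- The powers of `X - c` form a basis of `K[X] ⧸ ((X - c) ^ n)`. -/
theorem exists_basis_quotient_pow (c : K) (n : ℕ) (I : Ideal K[X])
    (hI : I = Ideal.span {(X - C c) ^ n}) :
    ∃ v : Basis (Fin n) K (K[X] ⧸ I), ∀ k, v k = Ideal.Quotient.mk I ((X - C c) ^ k.val) := by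
  subst hI
  have hzero : ∀ k, n ≤ k → Ideal.Quotient.mk (Ideal.span {(X - C c) ^ n}) ((X - C c) ^ k) = 0 := by
    intro k hk
    rw [Ideal.Quotient.eq_zero_iff_mem, Ideal.mem_span_singleton]
    exact pow_dvd_pow _ hk
  have hsmul : ∀ (a : K) (p : K[X]), Ideal.Quotient.mk (Ideal.span {(X - C c) ^ n}) (C a * p) =
      a • Ideal.Quotient.mk (Ideal.span {(X - C c) ^ n}) p := by
    intro a p
    rw [← Polynomial.smul_eq_C_mul]
    rfl
  refine ⟨Basis.mk (v := fun k : Fin n =>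
    Ideal.Quotient.mk (Ideal.span {(X - C c) ^ n}) ((X - C c) ^ k.val)) ?_ ?_, ?_⟩
  · rw [Fintype.linearIndependent_iff]
    intro g hg i
    simp_rw [← hsmul] at hg
    rw [← map_sum, Ideal.Quotient.eq_zero_iff_mem, Ideal.mem_span_singleton] at hg
    obtain ⟨r, hr⟩ := hg
    -- Substituting `X + c` turns divisibility by `(X - c) ^ n` into divisibility by `X ^ n`, that
    -- is, vanishing of the coefficients below `n`.
    have h2 := congrArg (fun p => p.comp (X + C c)) hr
    simp only [Polynomial.sum_comp, mul_comp, C_comp, pow_comp, sub_comp, X_comp,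
      add_sub_cancel_right] at h2
    have h3 := Polynomial.X_pow_dvd_iff.1 ⟨_, h2⟩ i.val i.isLt
    simpa [Polynomial.finsetSum_coeff, Polynomial.coeff_C_mul, Polynomial.coeff_X_pow,
      Fin.val_inj] using h3
  · rintro x -
    obtain ⟨p, rfl⟩ := Ideal.Quotient.mk_surjective x
    -- Spanning is the Taylor expansion at `c`, with the terms of order at least `n` zero in the
    -- quotient.
    rw [← Polynomial.sum_taylor_eq p c, Polynomial.sum, map_sum]
    refine Submodule.sum_mem _ fun k _ => ?_
    rw [hsmul]
    refine Submodule.smul_mem _ _ ?_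
    by_cases hk : k < n
    · exact Submodule.subset_span ⟨⟨k, hk⟩, rfl⟩
    · rw [hzero k (not_lt.1 hk)]
      exact zero_mem _
  · intro k
    simp

/-- A basis of Jordan chains, with chains indexed by an arbitrary finite type. -/
theorem exists_jordan_chains_aux [IsAlgClosed K] [FiniteDimensional K E] (f : E →ₗ[K] E) :
    ∃ (ι : Type u) (_ : Fintype ι) (eig : ι → K) (size : ι → ℕ) (y : ι → ℕ → E)
      (v : Basis (Σ i, Fin (size i)) K E), (∀ i, y i 0 = 0) ∧
      (∀ i, ∀ k < size i, f (y i (k + 1)) = eig i • y i (k + 1) + y i k) ∧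
      ∀ p, v p = y p.1 (p.2.val + 1) := by
  classical
  obtain ⟨ι, hι, p, hp, n, ⟨e⟩⟩ := Module.equiv_directSum_of_isTorsion
    (AEval.isTorsion_of_finiteDimensional K E f)
  have hroot : ∀ i, ∃ c, Associated (p i) (X - C c) := by
    intro i
    obtain ⟨c, hc⟩ := Polynomial.exists_root_of_degree_eq_one
      (IsAlgClosed.degree_eq_one_of_irreducible K (hp i))
    exact ⟨c, ((Polynomial.irreducible_X_sub_C c).associated_of_dvd (hp i)
      (Polynomial.dvd_iff_isRoot.2 hc)).symm⟩
  choose c hc using hroot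
  have hI : ∀ i, Ideal.span {p i ^ n i} = Ideal.span {(X - C (c i)) ^ n i} := fun i =>
    Ideal.span_singleton_eq_span_singleton.2 ((hc i).pow_pow)
  choose v hv using fun i => exists_basis_quotient_pow (c i) (n i) _ (hI i)
  let g : ι → AEval' f := fun i => e.symm (DirectSum.lof K[X] ι _ i (Ideal.Quotient.mk _ 1))
  have hg : ∀ i (q : K[X]), q • g i = e.symm (DirectSum.lof K[X] ι
      (fun i => K[X] ⧸ Ideal.span {p i ^ n i}) i (Ideal.Quotient.mk _ q)) := by
    intro i q
    simp only [g]
    rw [← map_smul, ← map_smul]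
    congr 2
    exact congrArg (Ideal.Quotient.mk _) (mul_one q)
  -- The exponent is reversed so that `X - c` lowers the index by one and `y i 0`, which is `(X - c)
  -- ^ n` times the generator, vanishes.
  let y : ι → ℕ → E := fun i k => (AEval'.of f).symm ((X - C (c i)) ^ (n i - k) • g i)
  let B : Basis (Σ i, Fin (n i)) K E :=
    ((DFinsupp.basis v).map (e.symm.restrictScalars K)).map (AEval'.of f).symm
  have hB : ∀ i k, B ⟨i, k⟩ = (AEval'.of f).symm ((X - C (c i)) ^ k.val • g i) := by
    intro i k
    rw [hg]
    rw [← hv]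
    have : DFinsupp.basis v ⟨i, k⟩ = DFinsupp.single i (v i k) := by
      apply (DFinsupp.basis v).repr.injective
      rw [Basis.repr_self]
      ext ⟨j, l⟩
      change Finsupp.single (⟨i, k⟩ : Σ i, Fin (n i)) (1 : K) ⟨j, l⟩ =
        (v j).repr ((DFinsupp.single i (v i k) :
          Π₀ i, K[X] ⧸ Ideal.span {p i ^ n i}) j) l
      by_cases hij : i = j
      · subst hij
        simp [Finsupp.single_apply]
      · simp [hij, DFinsupp.single_eq_of_ne (Ne.symm hij)]
    simp only [B, Basis.map_apply]
    rw [this]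
    rfl
  let σ : (Σ i, Fin (n i)) ≃ Σ i, Fin (n i) := Equiv.sigmaCongrRight fun i => Fin.revPerm
  refine ⟨ι, hι, c, n, y, B.reindex σ, ?_, ?_, ?_⟩
  · intro i
    simp only [y, hg, Nat.sub_zero]
    have : Ideal.Quotient.mk (Ideal.span {p i ^ n i}) ((X - C (c i)) ^ n i) = 0 := by
      rw [Ideal.Quotient.eq_zero_iff_mem, hI, Ideal.mem_span_singleton]
    rw [this]
    simp
  · intro i k hk
    have h1 : ∀ m : AEval' f, f ((AEval'.of f).symm m) = (AEval'.of f).symm ((X : K[X]) • m) := by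
      intro m
      obtain ⟨m, rfl⟩ := (AEval'.of f).surjective m
      rw [AEval'.X_smul_of]
      simp
    have h2 : (X : K[X]) • ((X - C (c i)) ^ (n i - (k + 1)) • g i) =
        (c i) • ((X - C (c i)) ^ (n i - (k + 1)) • g i) + (X - C (c i)) ^ (n i - k) • g i := by
      have : n i - k = n i - (k + 1) + 1 := by omega
      rw [this, ← algebraMap_smul K[X] (c i), smul_smul, smul_smul, ← add_smul]
      congr 1
      rw [Polynomial.algebraMap_eq]
      ring
    simp only [y]
    rw [h1, h2]
    simp
  · rintro ⟨i, k⟩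
    simp only [Basis.reindex_apply, y]
    have : σ.symm ⟨i, k⟩ = ⟨i, k.rev⟩ := rfl
    rw [this, hB]
    congr 3

/-- Every endomorphism of a finite-dimensional space over an algebraically closed field has a basis
consisting of Jordan chains `y i 1, …, y i (size i)`. -/
theorem exists_jordan_chains [IsAlgClosed K] [FiniteDimensional K E] (f : E →ₗ[K] E) :
    ∃ (b : ℕ) (eig : Fin b → K) (size : Fin b → ℕ) (y : Fin b → ℕ → E)
      (v : Basis (Σ i, Fin (size i)) K E), (∀ i, 0 < size i) ∧ (∀ i, y i 0 = 0) ∧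
      (∀ i, ∀ k < size i, f (y i (k + 1)) = eig i • y i (k + 1) + y i k) ∧
      ∀ p, v p = y p.1 (p.2.val + 1) := by
  classical
  obtain ⟨ι, hι, eig, size, y, v, h0, h1, h2⟩ := exists_jordan_chains_aux f
  -- Summands of size zero are discarded here, which makes all sizes positive.
  let s := Fintype.equivFin {i // 0 < size i}
  let τ : (Σ i, Fin (size i)) ≃ Σ j, Fin (size (s.symm j)) :=
    { toFun := fun p => ⟨s ⟨p.1, p.2.pos⟩, ⟨p.2.val, by simp⟩⟩
      invFun := fun p => ⟨(s.symm p.1).1, p.2⟩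
      left_inv := by
        rintro ⟨i, k⟩
        refine Sigma.ext (by simp) ?_
        refine (Fin.heq_ext_iff (by simp)).2 rfl
      right_inv := by
        rintro ⟨i, k⟩
        refine Sigma.ext (by simp) ?_
        refine (Fin.heq_ext_iff (by simp)).2 rfl }
  refine ⟨_, fun j => eig (s.symm j), fun j => size (s.symm j), fun j => y (s.symm j),
    v.reindex τ, fun j => (s.symm j).2, fun j => h0 _, fun j => h1 _, ?_⟩
  rintro ⟨j, k⟩
  rw [Basis.reindex_apply, h2]
  rfl

end JordanExistence

end Pencil

namespace Pencil

open Module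

/-! ### Coordinate subspaces and Jordan matrices as linear maps -/

section Coordinate

variable (K : Type*) {ι : Type*} [Field K]

/-- The vectors supported on a set of coordinates. -/
def coordSubspace (S : Set ι) : Submodule K (ι → K) where
  carrier := {x | ∀ i, i ∉ S → x i = 0}
  add_mem' := fun {x y} hx hy i hi => by simp [hx i hi, hy i hi]
  zero_mem' := fun _ _ => rfl
  smul_mem' := fun c x hx i hi => by simp [hx i hi]

variable {K}

theorem mem_coordSubspace {S : Set ι} {x : ι → K} :
    x ∈ coordSubspace K S ↔ ∀ i, i ∉ S → x i = 0 := Iff.rfl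

theorem finrank_coordSubspace [Finite ι] (S : Set ι) :
    finrank K (coordSubspace K S) = Nat.card S := by
  classical
  have := Fintype.ofFinite ι
  let e : coordSubspace K S ≃ₗ[K] (S → K) :=
    { toFun := fun x i => x.1 i
      map_add' := fun _ _ => rfl
      map_smul' := fun _ _ => rfl
      invFun := fun y => ⟨fun i => if h : i ∈ S then y ⟨i, h⟩ else 0, fun i hi => by simp [hi]⟩
      left_inv := by
        rintro ⟨x, hx⟩
        ext i
        by_cases h : i ∈ S
        · simp [h]
        · simp [h, hx i h]
      right_inv := fun y => by
        ext i
        simp }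
  rw [e.finrank_eq, Module.finrank_pi, Nat.card_eq_fintype_card]

end Coordinate

section JordanMap

variable {K : Type*} {ι : Type*} [Field K]

/-- The linear map of a matrix in Jordan canonical form. -/
def jordanMap (eig : ι → K) (size : ι → ℕ) :
    ((Σ i, Fin (size i)) → K) →ₗ[K] ((Σ i, Fin (size i)) → K) where
  toFun x p := eig p.1 * x p + if h : p.2.val + 1 < size p.1 then x ⟨p.1, ⟨p.2.val + 1, h⟩⟩ else 0
  map_add' x y := by
    ext p
    by_cases h : p.2.val + 1 < size p.1
    · simp [h]; ring
    · simp [h]; ring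
  map_smul' c x := by
    ext p
    by_cases h : p.2.val + 1 < size p.1
    · simp [h]; ring
    · simp [h]; ring

theorem jordanMap_apply (eig : ι → K) (size : ι → ℕ) (x : (Σ i, Fin (size i)) → K)
    (p : Σ i, Fin (size i)) : jordanMap eig size x p =
      eig p.1 * x p + if h : p.2.val + 1 < size p.1 then x ⟨p.1, ⟨p.2.val + 1, h⟩⟩ else 0 := rfl

/-- Summation by parts along each block: the shift of the coordinates becomes a shift of the
vectors, and `y i 0 = 0` removes the boundary term. -/
theorem sum_jordanMap_smul [Fintype ι] {W : Type*} [AddCommGroup W] [Module K W]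
    (eig : ι → K) (size : ι → ℕ) (y : ι → ℕ → W) (hy : ∀ i, y i 0 = 0)
    (x : (Σ i, Fin (size i)) → K) :
    ∑ p, jordanMap eig size x p • y p.1 (p.2.val + 1) =
      ∑ p, x p • (eig p.1 • y p.1 (p.2.val + 1) + y p.1 p.2.val) := by
  simp_rw [Fintype.sum_sigma]
  refine Finset.sum_congr rfl fun i _ => ?_
  simp_rw [jordanMap_apply, add_smul, smul_add, Finset.sum_add_distrib]
  congr 1
  · refine Finset.sum_congr rfl fun k _ => ?_
    rw [smul_smul, mul_comm]
  · have key : ∀ (s : ℕ) (u : Fin s → K) (z : ℕ → W), z 0 = 0 →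
        ∑ k : Fin s, (if h : k.val + 1 < s then u ⟨k.val + 1, h⟩ else 0) • z (k.val + 1) =
          ∑ k : Fin s, u k • z k.val := by
      intro s u z hz
      cases s with
      | zero => simp
      | succ s =>
        rw [Fin.sum_univ_castSucc, Fin.sum_univ_succ]
        simp only [Fin.val_castSucc, Fin.val_last, lt_irrefl, dite_false, zero_smul, add_zero,
          Fin.val_zero, hz, smul_zero, zero_add]
        refine Finset.sum_congr rfl fun k _ => ?_
        have : k.val + 1 < s + 1 := by omega
        simp [this]
        rfl
    exact key (size i) (fun k => x ⟨i, k⟩) (y i) (hy i)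

theorem exists_equiv_jordanMap_of_chains [Fintype ι] {E : Type*} [AddCommGroup E] [Module K E]
    (f : E →ₗ[K] E) (eig : ι → K) (size : ι → ℕ) (y : ι → ℕ → E)
    (v : Basis (Σ i, Fin (size i)) K E) (h0 : ∀ i, y i 0 = 0)
    (h1 : ∀ i, ∀ k < size i, f (y i (k + 1)) = eig i • y i (k + 1) + y i k)
    (h2 : ∀ p, v p = y p.1 (p.2.val + 1)) (x : E) :
    v.equivFun (f x) = jordanMap eig size (v.equivFun x) := by
  apply v.equivFun.symm.injective
  obtain ⟨c, rfl⟩ := v.equivFun.symm.surjective x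
  rw [LinearEquiv.symm_apply_apply, LinearEquiv.apply_symm_apply, Basis.equivFun_symm_apply,
    Basis.equivFun_symm_apply, map_sum]
  simp_rw [h2]
  rw [sum_jordanMap_smul _ _ _ h0]
  refine Finset.sum_congr rfl fun p _ => ?_
  rw [map_smul, h1 _ _ p.2.isLt]

/-- The kernels of the powers of `r J + s`. -/
theorem ker_pow_jordanMap (eig : ι → K) (size : ι → ℕ) (r s : K) (hrs : r ≠ 0 ∨ s ≠ 0) (j : ℕ) :
    LinearMap.ker ((r • jordanMap eig size + s • LinearMap.id) ^ j) =
      coordSubspace K {p | r * eig p.1 + s = 0 ∧ p.2.val < j} := by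
  set f := r • jordanMap eig size + s • (LinearMap.id : ((Σ i, Fin (size i)) → K) →ₗ[K] _) with hf
  have happ : ∀ x p, f x p = (r * eig p.1 + s) * x p +
      r * if h : p.2.val + 1 < size p.1 then x ⟨p.1, ⟨p.2.val + 1, h⟩⟩ else 0 := by
    intro x p
    simp only [hf, LinearMap.add_apply, LinearMap.smul_apply, Pi.add_apply, Pi.smul_apply,
      jordanMap_apply, LinearMap.id_apply, smul_eq_mul]
    ring
  induction j with
  | zero =>
    ext x
    simp [mem_coordSubspace, funext_iff]
  | succ j ih =>
    ext x
    rw [LinearMap.mem_ker, pow_succ, Module.End.mul_apply, ← LinearMap.mem_ker, ih,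
      mem_coordSubspace, mem_coordSubspace]
    constructor
    · rintro h ⟨i, k⟩ hp
      by_cases hα : r * eig i + s = 0
      · have hr : r ≠ 0 := by
          rintro rfl
          simp_all
        have hk : j + 1 ≤ k.val := by
          by_contra hk
          exact hp ⟨hα, by simp; omega⟩
        have h1 := h ⟨i, ⟨k.val - 1, by omega⟩⟩ (fun hh => by have := hh.2; simp at this; omega)
        rw [happ] at h1
        have h2 : k.val - 1 + 1 = k.val := by omega
        have h3 : k.val - 1 + 1 < size i := by omega
        simp only [hα, zero_mul, zero_add, h3, dite_true] at h1
        simpa [h2, hr] using h1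
      -- When `r * eig i + s ≠ 0` the block is triangular with nonzero diagonal; back substitution
      -- starts at its last coordinate.
      · have key : ∀ m, ∀ k : Fin (size i), size i ≤ k.val + m → x ⟨i, k⟩ = 0 := by
          intro m
          induction m with
          | zero => intro k hk; omega
          | succ m ihm =>
            intro k hk
            have h1 := h ⟨i, k⟩ (fun hh => hα hh.1)
            rw [happ] at h1
            by_cases h3 : k.val + 1 < size i
            · have h4 := ihm ⟨k.val + 1, h3⟩ (by simp; omega)
              simpa [h3, h4, hα] using h1
            · simpa [h3, hα] using h1
        exact key (size i) k (by omega)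
    · rintro h ⟨i, k⟩ hp
      rw [happ]
      by_cases hα : r * eig i + s = 0
      · have hk : j ≤ k.val := by
          by_contra hk
          exact hp ⟨hα, by simp; omega⟩
        simp only [hα, zero_mul, zero_add]
        by_cases h3 : k.val + 1 < size i
        · rw [dif_pos h3, h, mul_zero]
          rintro ⟨-, h4⟩
          simp at h4
          omega
        · simp [h3]
      · have h0 : ∀ k, x ⟨i, k⟩ = 0 := fun k => h _ (fun hh => hα hh.1)
        simp [h0]

theorem card_chain_initial [Fintype ι] (size : ι → ℕ) (P : ι → Prop) [DecidablePred P] (j : ℕ) :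
    Nat.card {p : Σ i, Fin (size i) | P p.1 ∧ p.2.val < j} =
      ∑ i, if P i then min j (size i) else 0 := by
  classical
  rw [Nat.card_eq_fintype_card, Fintype.card_subtype]
  have : (Finset.univ.filter fun p : Σ i, Fin (size i) => p ∈ {p | P p.1 ∧ p.2.val < j}) =
      Finset.univ.sigma fun i => if P i then Finset.univ.filter fun k : Fin (size i) => k.val < j
        else ∅ := by
    ext ⟨i, k⟩
    by_cases h : P i <;> simp [h]
  rw [this, Finset.card_sigma]
  refine Finset.sum_congr rfl fun i _ => ?_
  by_cases h : P i
  · simp only [h, if_true]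
    rw [Fin.card_filter_val_lt, min_comm]
  · simp [h]

end JordanMap

/-! ### Recovering multisets of sizes from truncated sums -/

section Counting

theorem sum_min_succ {α κ : Type*} [Fintype κ] [DecidableEq α] (a : κ → α) (n : κ → ℕ) (c : α)
    (j : ℕ) : (∑ i, if a i = c then min (j + 1) (n i) else 0) =
      (∑ i, if a i = c then min j (n i) else 0) +
        (Finset.univ.filter fun i => a i = c ∧ j < n i).card := by
  rw [Finset.card_filter, ← Finset.sum_add_distrib]
  refine Finset.sum_congr rfl fun i _ => ?_
  by_cases h1 : a i = c <;> by_cases h2 : j < n i <;> simp [h1, h2] <;> omega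

/-- With `sum_min_succ` this makes the number of indices of size exactly `j + 1` a second difference
of the truncated sums. -/
theorem card_filter_lt_eq_add {α κ : Type*} [Fintype κ] [DecidableEq α] (a : κ → α) (n : κ → ℕ)
    (c : α) (j : ℕ) : (Finset.univ.filter fun i => a i = c ∧ j < n i).card =
      (Finset.univ.filter fun i => a i = c ∧ j + 1 < n i).card +
        (Finset.univ.filter fun i => a i = c ∧ n i = j + 1).card := by
  simp_rw [Finset.card_filter]
  rw [← Finset.sum_add_distrib]
  refine Finset.sum_congr rfl fun i _ => ?_
  by_cases h1 : a i = c
  · rcases lt_trichotomy (n i) (j + 1) with h2 | h2 | h2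
    · have h3 : ¬ j < n i := by omega
      have h4 : ¬ j + 1 < n i := by omega
      simp [h3, h4, h2.ne]
    · simp [h1, h2]
    · have h3 : j < n i := by omega
      simp [h1, h2, h3, h2.ne']
  · simp [h1]

/-- Finite families of pairs `(a i, n i)` with `n i > 0` are determined up to reindexing by the sums
of `min j (n i)` over the fibres of `a`. -/
theorem exists_equiv_of_sum_min_eq {α ι ι' : Type*} [Fintype ι] [Fintype ι'] [DecidableEq α]
    (a : ι → α) (n : ι → ℕ) (a' : ι' → α) (n' : ι' → ℕ) (hn : ∀ i, 0 < n i) (hn' : ∀ i, 0 < n' i)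
    (h : ∀ c j, (∑ i, if a i = c then min j (n i) else 0) =
      ∑ i, if a' i = c then min j (n' i) else 0) :
    ∃ σ : ι ≃ ι', ∀ i, a' (σ i) = a i ∧ n' (σ i) = n i := by
  classical
  have h1 : ∀ c j, (Finset.univ.filter fun i => a i = c ∧ j < n i).card =
      (Finset.univ.filter fun i => a' i = c ∧ j < n' i).card := by
    intro c j
    have e1 := sum_min_succ a n c j
    have e2 := sum_min_succ a' n' c j
    rw [h, h] at e1
    omega
  have h2 : ∀ t : α × ℕ, Nonempty ({i // (a i, n i) = t} ≃ {i // (a' i, n' i) = t}) := by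
    rintro ⟨c, k⟩
    rw [← Fintype.card_eq, Fintype.card_subtype, Fintype.card_subtype]
    simp only [Prod.mk.injEq]
    cases k with
    | zero => simp [(hn _).ne', (hn' _).ne']
    | succ j =>
      have e1 := card_filter_lt_eq_add a n c j
      have e2 := card_filter_lt_eq_add a' n' c j
      rw [h1, h1] at e1
      omega
  refine ⟨Equiv.ofFiberEquiv (f := fun i => (a i, n i)) (g := fun i => (a' i, n' i))
    fun t => (h2 t).some, fun i => ?_⟩
  have := Equiv.ofFiberEquiv_map (f := fun i => (a i, n i)) (g := fun i => (a' i, n' i))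
    (fun t => (h2 t).some) i
  exact Prod.mk.inj this

/-- An antitone tuple is determined by its multiset of values. -/
theorem antitone_eq_of_perm {q : ℕ} {f g : Fin q → ℕ} (hf : Antitone f) (hg : Antitone g)
    (σ : Fin q ≃ Fin q) (h : ∀ i, g (σ i) = f i) : f = g := by
  have h1 : f = g ∘ σ := funext fun i => (h i).symm
  have := Tuple.unique_monotone (f := OrderDual.toDual ∘ g) (σ := σ) (τ := 1)
    (by rw [Function.comp_assoc, ← h1]; exact hf.dual_right) hg.dual_right
  rw [h1]
  exact this

end Counting

/-! ### Similarity and dimensions of kernels of powers -/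

section Similarity

variable {K : Type*} [Field K] {ι ι' : Type*}

/-- General `r` and `s`, rather than `J - c` alone, also cover the numerators and denominators of
fractional linear images of `J`. -/
theorem finrank_ker_pow_jordanMap [Fintype ι] [DecidableEq K] (eig : ι → K) (size : ι → ℕ) (r s : K)
    (hrs : r ≠ 0 ∨ s ≠ 0) (j : ℕ) :
    finrank K (LinearMap.ker ((r • jordanMap eig size + s • LinearMap.id) ^ j)) =
      ∑ i, if r * eig i + s = 0 then min j (size i) else 0 := by
  rw [ker_pow_jordanMap _ _ _ _ hrs, finrank_coordSubspace]
  exact card_chain_initial size (fun i => r * eig i + s = 0) j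

/-- Jordan forms are determined by the dimensions of the kernels of powers. -/
theorem exists_equiv_of_finrank_ker_pow [Fintype ι] [Fintype ι'] (eig : ι → K) (size : ι → ℕ)
    (eig' : ι' → K) (size' : ι' → ℕ) (hs : ∀ i, 0 < size i) (hs' : ∀ i, 0 < size' i)
    (h : ∀ (c : K) (j : ℕ), finrank K (LinearMap.ker ((jordanMap eig size - c • LinearMap.id) ^ j)) =
      finrank K (LinearMap.ker ((jordanMap eig' size' - c • LinearMap.id) ^ j))) :
    ∃ σ : ι ≃ ι', ∀ i, eig' (σ i) = eig i ∧ size' (σ i) = size i := by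
  classical
  refine exists_equiv_of_sum_min_eq _ _ _ _ hs hs' fun c j => ?_
  have h1 := finrank_ker_pow_jordanMap eig size 1 (-c) (Or.inl one_ne_zero) j
  have h2 := finrank_ker_pow_jordanMap eig' size' 1 (-c) (Or.inl one_ne_zero) j
  simp only [← sub_eq_add_neg, one_mul, sub_eq_zero] at h1 h2
  have e1 : (1 : K) • jordanMap eig size + (-c) • LinearMap.id =
      jordanMap eig size - c • LinearMap.id := by
    refine LinearMap.ext fun x => ?_
    rw [LinearMap.add_apply, LinearMap.sub_apply, LinearMap.smul_apply, LinearMap.smul_apply,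
      LinearMap.smul_apply, one_smul, neg_smul, sub_eq_add_neg]
  have e2 : (1 : K) • jordanMap eig' size' + (-c) • LinearMap.id =
      jordanMap eig' size' - c • LinearMap.id := by
    refine LinearMap.ext fun x => ?_
    rw [LinearMap.add_apply, LinearMap.sub_apply, LinearMap.smul_apply, LinearMap.smul_apply,
      LinearMap.smul_apply, one_smul, neg_smul, sub_eq_add_neg]
  rw [e1] at h1
  rw [e2] at h2
  rw [← h1, ← h2, h]

/-- Permuting the blocks of a Jordan matrix. -/
theorem exists_equiv_jordanMap_perm (eig : ι → K) (size : ι → ℕ) (eig' : ι' → K) (size' : ι' → ℕ)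
    (σ : ι ≃ ι') (h : ∀ i, eig' (σ i) = eig i ∧ size' (σ i) = size i) :
    ∃ e : ((Σ i, Fin (size i)) → K) ≃ₗ[K] ((Σ i, Fin (size' i)) → K),
      ∀ x, e (jordanMap eig size x) = jordanMap eig' size' (e x) := by
  obtain rfl : size = fun i => size' (σ i) := funext fun i => (h i).2.symm
  obtain rfl : eig = fun i => eig' (σ i) := funext fun i => (h i).1.symm
  let τ : (Σ i, Fin (size' (σ i))) ≃ Σ i, Fin (size' i) :=
    Equiv.sigmaCongrLeft (β := fun i => Fin (size' i)) σ
  refine ⟨LinearEquiv.funCongrLeft K K τ.symm, fun x => ?_⟩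
  ext p
  obtain ⟨⟨i, k⟩, rfl⟩ := τ.surjective p
  have hτ : ∀ i k, τ ⟨i, k⟩ = ⟨σ i, k⟩ := fun _ _ => rfl
  rw [jordanMap_apply]
  simp only [LinearEquiv.funCongrLeft_apply, LinearMap.funLeft_apply, Equiv.symm_apply_apply]
  rw [jordanMap_apply]
  simp only [hτ]
  congr 2
  funext h3
  exact congrArg x (τ.symm_apply_apply ⟨i, ⟨k.val + 1, h3⟩⟩).symm

theorem finrank_ker_pow_congr {E E' : Type*} [AddCommGroup E] [Module K E] [AddCommGroup E']
    [Module K E'] (f : E →ₗ[K] E) (g : E' →ₗ[K] E') (e : E ≃ₗ[K] E') (he : ∀ x, e (f x) = g (e x))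
    (j : ℕ) : finrank K (LinearMap.ker (f ^ j)) = finrank K (LinearMap.ker (g ^ j)) := by
  have hp : ∀ x, e ((f ^ j) x) = (g ^ j) (e x) := by
    induction j with
    | zero => simp
    | succ j ih =>
      intro x
      rw [pow_succ, pow_succ, Module.End.mul_apply, Module.End.mul_apply, ih, he]
  refine LinearEquiv.finrank_eq (e.submoduleMap _ |>.trans (LinearEquiv.ofEq _ _ ?_))
  ext z
  obtain ⟨x, rfl⟩ := e.surjective z
  simp [← hp]

/-- Endomorphisms are similar if the kernels of powers have the same dimensions. -/
theorem exists_equiv_of_finrank_ker_pow_eq [IsAlgClosed K] {E E' : Type*} [AddCommGroup E]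
    [Module K E] [FiniteDimensional K E] [AddCommGroup E'] [Module K E'] [FiniteDimensional K E']
    (f : E →ₗ[K] E) (g : E' →ₗ[K] E')
    (h : ∀ (c : K) (j : ℕ), finrank K (LinearMap.ker ((f - c • LinearMap.id) ^ j)) =
      finrank K (LinearMap.ker ((g - c • LinearMap.id : E' →ₗ[K] E') ^ j))) :
    ∃ e : E ≃ₗ[K] E', ∀ x, e (f x) = g (e x) := by
  obtain ⟨b, eig, size, y, v, hs, h0, h1, h2⟩ := exists_jordan_chains f
  obtain ⟨b', eig', size', y', v', hs', h0', h1', h2'⟩ := exists_jordan_chains g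
  have e1 := exists_equiv_jordanMap_of_chains f eig size y v h0 h1 h2
  have e2 := exists_equiv_jordanMap_of_chains g eig' size' y' v' h0' h1' h2'
  obtain ⟨σ, hσ⟩ := exists_equiv_of_finrank_ker_pow eig size eig' size' hs hs' fun c j => by
    rw [← finrank_ker_pow_congr (f - c • LinearMap.id) _ v.equivFun (fun x => by
        rw [LinearMap.sub_apply, map_sub, e1]; simp) j,
      ← finrank_ker_pow_congr (g - c • LinearMap.id) _ v'.equivFun (fun x => by
        rw [LinearMap.sub_apply, map_sub, e2]; simp) j, h]
  obtain ⟨e, he⟩ := exists_equiv_jordanMap_perm eig size eig' size' σ hσ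
  refine ⟨v.equivFun.trans (e.trans v'.equivFun.symm), fun x => ?_⟩
  apply v'.equivFun.injective
  rw [e2]
  simp only [LinearEquiv.trans_apply, LinearEquiv.apply_symm_apply]
  rw [e1, he]

end Similarity

end Pencil

namespace Pencil

open Module

/-! ### Strict equivalence of pencils -/

section Iso

variable {K : Type*} [Field K]
variable {V W V' W' V'' W'' : Type*} [AddCommGroup V] [Module K V] [AddCommGroup W] [Module K W]
  [AddCommGroup V'] [Module K V'] [AddCommGroup W'] [Module K W']
  [AddCommGroup V''] [Module K V''] [AddCommGroup W''] [Module K W'']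

/-- Strict equivalence of two pencils of linear maps. -/
def Iso (A B : V →ₗ[K] W) (A' B' : V' →ₗ[K] W') : Prop :=
  ∃ (e : V ≃ₗ[K] V') (f : W ≃ₗ[K] W'), (∀ x, f (A x) = A' (e x)) ∧ ∀ x, f (B x) = B' (e x)

theorem Iso.refl (A B : V →ₗ[K] W) : Iso A B A B :=
  ⟨LinearEquiv.refl K V, LinearEquiv.refl K W, fun _ => rfl, fun _ => rfl⟩

theorem Iso.symm {A B : V →ₗ[K] W} {A' B' : V' →ₗ[K] W'} (h : Iso A B A' B') : Iso A' B' A B := by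
  obtain ⟨e, f, h1, h2⟩ := h
  refine ⟨e.symm, f.symm, fun x => ?_, fun x => ?_⟩
  · rw [LinearEquiv.symm_apply_eq, h1, LinearEquiv.apply_symm_apply]
  · rw [LinearEquiv.symm_apply_eq, h2, LinearEquiv.apply_symm_apply]

theorem Iso.trans {A B : V →ₗ[K] W} {A' B' : V' →ₗ[K] W'} {A'' B'' : V'' →ₗ[K] W''}
    (h : Iso A B A' B') (h' : Iso A' B' A'' B'') : Iso A B A'' B'' := by
  obtain ⟨e, f, h1, h2⟩ := h
  obtain ⟨e', f', h1', h2'⟩ := h'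
  exact ⟨e.trans e', f.trans f', fun x => by simp [h1, h1'], fun x => by simp [h2, h2']⟩

theorem Iso.comb {A B : V →ₗ[K] W} {A' B' : V' →ₗ[K] W'} (h : Iso A B A' B') (a b c d : K) :
    Iso (a • A + b • B) (c • A + d • B) (a • A' + b • B') (c • A' + d • B') := by
  obtain ⟨e, f, h1, h2⟩ := h
  exact ⟨e, f, fun x => by simp [h1, h2], fun x => by simp [h1, h2]⟩

theorem Iso.prodMap {V₁ W₁ V₁' W₁' : Type*} [AddCommGroup V₁] [Module K V₁] [AddCommGroup W₁]
    [Module K W₁] [AddCommGroup V₁'] [Module K V₁'] [AddCommGroup W₁'] [Module K W₁']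
    {A B : V →ₗ[K] W} {A' B' : V' →ₗ[K] W'} {A₁ B₁ : V₁ →ₗ[K] W₁} {A₁' B₁' : V₁' →ₗ[K] W₁'}
    (h : Iso A B A' B') (h₁ : Iso A₁ B₁ A₁' B₁') :
    Iso (A.prodMap A₁) (B.prodMap B₁) (A'.prodMap A₁') (B'.prodMap B₁') := by
  obtain ⟨e, f, h1, h2⟩ := h
  obtain ⟨e', f', h1', h2'⟩ := h₁
  exact ⟨e.prodCongr e', f.prodCongr f', fun x => by simp [h1, h1'], fun x => by simp [h2, h2']⟩

end Iso

/-! ### Iterated linear relations and their invariance -/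

section RelIter

variable {K : Type*} [Field K]
variable {V W V' W' : Type*} [AddCommGroup V] [Module K V] [AddCommGroup W] [Module K W]
  [AddCommGroup V'] [Module K V'] [AddCommGroup W'] [Module K W']

/-- The iterates of `S` under the linear relation `A⁻¹ B`. -/
def relIter (A B : V →ₗ[K] W) (S : Submodule K V) : ℕ → Submodule K V
  | 0 => S
  | j + 1 => ((relIter A B S j).map B).comap A

theorem relIter_zero (A B : V →ₗ[K] W) (S : Submodule K V) : relIter A B S 0 = S := rfl

theorem mem_relIter_succ {A B : V →ₗ[K] W} {S : Submodule K V} {j : ℕ} {x : V} :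
    x ∈ relIter A B S (j + 1) ↔ ∃ y ∈ relIter A B S j, B y = A x := Iff.rfl

theorem relIter_bot_le_succ (A B : V →ₗ[K] W) (j : ℕ) :
    relIter A B ⊥ j ≤ relIter A B ⊥ (j + 1) := by
  induction j with
  | zero => exact bot_le
  | succ j ih => exact Submodule.comap_mono (Submodule.map_mono ih)

theorem relIter_bot_mono (A B : V →ₗ[K] W) : Monotone (relIter A B ⊥) :=
  monotone_nat_of_le_succ (relIter_bot_le_succ A B)

theorem relIter_top_succ_le (A B : V →ₗ[K] W) (j : ℕ) :
    relIter A B ⊤ (j + 1) ≤ relIter A B ⊤ j := by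
  induction j with
  | zero => exact le_top
  | succ j ih => exact Submodule.comap_mono (Submodule.map_mono ih)

theorem map_relIter {A B : V →ₗ[K] W} {A' B' : V' →ₗ[K] W'} (e : V ≃ₗ[K] V') (f : W ≃ₗ[K] W')
    (h1 : ∀ x, f (A x) = A' (e x)) (h2 : ∀ x, f (B x) = B' (e x)) (S : Submodule K V) (j : ℕ) :
    (relIter A B S j).map (e : V →ₗ[K] V') = relIter A' B' (S.map (e : V →ₗ[K] V')) j := by
  induction j with
  | zero => rfl
  | succ j ih =>
    ext z
    obtain ⟨x, rfl⟩ := e.surjective z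
    rw [mem_relIter_succ, ← ih]
    simp only [Submodule.mem_map, LinearEquiv.coe_coe, EmbeddingLike.apply_eq_iff_eq,
      exists_eq_right, exists_exists_and_eq_and, ← h1, ← h2, mem_relIter_succ]

theorem Iso.finrank_relIter_bot {A B : V →ₗ[K] W} {A' B' : V' →ₗ[K] W'} (h : Iso A B A' B')
    (j : ℕ) : finrank K (relIter A B ⊥ j) = finrank K (relIter A' B' ⊥ j) := by
  obtain ⟨e, f, h1, h2⟩ := h
  have := map_relIter e f h1 h2 ⊥ j
  rw [Submodule.map_bot] at this
  rw [← this]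
  exact (e.submoduleMap _).finrank_eq

theorem Iso.finrank_relIter_top {A B : V →ₗ[K] W} {A' B' : V' →ₗ[K] W'} (h : Iso A B A' B')
    (j : ℕ) : finrank K (relIter A B ⊤ j) = finrank K (relIter A' B' ⊤ j) := by
  obtain ⟨e, f, h1, h2⟩ := h
  have := map_relIter e f h1 h2 ⊤ j
  rw [Submodule.map_top, LinearEquiv.range] at this
  rw [← this]
  exact (e.submoduleMap _).finrank_eq

theorem Iso.swap {A B : V →ₗ[K] W} {A' B' : V' →ₗ[K] W'} (h : Iso A B A' B') : Iso B A B' A' := by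
  obtain ⟨e, f, h1, h2⟩ := h
  exact ⟨e, f, h2, h1⟩

theorem relIter_prodMap (A B : V →ₗ[K] W) (A' B' : V' →ₗ[K] W') (S : Submodule K V)
    (S' : Submodule K V') (j : ℕ) :
    relIter (A.prodMap A') (B.prodMap B') (S.prod S') j =
      (relIter A B S j).prod (relIter A' B' S' j) := by
  induction j with
  | zero => rfl
  | succ j ih =>
    ext ⟨x, y⟩
    rw [mem_relIter_succ, ih, Submodule.mem_prod, mem_relIter_succ, mem_relIter_succ]
    simp only [Prod.exists, Submodule.mem_prod, LinearMap.prodMap_apply, Prod.mk.injEq]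
    constructor
    · rintro ⟨u, v, ⟨hu, hv⟩, h1, h2⟩
      exact ⟨⟨u, hu, h1⟩, ⟨v, hv, h2⟩⟩
    · rintro ⟨⟨u, hu, h1⟩, ⟨v, hv, h2⟩⟩
      exact ⟨u, v, ⟨hu, hv⟩, h1, h2⟩

theorem finrank_submodule_prod [FiniteDimensional K V] [FiniteDimensional K V']
    (S : Submodule K V) (S' : Submodule K V') :
    finrank K (S.prod S') = finrank K S + finrank K S' := by
  let e : S.prod S' ≃ₗ[K] S × S' :=
    { toFun := fun x => (⟨x.1.1, x.2.1⟩, ⟨x.1.2, x.2.2⟩)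
      map_add' := fun _ _ => rfl
      map_smul' := fun _ _ => rfl
      invFun := fun y => ⟨(y.1.1, y.2.1), y.1.2, y.2.2⟩
      left_inv := fun _ => rfl
      right_inv := fun _ => rfl }
  rw [e.finrank_eq, finrank_prod]

theorem finrank_relIter_bot_prodMap [FiniteDimensional K V] [FiniteDimensional K V']
    (A B : V →ₗ[K] W) (A' B' : V' →ₗ[K] W') (j : ℕ) :
    finrank K (relIter (A.prodMap A') (B.prodMap B') ⊥ j) =
      finrank K (relIter A B ⊥ j) + finrank K (relIter A' B' ⊥ j) := by
  rw [← finrank_submodule_prod, ← relIter_prodMap, Submodule.prod_bot]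

theorem finrank_relIter_top_prodMap [FiniteDimensional K V] [FiniteDimensional K V']
    (A B : V →ₗ[K] W) (A' B' : V' →ₗ[K] W') (j : ℕ) :
    finrank K (relIter (A.prodMap A') (B.prodMap B') ⊤ j) =
      finrank K (relIter A B ⊤ j) + finrank K (relIter A' B' ⊤ j) := by
  rw [← finrank_submodule_prod, ← relIter_prodMap, Submodule.prod_top]

/-- The relation here is f⁻¹, so its iterates of zero are the successive preimages of zero. -/
theorem relIter_id_eq_ker_pow (f : V →ₗ[K] V) (j : ℕ) :
    relIter f LinearMap.id ⊥ j = LinearMap.ker (f ^ j) := by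
  induction j with
  | zero => ext x; simp [relIter_zero]
  | succ j ih =>
    ext x
    rw [mem_relIter_succ, ih, pow_succ]
    simp

/-- Consequently the Jordan part contributes nothing to the invariants that determine the row
chains. -/
theorem relIter_id_bot (f : V →ₗ[K] V) (j : ℕ) : relIter LinearMap.id f ⊥ j = ⊥ := by
  induction j with
  | zero => rfl
  | succ j ih =>
    ext x
    rw [mem_relIter_succ, ih]
    simp [eq_comm]

/-- Consequently the Jordan part contributes its full dimension to the invariants that determine the
column chain. -/
theorem relIter_id_top (f : V →ₗ[K] V) (j : ℕ) : relIter f LinearMap.id ⊤ j = ⊤ := by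
  induction j with
  | zero => rfl
  | succ j ih =>
    ext x
    rw [mem_relIter_succ, ih]
    simp

end RelIter

/-! ### Model chains and the dimensions of their iterates -/

section ChainPencil

variable (K : Type*) [Field K] {ι : Type*}

/-- The index type of the rows of a direct sum of chains. -/
abbrev RowIndex (ε : ι → ℕ) (η : ℕ) : Type _ := (Σ i, Fin (ε i)) ⊕ Fin (η + 1)

/-- The index type of the columns of a direct sum of chains. -/
abbrev ColIndex (ε : ι → ℕ) (η : ℕ) : Type _ := (Σ i, Fin (ε i + 1)) ⊕ Fin η

/-- Prepending a zero. -/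
def colA (n : ℕ) : (Fin n → K) →ₗ[K] (Fin (n + 1) → K) where
  toFun x := Fin.cons (α := fun _ => K) 0 x
  map_add' x y := by
    ext k
    refine Fin.cases ?_ (fun k => ?_) k <;> simp
  map_smul' c x := by
    ext k
    refine Fin.cases ?_ (fun k => ?_) k <;> simp

/-- Appending a zero. -/
def colB (n : ℕ) : (Fin n → K) →ₗ[K] (Fin (n + 1) → K) where
  toFun x := Fin.snoc (α := fun _ => K) x 0
  map_add' x y := by
    ext k
    refine Fin.lastCases ?_ (fun k => ?_) k <;> simp
  map_smul' c x := by
    ext k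
    refine Fin.lastCases ?_ (fun k => ?_) k <;> simp

@[simp] theorem colA_zero (n : ℕ) (x : Fin n → K) : colA K n x 0 = 0 := rfl

@[simp] theorem colA_succ (n : ℕ) (x : Fin n → K) (k : Fin n) : colA K n x k.succ = x k := rfl

@[simp] theorem colB_last (n : ℕ) (x : Fin n → K) : colB K n x (Fin.last n) = 0 := by
  simp [colB]

@[simp] theorem colB_castSucc (n : ℕ) (x : Fin n → K) (k : Fin n) :
    colB K n x k.castSucc = x k := by
  simp [colB]

/-- Removing the first coordinate. -/
def rowA (n : ℕ) : (Fin (n + 1) → K) →ₗ[K] (Fin n → K) := LinearMap.funLeft K K Fin.succ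

/-- Removing the last coordinate. -/
def rowB (n : ℕ) : (Fin (n + 1) → K) →ₗ[K] (Fin n → K) := LinearMap.funLeft K K Fin.castSucc

@[simp] theorem rowA_apply (n : ℕ) (x : Fin (n + 1) → K) (k : Fin n) :
    rowA K n x k = x k.succ := rfl

@[simp] theorem rowB_apply (n : ℕ) (x : Fin (n + 1) → K) (k : Fin n) :
    rowB K n x k = x k.castSucc := rfl

/-- The first map of a direct sum of chains. -/
def chainA (ε : ι → ℕ) (η : ℕ) : (ColIndex ε η → K) →ₗ[K] (RowIndex ε η → K) where
  toFun x := Sum.elim (fun p => rowA K (ε p.1) (fun k => x (.inl ⟨p.1, k⟩)) p.2)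
    (colA K η fun k => x (.inr k))
  map_add' x y := by
    ext (p | k)
    · rfl
    · exact congrFun (map_add (colA K η) (fun k => x (.inr k)) (fun k => y (.inr k))) k
  map_smul' c x := by
    ext (p | k)
    · rfl
    · exact congrFun (map_smul (colA K η) c (fun k => x (.inr k))) k

/-- The second map of a direct sum of chains. -/
def chainB (ε : ι → ℕ) (η : ℕ) : (ColIndex ε η → K) →ₗ[K] (RowIndex ε η → K) where
  toFun x := Sum.elim (fun p => rowB K (ε p.1) (fun k => x (.inl ⟨p.1, k⟩)) p.2)
    (colB K η fun k => x (.inr k))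
  map_add' x y := by
    ext (p | k)
    · rfl
    · exact congrFun (map_add (colB K η) (fun k => x (.inr k)) (fun k => y (.inr k))) k
  map_smul' c x := by
    ext (p | k)
    · rfl
    · exact congrFun (map_smul (colB K η) c (fun k => x (.inr k))) k

@[simp] theorem chainA_inl (ε : ι → ℕ) (η : ℕ) (x : ColIndex ε η → K) (p : Σ i, Fin (ε i)) :
    chainA K ε η x (.inl p) = x (.inl ⟨p.1, p.2.succ⟩) := rfl

@[simp] theorem chainB_inl (ε : ι → ℕ) (η : ℕ) (x : ColIndex ε η → K) (p : Σ i, Fin (ε i)) :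
    chainB K ε η x (.inl p) = x (.inl ⟨p.1, p.2.castSucc⟩) := rfl

@[simp] theorem chainA_inr (ε : ι → ℕ) (η : ℕ) (x : ColIndex ε η → K) (k : Fin (η + 1)) :
    chainA K ε η x (.inr k) = colA K η (fun k => x (.inr k)) k := rfl

@[simp] theorem chainB_inr (ε : ι → ℕ) (η : ℕ) (x : ColIndex ε η → K) (k : Fin (η + 1)) :
    chainB K ε η x (.inr k) = colB K η (fun k => x (.inr k)) k := rfl

/-- On a row chain, `A x = B y` says that `x` is `y` shifted by one place, with a free first
coordinate, so each step frees one more coordinate. On the column chain `A` is injective and nothing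
is gained. -/
theorem relIter_chain_bot (ε : ι → ℕ) (η j : ℕ) :
    relIter (chainA K ε η) (chainB K ε η) ⊥ j =
      coordSubspace K {c | ∃ p : Σ i, Fin (ε i + 1), p.2.val < j ∧ c = .inl p} := by
  induction j with
  | zero =>
    ext x
    simp [relIter_zero, mem_coordSubspace, funext_iff]
  | succ j ih =>
    ext x
    rw [mem_relIter_succ, ih, mem_coordSubspace]
    constructor
    · rintro ⟨y, hy, h⟩
      have hy' : ∀ k, y (.inr k) = 0 := fun k => hy _ (by simp)
      rintro (⟨i, k⟩ | k) hc
      · have hk : j + 1 ≤ k.val := by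
          by_contra hk
          exact hc ⟨⟨i, k⟩, by simp; omega, rfl⟩
        obtain ⟨k, rfl⟩ := Fin.exists_succ_eq.2 (show k ≠ 0 by rintro rfl; simp at hk)
        have h1 := congrFun h (.inl ⟨i, k⟩)
        simp only [chainA_inl, chainB_inl] at h1
        rw [← h1]
        refine hy _ ?_
        rintro ⟨p, hp, h2⟩
        simp only [Sum.inl.injEq] at h2
        subst h2
        simp at hp hk
        omega
      · have h1 := congrFun h (.inr k.succ)
        simp only [chainA_inr, chainB_inr, colA_succ] at h1
        rw [← h1]
        simp only [hy']
        exact congrFun (map_zero (colB K η)) _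
    · intro h
      refine ⟨Sum.elim (fun p => if hk : p.2.val < ε p.1 then
        x (.inl ⟨p.1, (⟨p.2.val, hk⟩ : Fin (ε p.1)).succ⟩) else 0) 0, ?_, ?_⟩
      · rintro (⟨i, k⟩ | k) hc
        · simp only [Sum.elim_inl]
          split_ifs with hk
          · refine h _ ?_
            rintro ⟨p, hp, h2⟩
            simp only [Sum.inl.injEq] at h2
            subst h2
            simp at hp
            exact hc ⟨⟨i, k⟩, hp, rfl⟩
          · rfl
        · rfl
      · have hx : (fun k => x (.inr k)) = 0 := funext fun k => h _ (by simp)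
        ext (⟨i, k⟩ | k)
        · simp
          rfl
        · rw [chainA_inr, chainB_inr, hx]
          simp only [Sum.elim_inr]
          exact (congrFun (map_zero (colB K η)) _).trans (congrFun (map_zero (colA K η)) _).symm

/-- On the column chain, `B x = A y` says that `x` is `y` shifted with first coordinate zero, so
each step kills one more coordinate until none is left. On row chains `A` is surjective and nothing
is lost. -/
theorem relIter_chain_top (ε : ι → ℕ) (η j : ℕ) :
    relIter (chainB K ε η) (chainA K ε η) ⊤ j =
      coordSubspace K {c | ∀ k : Fin η, c = .inr k → j ≤ k.val} := by
  induction j with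
  | zero =>
    ext x
    simp [relIter_zero, mem_coordSubspace]
  | succ j ih =>
    ext x
    rw [mem_relIter_succ, ih, mem_coordSubspace]
    constructor
    · rintro ⟨y, hy, h⟩
      rintro (p | ⟨k, hk'⟩) hc
      · exact absurd (by simp) hc
      · have hk : k ≤ j := by
          by_contra hk
          refine hc ?_
          rintro k' h2
          simp only [Sum.inr.injEq] at h2
          subst h2
          simp
          omega
        have h1 := congrFun h (.inr (Fin.castSucc ⟨k, hk'⟩))
        simp only [chainA_inr, chainB_inr, colB_castSucc] at h1
        rw [← h1]
        cases k with
        | zero => rfl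
        | succ k =>
          have : Fin.castSucc ⟨k + 1, hk'⟩ = Fin.succ ⟨k, by omega⟩ := rfl
          rw [this, colA_succ]
          refine hy _ ?_
          intro h2
          have := h2 _ rfl
          simp at this
          omega
    · intro h
      refine ⟨Sum.elim (fun p => if hk : 0 < p.2.val then
        x (.inl ⟨p.1, ⟨p.2.val - 1, by omega⟩⟩) else 0)
        (fun k => if hk : k.val + 1 < η then x (.inr ⟨k.val + 1, hk⟩) else 0), ?_, ?_⟩
      · rintro (⟨i, k⟩ | k) hc
        · exact absurd (by simp) hc
        · simp only [Sum.elim_inr]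
          split_ifs with hk
          · refine h _ ?_
            intro h2
            refine hc fun k' hk' => ?_
            simp only [Sum.inr.injEq] at hk'
            subst hk'
            have := h2 _ rfl
            simpa using this
          · rfl
      · ext (⟨i, k⟩ | k)
        · simp
          rfl
        · rw [chainA_inr, chainB_inr]
          rcases k with ⟨k, hk⟩
          cases k with
          | zero =>
            refine (show (0 : K) = _ from ?_)
            rcases Nat.eq_zero_or_pos η with rfl | hη
            · exact (colB_last K 0 _).symm
            · have : (⟨0, hk⟩ : Fin (η + 1)) = Fin.castSucc ⟨0, hη⟩ := rfl
              rw [this, colB_castSucc]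
              exact (h _ fun h2 => by simpa using h2 _ rfl).symm
          | succ k =>
            have e1 : (⟨k + 1, hk⟩ : Fin (η + 1)) = Fin.succ ⟨k, by omega⟩ := rfl
            rw [e1, colA_succ, ← e1]
            simp only [Sum.elim_inr]
            split_ifs with h3
            · have e2 : (⟨k + 1, hk⟩ : Fin (η + 1)) = Fin.castSucc ⟨k + 1, h3⟩ := rfl
              rw [e2, colB_castSucc]
            · have e2 : (⟨k + 1, hk⟩ : Fin (η + 1)) = Fin.last η := by
                ext
                simp
                omega
              rw [e2, colB_last]

theorem finrank_relIter_chain_bot [Fintype ι] (ε : ι → ℕ) (η j : ℕ) :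
    finrank K (relIter (chainA K ε η) (chainB K ε η) ⊥ j) = ∑ i, min j (ε i + 1) := by
  rw [relIter_chain_bot, finrank_coordSubspace]
  have := card_chain_initial (fun i => ε i + 1) (fun _ : ι => True) j
  simp only [true_and, if_true] at this
  rw [← this]
  refine Nat.card_congr (Equiv.ofBijective (fun p => ⟨.inl p.1, p.1, p.2, rfl⟩) ⟨?_, ?_⟩).symm
  · rintro ⟨p, hp⟩ ⟨p', hp'⟩ h
    simpa using h
  · rintro ⟨c, p, hp, rfl⟩
    exact ⟨⟨p, hp⟩, rfl⟩

theorem finrank_relIter_chain_top_add [Fintype ι] (ε : ι → ℕ) (η j : ℕ) :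
    finrank K (relIter (chainB K ε η) (chainA K ε η) ⊤ j) + min j η =
      Fintype.card (ColIndex ε η) := by
  classical
  rw [relIter_chain_top, finrank_coordSubspace, Nat.card_eq_fintype_card, Fintype.card_subtype]
  have h1 : min j η = (Finset.univ.filter fun c : ColIndex ε η =>
      ¬ c ∈ {c : ColIndex ε η | ∀ k : Fin η, c = .inr k → j ≤ k.val}).card := by
    have : (Finset.univ.filter fun c : ColIndex ε η =>
        ¬ c ∈ {c : ColIndex ε η | ∀ k : Fin η, c = .inr k → j ≤ k.val}) =
        (Finset.univ.filter fun k : Fin η => k.val < j).map ⟨Sum.inr, Sum.inr_injective⟩ := by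
      ext (p | k) <;> simp
    rw [this, Finset.card_map, Fin.card_filter_val_lt, min_comm]
  rw [h1, Finset.card_filter_add_card_filter_not, Finset.card_univ]

end ChainPencil

end Pencil

namespace Pencil

open Module Polynomial

/-! ### Invariance of chains under a change of generators -/

section Mobius

variable {K : Type*} [Field K]

/-- The linear combinations of the products `P ^ k * Q ^ (n - 1 - k)`. -/
def binaryForm (P Q : K[X]) (n : ℕ) : (Fin n → K) →ₗ[K] K[X] :=
  ∑ k : Fin n, (LinearMap.proj k).smulRight (P ^ k.val * Q ^ (n - 1 - k.val))

theorem binaryForm_apply (P Q : K[X]) (n : ℕ) (x : Fin n → K) :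
    binaryForm P Q n x = ∑ k : Fin n, x k • (P ^ k.val * Q ^ (n - 1 - k.val)) := by
  simp [binaryForm]

/-- Together with `binaryForm_colB`: the two maps of a column chain become multiplication by `P` and
by `Q`. -/
theorem binaryForm_colA (P Q : K[X]) (n : ℕ) (x : Fin n → K) :
    binaryForm P Q (n + 1) (colA K n x) = P * binaryForm P Q n x := by
  rw [binaryForm_apply, binaryForm_apply, Fin.sum_univ_succ, colA_zero, zero_smul, zero_add,
    Finset.mul_sum]
  refine Finset.sum_congr rfl fun k _ => ?_
  have : n + 1 - 1 - (k.val + 1) = n - 1 - k.val := by omega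
  rw [colA_succ, Fin.val_succ, this, mul_smul_comm, pow_succ]
  ring_nf

theorem binaryForm_colB (P Q : K[X]) (n : ℕ) (x : Fin n → K) :
    binaryForm P Q (n + 1) (colB K n x) = Q * binaryForm P Q n x := by
  rw [binaryForm_apply, binaryForm_apply, Fin.sum_univ_castSucc, colB_last, zero_smul, add_zero,
    Finset.mul_sum]
  refine Finset.sum_congr rfl fun k _ => ?_
  have : n + 1 - 1 - k.val = n - 1 - k.val + 1 := by omega
  rw [colB_castSucc, Fin.val_castSucc, this, mul_smul_comm, pow_succ]
  ring_nf

theorem binaryForm_X_one_injective (n : ℕ) : Function.Injective (binaryForm (X : K[X]) 1 n) := by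
  rw [injective_iff_map_eq_zero]
  intro x hx
  ext k
  rw [binaryForm_apply] at hx
  have := congrArg (fun p => p.coeff k.val) hx
  simpa [Polynomial.finsetSum_coeff, Polynomial.coeff_X_pow, Fin.val_inj] using this

theorem eq_colA_add_smul_colB (n : ℕ) (x : Fin (n + 2) → K) :
    x = colA K (n + 1) (fun k => x k.succ) + colB K (n + 1) (Pi.single 0 (x 0)) := by
  ext k
  refine Fin.cases ?_ (fun k => ?_) k
  · rw [Pi.add_apply, colA_zero, zero_add]
    exact (colB_castSucc K (n + 1) (Pi.single 0 (x 0)) 0).symm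
  · rw [Pi.add_apply, colA_succ]
    have : colB K (n + 1) (Pi.single 0 (x 0)) k.succ = 0 := by
      refine Fin.lastCases ?_ (fun k => ?_) k
      · rw [Fin.succ_last, colB_last]
      · rw [Fin.succ_castSucc, colB_castSucc, Pi.single_eq_of_ne (Fin.succ_ne_zero k)]
    rw [this, add_zero]

/-- By Cramer's rule `X` and `1` are linear combinations of the two linear polynomials `P` and `Q`.
A form of the next degree is `X` times a form plus `1` times a form, so the inclusion propagates by
induction. -/
theorem range_binaryForm_X_one_le (a b c d : K) (hdet : a * d - b * c ≠ 0) (n : ℕ) :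
    LinearMap.range (binaryForm (X : K[X]) 1 n) ≤
      LinearMap.range (binaryForm (C a * X + C b) (C c * X + C d) n) := by
  induction n with
  | zero =>
    rintro _ ⟨x, rfl⟩
    simp [binaryForm_apply]
  | succ n ih =>
    -- One coordinate is treated apart: the forms are then constants, and the splitting off of `X`
    -- needs two coordinates.
    cases n with
    | zero =>
      rintro _ ⟨x, rfl⟩
      exact ⟨x, by simp [binaryForm_apply]⟩
    | succ n =>
      set P := C a * X + C b with hP
      set Q := C c * X + C d with hQ
      have hmul : ∀ p ∈ LinearMap.range (binaryForm P Q (n + 1)), ∀ u v : K,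
          (C u * P + C v * Q) * p ∈ LinearMap.range (binaryForm P Q (n + 2)) := by
        rintro _ ⟨y, rfl⟩ u v
        refine ⟨u • colA K _ y + v • colB K _ y, ?_⟩
        rw [map_add, map_smul, map_smul, binaryForm_colA, binaryForm_colB, Polynomial.smul_eq_C_mul,
          Polynomial.smul_eq_C_mul]
        ring
      have hX : C (d / (a * d - b * c)) * P + C (-b / (a * d - b * c)) * Q = X := by
        have h1 : d / (a * d - b * c) * a + -b / (a * d - b * c) * c = 1 := by
          rw [div_mul_eq_mul_div, div_mul_eq_mul_div, ← add_div, div_eq_one_iff_eq hdet]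
          ring
        have h2 : d / (a * d - b * c) * b + -b / (a * d - b * c) * d = 0 := by
          field_simp
          ring
        calc _ = C (d / (a * d - b * c) * a + -b / (a * d - b * c) * c) * X +
              C (d / (a * d - b * c) * b + -b / (a * d - b * c) * d) := by
              simp only [hP, hQ, C_add, C_mul]
              ring
          _ = X := by rw [h1, h2]; simp
      have h1 : C (-c / (a * d - b * c)) * P + C (a / (a * d - b * c)) * Q = 1 := by
        have h1 : -c / (a * d - b * c) * a + a / (a * d - b * c) * c = 0 := by
          field_simp
          ring
        have h2 : -c / (a * d - b * c) * b + a / (a * d - b * c) * d = 1 := by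
          rw [div_mul_eq_mul_div, div_mul_eq_mul_div, ← add_div, div_eq_one_iff_eq hdet]
          ring
        calc _ = C (-c / (a * d - b * c) * a + a / (a * d - b * c) * c) * X +
              C (-c / (a * d - b * c) * b + a / (a * d - b * c) * d) := by
              simp only [hP, hQ, C_add, C_mul]
              ring
          _ = 1 := by rw [h1, h2]; simp
      have hX' : ∀ p ∈ LinearMap.range (binaryForm P Q (n + 1)),
          X * p ∈ LinearMap.range (binaryForm P Q (n + 2)) := by
        intro p hp
        have := hmul p hp (d / (a * d - b * c)) (-b / (a * d - b * c))
        rwa [hX] at this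
      have h1' : ∀ p ∈ LinearMap.range (binaryForm P Q (n + 1)),
          1 * p ∈ LinearMap.range (binaryForm P Q (n + 2)) := by
        intro p hp
        have := hmul p hp (-c / (a * d - b * c)) (a / (a * d - b * c))
        rwa [h1] at this
      rintro _ ⟨x, rfl⟩
      have hx : binaryForm X 1 (n + 2) x =
          X * binaryForm X 1 (n + 1) (fun k => x k.succ) +
            1 * binaryForm X 1 (n + 1) (Pi.single 0 (x 0)) := by
        rw [← binaryForm_colA, ← binaryForm_colB, ← map_add, ← eq_colA_add_smul_colB]
      rw [hx]
      exact Submodule.add_mem _ (hX' _ (ih (LinearMap.mem_range_self _ _)))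
        (h1' _ (ih (LinearMap.mem_range_self _ _)))

/-- The monomials are independent, so the smaller range already has dimension `n`. Equality of the
ranges and injectivity of the second form follow by counting, and `e` changes coordinates between
the two bases. -/
theorem exists_equiv_binaryForm (a b c d : K) (hdet : a * d - b * c ≠ 0) (n : ℕ) :
    ∃ e : (Fin n → K) ≃ₗ[K] (Fin n → K), ∀ x,
      binaryForm (X : K[X]) 1 n (e x) = binaryForm (C a * X + C b) (C c * X + C d) n x := by
  have hle := range_binaryForm_X_one_le a b c d hdet n
  have hfr := LinearMap.finrank_range_of_inj (binaryForm_X_one_injective (K := K) n)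
  have heq : LinearMap.range (binaryForm (X : K[X]) 1 n) =
      LinearMap.range (binaryForm (C a * X + C b) (C c * X + C d) n) := by
    refine Submodule.eq_of_le_of_finrank_le hle ?_
    rw [hfr]
    exact LinearMap.finrank_range_le _
  have hinj : Function.Injective (binaryForm (C a * X + C b) (C c * X + C d) n) := by
    rw [← LinearMap.ker_eq_bot, ← Submodule.finrank_eq_zero (R := K)]
    have := LinearMap.finrank_range_add_finrank_ker (binaryForm (C a * X + C b) (C c * X + C d) n)
    rw [← heq, hfr] at this
    omega
  refine ⟨(LinearEquiv.ofInjective _ hinj).trans ((LinearEquiv.ofEq _ _ heq.symm).trans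
    (LinearEquiv.ofInjective _ (binaryForm_X_one_injective n)).symm), fun x => ?_⟩
  have := LinearEquiv.apply_symm_apply (LinearEquiv.ofInjective _
    (binaryForm_X_one_injective (K := K) n)) (LinearEquiv.ofEq _ _ heq.symm
      (LinearEquiv.ofInjective _ hinj x))
  exact congrArg Subtype.val this

/-- The column chain is invariant under invertible linear combinations. -/
theorem iso_col_comb (a b c d : K) (hdet : a * d - b * c ≠ 0) (n : ℕ) :
    Iso (a • colA K n + b • colB K n) (c • colA K n + d • colB K n) (colA K n) (colB K n) := by
  obtain ⟨e, he⟩ := exists_equiv_binaryForm a b c d hdet n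
  obtain ⟨f, hf⟩ := exists_equiv_binaryForm a b c d hdet (n + 1)
  have key : ∀ u v x, binaryForm (X : K[X]) 1 (n + 1) (u • colA K n x + v • colB K n x) =
      (C u * X + C v) * binaryForm X 1 n x := by
    intro u v x
    rw [map_add, map_smul, map_smul, binaryForm_colA, binaryForm_colB, Polynomial.smul_eq_C_mul,
      Polynomial.smul_eq_C_mul]
    ring
  -- `e` and `f` re-expand a polynomial from products of the linear polynomials to monomials; both
  -- identities are checked on the polynomials themselves.
  refine Iso.symm ⟨e, f, fun x => ?_, fun x => ?_⟩
  · apply binaryForm_X_one_injective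
    rw [hf, binaryForm_colA, ← he, LinearMap.add_apply, LinearMap.smul_apply, LinearMap.smul_apply,
      key]
  · apply binaryForm_X_one_injective
    rw [hf, binaryForm_colB, ← he, LinearMap.add_apply, LinearMap.smul_apply, LinearMap.smul_apply,
      key]

theorem toMatrix'_rowA (n : ℕ) :
    LinearMap.toMatrix' (rowA K n) = (LinearMap.toMatrix' (colA K n)).transpose := by
  ext i j
  rw [Matrix.transpose_apply, LinearMap.toMatrix'_apply, LinearMap.toMatrix'_apply, rowA_apply]
  refine Fin.cases ?_ (fun j => ?_) j
  · simp
  · simp [Pi.single_apply, eq_comm]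

theorem toMatrix'_rowB (n : ℕ) :
    LinearMap.toMatrix' (rowB K n) = (LinearMap.toMatrix' (colB K n)).transpose := by
  ext i j
  rw [Matrix.transpose_apply, LinearMap.toMatrix'_apply, LinearMap.toMatrix'_apply, rowB_apply]
  refine Fin.lastCases ?_ (fun j => ?_) j
  · simp [(Fin.castSucc_lt_last i).ne]
  · simp [Pi.single_apply, eq_comm]

theorem exists_transpose_equiv {p q : Type*} [Fintype p] [Fintype q] [DecidableEq p] [DecidableEq q]
    (g : (p → K) ≃ₗ[K] (q → K)) : ∃ g' : (q → K) ≃ₗ[K] (p → K),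
      ∀ x, g' x = (LinearMap.toMatrix' (g : (p → K) →ₗ[K] (q → K))).transpose.mulVec x := by
  refine ⟨Matrix.toLin'OfInv
    (M' := (LinearMap.toMatrix' (g : (p → K) →ₗ[K] (q → K))).transpose)
    (M := (LinearMap.toMatrix' (g.symm : (q → K) →ₗ[K] (p → K))).transpose) ?_ ?_,
    fun x => rfl⟩
  · rw [← Matrix.transpose_mul, ← LinearMap.toMatrix'_comp]
    simp
  · rw [← Matrix.transpose_mul, ← LinearMap.toMatrix'_comp]
    simp

/-- Strictly equivalent pencils have strictly equivalent transposes. -/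
theorem Iso.transpose {m n m' n' : Type*} [Fintype m] [Fintype n] [Fintype m'] [Fintype n']
    [DecidableEq m] [DecidableEq n] [DecidableEq m'] [DecidableEq n']
    {A B : Matrix m n K} {A' B' : Matrix m' n' K}
    (h : Iso A.toLin' B.toLin' A'.toLin' B'.toLin') :
    Iso A.transpose.toLin' B.transpose.toLin' A'.transpose.toLin' B'.transpose.toLin' := by
  obtain ⟨e, f, h1, h2⟩ := h
  obtain ⟨e', he'⟩ := exists_transpose_equiv e
  obtain ⟨f', hf'⟩ := exists_transpose_equiv f
  refine Iso.symm ⟨f', e', fun y => ?_, fun y => ?_⟩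
  · rw [he', hf', Matrix.toLin'_apply, Matrix.toLin'_apply, Matrix.mulVec_mulVec,
      Matrix.mulVec_mulVec, ← Matrix.transpose_mul, ← Matrix.transpose_mul]
    congr 2
    have : (f : (m → K) →ₗ[K] _) ∘ₗ A.toLin' = A'.toLin' ∘ₗ (e : (n → K) →ₗ[K] _) :=
      LinearMap.ext h1
    have := congrArg LinearMap.toMatrix' this
    rw [LinearMap.toMatrix'_comp, LinearMap.toMatrix'_comp, LinearMap.toMatrix'_toLin',
      LinearMap.toMatrix'_toLin'] at this
    exact this.symm
  · rw [he', hf', Matrix.toLin'_apply, Matrix.toLin'_apply, Matrix.mulVec_mulVec,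
      Matrix.mulVec_mulVec, ← Matrix.transpose_mul, ← Matrix.transpose_mul]
    congr 2
    have : (f : (m → K) →ₗ[K] _) ∘ₗ B.toLin' = B'.toLin' ∘ₗ (e : (n → K) →ₗ[K] _) :=
      LinearMap.ext h2
    have := congrArg LinearMap.toMatrix' this
    rw [LinearMap.toMatrix'_comp, LinearMap.toMatrix'_comp, LinearMap.toMatrix'_toLin',
      LinearMap.toMatrix'_toLin'] at this
    exact this.symm

/-- The row chain is invariant under invertible linear combinations. -/
theorem iso_row_comb (a b c d : K) (hdet : a * d - b * c ≠ 0) (n : ℕ) :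
    Iso (a • rowA K n + b • rowB K n) (c • rowA K n + d • rowB K n) (rowA K n) (rowB K n) := by
  have h := iso_col_comb a b c d hdet n
  have hA : ∀ u v : K, (u • colA K n + v • colB K n) =
      (u • LinearMap.toMatrix' (colA K n) + v • LinearMap.toMatrix' (colB K n)).toLin' := by
    intro u v
    simp
  rw [hA, hA, ← Matrix.toLin'_toMatrix' (colA K n), ← Matrix.toLin'_toMatrix' (colB K n)] at h
  have h' := Iso.transpose h
  simp only [Matrix.transpose_add, Matrix.transpose_smul,
    ← toMatrix'_rowA, ← toMatrix'_rowB, map_add, map_smul, Matrix.toLin'_toMatrix'] at h'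
  exact h'

/-- A direct sum of chains is invariant under invertible linear combinations. -/
theorem iso_chain_comb {ι : Type*} (ε : ι → ℕ) (η : ℕ) (a b c d : K) (hdet : a * d - b * c ≠ 0) :
    Iso (a • chainA K ε η + b • chainB K ε η) (c • chainA K ε η + d • chainB K ε η)
      (chainA K ε η) (chainB K ε η) := by
  choose e f h1 h2 using fun n => iso_row_comb (K := K) a b c d hdet n
  obtain ⟨e', f', h1', h2'⟩ := iso_col_comb (K := K) a b c d hdet η
  have mk : ∀ (n : ι → ℕ) (m : ℕ) (u : ∀ i, (Fin (n i) → K) ≃ₗ[K] (Fin (n i) → K))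
      (w : (Fin m → K) ≃ₗ[K] (Fin m → K)),
      ∃ g : ((Σ i, Fin (n i)) ⊕ Fin m → K) ≃ₗ[K] ((Σ i, Fin (n i)) ⊕ Fin m → K),
        ∀ x, (∀ i, (fun k => g x (.inl ⟨i, k⟩)) = u i (fun k => x (.inl ⟨i, k⟩))) ∧
          (fun k => g x (.inr k)) = w (fun k => x (.inr k)) := by
    intro n m u w
    refine ⟨{ toFun := fun x => Sum.elim (fun p => u p.1 (fun k => x (.inl ⟨p.1, k⟩)) p.2)
                (w fun k => x (.inr k))
              map_add' := fun x y => ?_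
              map_smul' := fun r x => ?_
              invFun := fun x => Sum.elim
                (fun p => (u p.1).symm (fun k => x (.inl ⟨p.1, k⟩)) p.2)
                (w.symm fun k => x (.inr k))
              left_inv := fun x => ?_
              right_inv := fun x => ?_ }, fun x => ⟨fun i => rfl, rfl⟩⟩
    · ext (p | k)
      · exact congrFun (map_add (u p.1) (fun k => x (.inl ⟨p.1, k⟩))
          (fun k => y (.inl ⟨p.1, k⟩))) p.2
      · exact congrFun (map_add w (fun k => x (.inr k)) (fun k => y (.inr k))) k
    · ext (p | k)
      · exact congrFun (map_smul (u p.1) r (fun k => x (.inl ⟨p.1, k⟩))) p.2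
      · exact congrFun (map_smul w r (fun k => x (.inr k))) k
    · ext (p | k)
      · exact congrFun ((u p.1).symm_apply_apply (fun k => x (.inl ⟨p.1, k⟩))) p.2
      · exact congrFun (w.symm_apply_apply (fun k => x (.inr k))) k
    · ext (p | k)
      · exact congrFun ((u p.1).apply_symm_apply (fun k => x (.inl ⟨p.1, k⟩))) p.2
      · exact congrFun (w.apply_symm_apply (fun k => x (.inr k))) k
  obtain ⟨E, hE⟩ := mk (fun i => ε i + 1) η (fun i => e (ε i)) e'
  obtain ⟨F, hF⟩ := mk ε (η + 1) (fun i => f (ε i)) f'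
  refine ⟨E, F, fun x => ?_, fun x => ?_⟩
  · ext (⟨i, k⟩ | k)
    · refine (congrFun ((hF _).1 i) k).trans ?_
      refine (congrFun (h1 (ε i) fun k => x (.inl ⟨i, k⟩)) k).trans ?_
      rw [← (hE x).1 i]
      rfl
    · refine (congrFun (hF _).2 k).trans ?_
      refine (congrFun (h1' fun k => x (.inr k)) k).trans ?_
      rw [← (hE x).2]
      rfl
  · ext (⟨i, k⟩ | k)
    · refine (congrFun ((hF _).1 i) k).trans ?_
      refine (congrFun (h2 (ε i) fun k => x (.inl ⟨i, k⟩)) k).trans ?_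
      rw [← (hE x).1 i]
      rfl
    · refine (congrFun (hF _).2 k).trans ?_
      refine (congrFun (h2' fun k => x (.inr k)) k).trans ?_
      rw [← (hE x).2]
      rfl

end Mobius

end Pencil

namespace Pencil

open Module

/-! ### Iterates in a pencil whose first map has maximal rank -/

section Generic

variable {K V W : Type*} [Field K] [AddCommGroup V] [Module K V] [AddCommGroup W] [Module K W]

theorem exists_chain_of_mem_relIter_bot {A B : V →ₗ[K] W} (j : ℕ) :
    ∀ x ∈ relIter A B ⊥ (j + 1), ∃ z : ℕ → V, z j = x ∧ A (z 0) = 0 ∧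
      (∀ i < j, A (z (i + 1)) = B (z i)) ∧ ∀ i ≤ j, z i ∈ relIter A B ⊥ (i + 1) := by
  induction j with
  | zero =>
    intro x hx
    obtain ⟨y, hy, h⟩ := mem_relIter_succ.1 hx
    rw [relIter_zero, Submodule.mem_bot] at hy
    subst hy
    rw [map_zero] at h
    refine ⟨fun _ => x, rfl, h.symm, by simp, fun i hi => ?_⟩
    obtain rfl : i = 0 := by omega
    exact hx
  | succ j ih =>
    intro x hx
    obtain ⟨y, hy, h⟩ := mem_relIter_succ.1 hx
    obtain ⟨z, hz, h0, h1, h2⟩ := ih y hy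
    refine ⟨fun i => if i ≤ j then z i else x, by simp, by simpa using h0, fun i hi => ?_,
      fun i hi => ?_⟩
    · rcases Nat.lt_or_ge i j with h3 | h3
      · simp [h3.le, Nat.succ_le_of_lt h3, h1 i h3]
      · obtain rfl : i = j := by omega
        simp [hz, h]
    · by_cases h3 : i ≤ j
      · simpa [h3] using h2 i h3
      · obtain rfl : i = j + 1 := by omega
        simpa using hx

/-- The sum telescopes along the chain. Hence for `t ≠ 0` the range of `A - t • B` contains `B (z
j)`. -/
theorem sub_smul_apply_sum_pow_smul {A B : V →ₗ[K] W} (t : K) (z : ℕ → V) (j : ℕ)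
    (h0 : A (z 0) = 0) (h1 : ∀ i < j, A (z (i + 1)) = B (z i)) :
    A (∑ i ∈ Finset.range (j + 1), t ^ i • z i) - t • B (∑ i ∈ Finset.range (j + 1), t ^ i • z i) =
      -(t ^ (j + 1) • B (z j)) := by
  induction j with
  | zero => simp [h0]
  | succ j ih =>
    have := ih fun i hi => h1 i (by omega)
    rw [Finset.sum_range_succ, map_add, map_add, smul_add, add_sub_add_comm, this, map_smul,
      map_smul, h1 j (by omega), smul_smul, ← pow_succ']
    abel

/-- If `A` has the maximal rank in its pencil, then the iterates of `0` under `A⁻¹ B` are mapped by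
`B` into the range of `A`. -/
theorem apply_mem_range_of_mem_relIter_bot [Infinite K] [FiniteDimensional K V]
    [FiniteDimensional K W] {A B : V →ₗ[K] W}
    (hmax : ∀ a b : K, finrank K (LinearMap.range (a • A + b • B)) ≤
      finrank K (LinearMap.range A)) (j : ℕ) (x : V) (hx : x ∈ relIter A B ⊥ j) :
    B x ∈ LinearMap.range A := by
  by_contra hBx
  cases j with
  | zero =>
    rw [relIter_zero, Submodule.mem_bot] at hx
    subst hx
    exact hBx (by simp)
  | succ j =>
    obtain ⟨z, rfl, h0, h1, -⟩ := exists_chain_of_mem_relIter_bot j x hx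
    obtain ⟨S, hS⟩ := Submodule.exists_isCompl (LinearMap.ker A)
    -- `A - t B` on a complement of ker A, enlarged by the direction `B (z j)`. At `t = 0` it is
    -- injective because that direction lies outside the range of `A`.
    let L : K → (S × K →ₗ[K] W) := fun t =>
      ((A - t • B) ∘ₗ S.subtype).coprod (LinearMap.toSpanSingleton K W (B (z j)))
    have hL : ∀ t s c, L t (s, c) = A s - t • B s + c • B (z j) := fun t s c => rfl
    have hinj : LinearMap.ker (L 0) = ⊥ := by
      rw [LinearMap.ker_eq_bot']
      rintro ⟨s, c⟩ h
      rw [hL, zero_smul, sub_zero] at h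
      have hc : c = 0 := by
        by_contra hc
        refine hBx ⟨-c⁻¹ • s, ?_⟩
        rw [map_smul, eq_neg_of_add_eq_zero_left h, smul_neg, neg_smul, neg_neg, smul_smul,
          inv_mul_cancel₀ hc, one_smul]
      subst hc
      rw [zero_smul, add_zero] at h
      have hs : (s : V) ∈ LinearMap.ker A ⊓ S := ⟨h, s.2⟩
      rw [hS.inf_eq_bot, Submodule.mem_bot] at hs
      ext
      · exact hs
      · rfl
    obtain ⟨g, hg⟩ := LinearMap.exists_leftInverse_of_injective _ hinj
    let H : S × K →ₗ[K] S × K := g ∘ₗ B ∘ₗ S.subtype ∘ₗ LinearMap.fst K S K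
    -- A kernel vector of `L μ⁻¹` is an eigenvector of `H` for `μ`. A nonzero `μ` outside the finite
    -- spectrum exists because the field is infinite.
    have hfin : (spectrum K H ∪ {0}).Finite := (Module.End.finite_spectrum H).union (by simp)
    obtain ⟨μ, hμ⟩ := hfin.exists_notMem
    have hμ0 : μ ≠ 0 := fun h => hμ (Or.inr h)
    have hinj' : Function.Injective (L μ⁻¹) := by
      rw [injective_iff_map_eq_zero]
      rintro ⟨s, c⟩ h
      by_contra hne
      refine hμ (Or.inl (Module.End.HasEigenvalue.mem_spectrum
        (Module.End.hasEigenvalue_of_hasEigenvector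
          (x := (s, c)) ⟨Module.End.mem_eigenspace_iff.2 ?_, hne⟩)))
      have h2 : L 0 (s, c) = μ⁻¹ • B s := by
        rw [hL] at h ⊢
        rw [zero_smul, sub_zero, ← sub_eq_zero, ← h]
        abel
      have h3 : (s, c) = μ⁻¹ • H (s, c) := by
        have := congrArg g h2
        rw [map_smul] at this
        exact (LinearMap.congr_fun hg (s, c)).symm.trans this
      conv_rhs => rw [h3, smul_smul, mul_inv_cancel₀ hμ0, one_smul]
    -- By the telescoping identity the extra direction already lies in the range of `A - μ⁻¹ B`,
    -- whose rank therefore exceeds that of `A`, against maximality.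
    have hrange : LinearMap.range (L μ⁻¹) ≤ LinearMap.range ((1 : K) • A + (-μ⁻¹) • B) := by
      rintro _ ⟨⟨s, c⟩, rfl⟩
      have hz := sub_smul_apply_sum_pow_smul μ⁻¹ z j h0 h1
      set Z := ∑ i ∈ Finset.range (j + 1), μ⁻¹ ^ i • z i
      have hp : (μ⁻¹ ^ (j + 1)) ≠ 0 := pow_ne_zero _ (inv_ne_zero hμ0)
      refine ⟨s - (c * (μ⁻¹ ^ (j + 1))⁻¹) • Z, ?_⟩
      have hB : B (z j) = -((μ⁻¹ ^ (j + 1))⁻¹ • (A Z - μ⁻¹ • B Z)) := by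
        rw [hz, smul_neg, neg_neg, smul_smul, inv_mul_cancel₀ hp, one_smul]
      rw [hL, hB]
      simp only [LinearMap.add_apply, LinearMap.smul_apply, map_sub, map_smul]
      module
    have h4 := Submodule.finrank_mono hrange
    rw [LinearMap.finrank_range_of_inj hinj', finrank_prod, finrank_self] at h4
    have h5 := hmax 1 (-μ⁻¹)
    have h6 := LinearMap.finrank_range_add_finrank_ker A
    have h7 := Submodule.finrank_add_eq_of_isCompl hS
    omega

/-- Every `x` in an iterate of zero satisfies `B x = A y` with `y` in the next iterate, so the
relation can be followed forward indefinitely. -/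
theorem relIter_bot_le_relIter_top {A B : V →ₗ[K] W}
    (hA : ∀ j, ∀ x ∈ relIter A B ⊥ j, B x ∈ LinearMap.range A) (j : ℕ) :
    ∀ i, relIter A B ⊥ i ≤ relIter B A ⊤ j := by
  induction j with
  | zero => exact fun i => le_top
  | succ j ih =>
    intro i x hx
    obtain ⟨y, hy⟩ := hA i x hx
    exact mem_relIter_succ.2 ⟨y, ih (i + 1) (mem_relIter_succ.2 ⟨x, hx, hy.symm⟩), hy⟩

theorem relIter_stable {A B : V →ₗ[K] W} {S : Submodule K V} {n : ℕ}
    (h : relIter A B S (n + 1) = relIter A B S n) {m : ℕ} (hm : n ≤ m) :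
    relIter A B S m = relIter A B S n := by
  induction m, hm using Nat.le_induction with
  | base => rfl
  | succ m hm ih =>
    rw [← h]
    show ((relIter A B S m).map B).comap A = ((relIter A B S n).map B).comap A
    rw [ih]

theorem exists_relIter_bot_stable [FiniteDimensional K V] (A B : V →ₗ[K] W) :
    ∃ n, relIter A B ⊥ (n + 1) = relIter A B ⊥ n := by
  obtain ⟨n, hn⟩ := monotone_stabilizes_iff_noetherian.2
    (inferInstance : IsNoetherian K V) ⟨relIter A B ⊥, relIter_bot_mono A B⟩
  exact ⟨n, (hn (n + 1) (Nat.le_succ n)).symm⟩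

end Generic

/-! ### Splitting off the column chain -/

section ColChain

variable {K V W : Type*} [Field K] [AddCommGroup V] [Module K V] [AddCommGroup W] [Module K W]

/-- Unwinding membership gives the chain. It must begin with `B (v 0)` outside the range of `A`, for
otherwise `x` would survive one more step. -/
theorem exists_chain_of_mem_relIter_top {A B : V →ₗ[K] W} (m : ℕ) :
    ∀ x ∈ relIter B A ⊤ m, x ∉ relIter B A ⊤ (m + 1) → ∃ v : ℕ → V, v m = x ∧
      B (v 0) ∉ LinearMap.range A ∧ (∀ k < m, B (v (k + 1)) = A (v k)) ∧
      ∀ k ≤ m, v k ∉ relIter B A ⊤ (k + 1) := by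
  induction m with
  | zero =>
    intro x _ hx'
    refine ⟨fun _ => x, rfl, ?_, by simp, fun k hk => ?_⟩
    · rintro ⟨y, hy⟩
      exact hx' (mem_relIter_succ.2 ⟨y, trivial, hy⟩)
    · obtain rfl : k = 0 := by omega
      exact hx'
  | succ m ih =>
    intro x hx hx'
    obtain ⟨y, hy, h⟩ := mem_relIter_succ.1 hx
    obtain ⟨v, hv, h0, h1, h2⟩ := ih y hy fun hy' => hx' (mem_relIter_succ.2 ⟨y, hy', h⟩)
    refine ⟨fun i => if i ≤ m then v i else x, by simp, by simpa using h0, fun i hi => ?_,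
      fun i hi => ?_⟩
    · rcases Nat.lt_or_ge i m with h3 | h3
      · simp [h3.le, Nat.succ_le_of_lt h3, h1 i h3]
      · obtain rfl : i = m := by omega
        simp [hv, h]
    · by_cases h3 : i ≤ m
      · simpa [h3] using h2 i h3
      · obtain rfl : i = m + 1 := by omega
        simpa using hx'

theorem exists_sub_smul_mem_of_codim_one [FiniteDimensional K W] {R : Submodule K W}
    (hR : finrank K W = finrank K R + 1) {w : W} (hw : w ∉ R) (z : W) :
    ∃ c : K, z - c • w ∈ R := by
  have hlt : R < R ⊔ K ∙ w := by
    refine lt_of_le_of_ne le_sup_left fun h => hw ?_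
    rw [h]
    exact Submodule.mem_sup_right (Submodule.mem_span_singleton_self w)
  have h1 := Submodule.finrank_lt_finrank_of_lt hlt
  have h2 : R ⊔ K ∙ w = ⊤ := Submodule.eq_top_of_finrank_eq
    (le_antisymm (Submodule.finrank_le _) (by omega))
  have hz : z ∈ R ⊔ K ∙ w := h2 ▸ Submodule.mem_top
  obtain ⟨r, hr, s, hs, rfl⟩ := Submodule.mem_sup.1 hz
  obtain ⟨c, rfl⟩ := Submodule.mem_span_singleton.1 hs
  exact ⟨c, by simpa using hr⟩

/-- If the range of `A` is a hyperplane, then a column chain splits off from the pencil. -/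
theorem exists_col_chain [FiniteDimensional K V] [FiniteDimensional K W] (A B : V →ₗ[K] W)
    (hco : finrank K W = finrank K (LinearMap.range A) + 1) :
    ∃ (η : ℕ) (v : ℕ → V) (w : W), w ∉ LinearMap.range A ∧ (0 < η → B (v 0) = w) ∧
      (∀ k, k + 1 < η → B (v (k + 1)) = A (v k)) ∧
      relIter B A ⊤ (η + 1) = relIter B A ⊤ η ∧
      ⊤ ≤ relIter B A ⊤ η ⊔ Submodule.span K (Set.range fun k : Fin η => v k) ∧
      finrank K (relIter B A ⊤ η) + η ≤ finrank K V := by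
  classical
  have hst : ∃ n, relIter B A ⊤ (n + 1) = relIter B A ⊤ n := by
    by_contra! hne
    have hlt : ∀ n, finrank K (relIter B A ⊤ n) + n ≤ finrank K V := by
      intro n
      induction n with
      | zero => exact Submodule.finrank_le _
      | succ n ih =>
        have := Submodule.finrank_lt_finrank_of_lt
          (lt_of_le_of_ne (relIter_top_succ_le B A n) (hne n))
        omega
    have := hlt (finrank K V + 1)
    omega
  have hη := Nat.find_spec hst
  have hmin : ∀ k < Nat.find hst, relIter B A ⊤ (k + 1) ≠ relIter B A ⊤ k :=
    fun k hk => Nat.find_min hst hk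
  generalize Nat.find hst = η at hη hmin
  have hrank : ∀ n ≤ η, finrank K (relIter B A ⊤ n) + n ≤ finrank K V := by
    intro n
    induction n with
    | zero => exact fun _ => Submodule.finrank_le _
    | succ n ih =>
      intro hn
      have h1 := ih (by omega)
      have h2 := Submodule.finrank_lt_finrank_of_lt
        (lt_of_le_of_ne (relIter_top_succ_le B A n) (hmin n (by omega)))
      omega
  have hw : ∃ w : W, w ∉ LinearMap.range A := by
    by_contra! h
    have : LinearMap.range A = ⊤ := eq_top_iff.2 fun w _ => h w
    rw [this, finrank_top] at hco
    omega
  cases η with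
  | zero =>
    obtain ⟨w, hw⟩ := hw
    exact ⟨0, fun _ => 0, w, hw, by simp, by simp, hη, by simp [relIter_zero], hrank 0 le_rfl⟩
  | succ m =>
    obtain ⟨x, hx, hx'⟩ := SetLike.exists_of_lt
      -- The last strict inclusion before stabilisation supplies a chain of full length `m + 1`.
      (lt_of_le_of_ne (relIter_top_succ_le B A m) (hmin m (by omega)))
    obtain ⟨v, -, h0, h1, h2⟩ := exists_chain_of_mem_relIter_top m x hx hx'
    refine ⟨m + 1, v, B (v 0), h0, fun _ => rfl, fun k hk => h1 k (by omega), hη, ?_,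
      hrank _ le_rfl⟩
    -- Each quotient of successive iterates is spanned by `v k`: for `k = 0` because the range of
    -- `A` is a hyperplane missing `B (v 0)`, and then by transport along the relation.
    have hstep : ∀ k ≤ m, ∀ x ∈ relIter B A ⊤ k, ∃ c : K, x - c • v k ∈ relIter B A ⊤ (k + 1) := by
      intro k
      induction k with
      | zero =>
        intro _ x _
        obtain ⟨c, y, hy⟩ := exists_sub_smul_mem_of_codim_one hco h0 (B x)
        exact ⟨c, mem_relIter_succ.2 ⟨y, trivial, by rw [hy, map_sub, map_smul]⟩⟩
      | succ k ih =>
        intro hk x hx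
        obtain ⟨y, hy, h⟩ := mem_relIter_succ.1 hx
        obtain ⟨c, hc⟩ := ih (by omega) y hy
        refine ⟨c, mem_relIter_succ.2 ⟨_, hc, ?_⟩⟩
        rw [map_sub, map_sub, map_smul, map_smul, h, h1 k (by omega)]
    have hspan : ∀ k ≤ m + 1, ⊤ ≤ relIter B A ⊤ k ⊔
        Submodule.span K (Set.range fun k : Fin (m + 1) => v k) := by
      intro k
      induction k with
      | zero => exact fun _ => le_sup_left
      | succ k ih =>
        intro hk
        refine (ih (by omega)).trans (sup_le (fun x hx => ?_) le_sup_right)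
        obtain ⟨c, hc⟩ := hstep k (by omega) x hx
        rw [← sub_add_cancel x (c • v k)]
        exact Submodule.add_mem_sup hc (Submodule.smul_mem _ _
          (Submodule.subset_span ⟨⟨k, by omega⟩, rfl⟩))
    exact hspan _ le_rfl

end ColChain

/-! ### Row chains in the limit of the iterates of zero -/

section RowChains

variable {K V W : Type*} [Field K] [AddCommGroup V] [Module K V] [AddCommGroup W] [Module K W]

/-- An independent set is extended from one member of the flag to the next; `deg` records the stage
at which a vector enters. -/
theorem exists_flag_basis_aux (D : ℕ → Submodule K V) (hD : Monotone D) (n : ℕ) :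
    ∃ (s : Set V) (deg : V → ℕ), LinearIndepOn K id s ∧
      ∀ j ≤ n, Submodule.span K {v ∈ s | deg v ≤ j} = D j := by
  classical
  have ext : ∀ (s : Set V) (E : Submodule K V), LinearIndepOn K id s → s ⊆ E →
      ∃ b : Set V, s ⊆ b ∧ LinearIndepOn K id b ∧ Submodule.span K b = E := by
    intro s E hs hsE
    obtain ⟨b, hbE, hsb, hE, hb⟩ := exists_linearIndepOn_id_extension hs hsE
    exact ⟨b, hsb, hb, le_antisymm (Submodule.span_le.2 hbE) hE⟩
  induction n with
  | zero =>
    obtain ⟨b, -, hb, hE⟩ := ext ∅ (D 0) (linearIndepOn_empty K _) (Set.empty_subset _)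
    refine ⟨b, fun _ => 0, hb, fun j hj => ?_⟩
    obtain rfl : j = 0 := by omega
    simpa using hE
  | succ n ih =>
    obtain ⟨s, deg, hs, hspan⟩ := ih
    set s' := {v ∈ s | deg v ≤ n} with hs'
    have hs'n : s' ⊆ D (n + 1) := by
      have := hspan n le_rfl
      refine (Submodule.subset_span.trans this.le).trans (hD (Nat.le_succ n))
    obtain ⟨b, hsb, hb, hE⟩ := ext s' (D (n + 1)) (hs.mono (Set.sep_subset _ _)) hs'n
    refine ⟨b, fun v => if v ∈ s' then deg v else n + 1, hb, fun j hj => ?_⟩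
    rcases Nat.lt_or_ge j (n + 1) with h | h
    · rw [← hspan j (by omega)]
      congr 1
      ext v
      constructor
      · rintro ⟨-, hv⟩
        by_cases hvs : v ∈ s'
        · simp only [hvs, if_true] at hv
          exact ⟨hvs.1, hv⟩
        · simp only [hvs, if_false] at hv
          omega
      · rintro ⟨hv, hvj⟩
        have hvs : v ∈ s' := ⟨hv, by omega⟩
        exact ⟨hsb hvs, by simpa [hvs] using hvj⟩
    · obtain rfl : j = n + 1 := by omega
      rw [← hE]
      congr 1
      ext v
      refine ⟨fun hv => hv.1, fun hv => ⟨hv, ?_⟩⟩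
      by_cases hvs : v ∈ s'
      · simpa [hvs] using hvs.2.trans (Nat.le_succ n)
      · simp [hvs]

/-- A basis adapted to a flag that is eventually constant. -/
theorem exists_flag_basis [FiniteDimensional K V] (D : ℕ → Submodule K V) (hD : Monotone D) (n : ℕ)
    (hn : ∀ j, n ≤ j → D j = D n) :
    ∃ (q : ℕ) (u : Fin q → V) (deg : Fin q → ℕ), Antitone deg ∧ LinearIndependent K u ∧
      (∀ i, deg i ≤ n) ∧ ∀ j, Submodule.span K (u '' {i | deg i ≤ j}) = D j := by
  classical
  obtain ⟨s, deg, hs, hspan⟩ := exists_flag_basis_aux D hD n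
  set t := {v ∈ s | deg v ≤ n} with ht
  have hli : LinearIndependent K (fun v : t => (v : V)) := hs.mono (Set.sep_subset _ _)
  have : Fintype t := hli.setFinite.fintype
  let e := (Fintype.equivFin t).symm
  -- Sorting in the order dual puts the degrees in decreasing order.
  let g : Fin (Fintype.card t) → ℕᵒᵈ := fun i => OrderDual.toDual (deg (e i))
  let σ := Tuple.sort g
  have hmono : Monotone (g ∘ σ) := Tuple.monotone_sort g
  have hdeg : ∀ i, deg (e (σ i)) ≤ n := fun i => (e (σ i)).2.2
  have himage : ∀ j, (fun i => (e (σ i) : V)) '' {i | deg (e (σ i)) ≤ j} =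
      {v ∈ t | deg v ≤ j} := by
    intro j
    ext v
    constructor
    · rintro ⟨i, hi, rfl⟩
      exact ⟨(e (σ i)).2, hi⟩
    · rintro ⟨hv, hj⟩
      refine ⟨σ.symm (e.symm ⟨v, hv⟩), ?_, ?_⟩ <;> simp [hj]
  refine ⟨_, fun i => e (σ i), fun i => deg (e (σ i)), fun i j hij => hmono hij,
    hli.comp (e ∘ σ) (e.injective.comp σ.injective), hdeg, fun j => ?_⟩
  rw [himage]
  rcases le_total j n with h | h
  · rw [← hspan j h]
    congr 1
    ext v
    exact ⟨fun hv => ⟨hv.1.1, hv.2⟩, fun hv => ⟨⟨hv.1, hv.2.trans h⟩, hv.2⟩⟩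
  · rw [hn j h, ← hspan n le_rfl]
    congr 1
    ext v
    exact ⟨fun hv => hv.1, fun hv => ⟨hv, hv.2.trans h⟩⟩

theorem finrank_map_add_finrank_inf_ker [FiniteDimensional K V] (f : V →ₗ[K] W)
    (S : Submodule K V) :
    finrank K (S.map f) + finrank K (LinearMap.ker f ⊓ S : Submodule K V) = finrank K S := by
  rw [← LinearMap.finrank_range_add_finrank_ker (f.domRestrict S), LinearMap.range_domRestrict,
    LinearMap.ker_domRestrict]
  congr 1
  rw [inf_comm, ← Submodule.map_comap_subtype, Submodule.finrank_map_subtype_eq]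

/-- The preinjective part of the pencil is a direct sum of row chains. -/
theorem exists_row_chains [FiniteDimensional K V] {A B : V →ₗ[K] W}
    (hA : ∀ j, ∀ x ∈ relIter A B ⊥ j, B x ∈ LinearMap.range A) {n : ℕ}
    (hn : relIter A B ⊥ (n + 1) = relIter A B ⊥ n) :
    ∃ (q : ℕ) (ε : Fin q → ℕ) (x : Fin q → ℕ → V), Antitone ε ∧ (∀ i, A (x i 0) = 0) ∧
      (∀ i, ∀ k < ε i, A (x i (k + 1)) = B (x i k)) ∧ (∀ i, B (x i (ε i)) = 0) ∧
      relIter A B ⊥ n ≤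
        Submodule.span K (Set.range fun p : Σ i, Fin (ε i + 1) => x p.1 p.2.val) ∧
      finrank K (relIter A B ⊥ n) = ∑ i, (ε i + 1) ∧ finrank K (LinearMap.ker A) = q := by
  set U := relIter A B ⊥ with hUdef
  have hmono : Monotone U := relIter_bot_mono A B
  have hstab : ∀ m, n ≤ m → U m = U n := fun m hm => relIter_stable hn hm
  -- The chains are built from their ends: `u` is a basis of ker B ∩ U adapted to the flag, and the
  -- degree of an end is the length of its chain. The shift `j + 1` makes chains of length zero end
  -- in `U 1`, which is ker A.
  obtain ⟨q, u, ε, hε, hli, hεn, hspan⟩ := exists_flag_basis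
    (fun j => LinearMap.ker B ⊓ U (j + 1)) (fun i j hij => inf_le_inf_left _ (hmono (by omega))) n
    (fun j hj => by rw [hstab (j + 1) (by omega), hstab (n + 1) (by omega)])
  have hu : ∀ i, u i ∈ LinearMap.ker B ⊓ U (ε i + 1) := fun i => by
    rw [← hspan]
    exact Submodule.subset_span ⟨i, le_refl (ε i), rfl⟩
  choose x hx h0 h1 h2 using fun i => exists_chain_of_mem_relIter_bot (ε i) (u i) (hu i).2
  have hcard : ∀ j, finrank K (LinearMap.ker B ⊓ U j : Submodule K V) =
      (Finset.univ.filter fun i => ε i < j).card := by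
    intro j
    cases j with
    | zero => simp [hUdef, relIter_zero]
    | succ j =>
      rw [← hspan]
      have h3 := finrank_span_eq_card (hli.comp (Subtype.val : {i // ε i ≤ j} → Fin q)
        Subtype.val_injective)
      rw [Set.range_comp, Subtype.range_coe_subtype, Fintype.card_subtype] at h3
      rw [h3]
      simp only [Nat.lt_succ_iff]
  have hkerA : LinearMap.ker A ≤ U 1 := fun z hz =>
    mem_relIter_succ.2 ⟨0, zero_mem _, by rw [map_zero, LinearMap.mem_ker.1 hz]⟩
  -- Since `B` maps `U j` into the range of `A`, A(U_{j+1}) = B(U_j); rank-nullity is applied on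
  -- both sides.
  have hrec : ∀ j, finrank K (U (j + 1)) + finrank K (LinearMap.ker B ⊓ U j : Submodule K V) =
      finrank K (U j) + finrank K (LinearMap.ker A) := by
    intro j
    have e1 := finrank_map_add_finrank_inf_ker B (U j)
    have e2 := finrank_map_add_finrank_inf_ker A (U (j + 1))
    have e3 : (U (j + 1)).map A = (U j).map B := by
      refine Submodule.map_comap_eq_of_le ?_
      rintro _ ⟨z, hz, rfl⟩
      exact hA j z hz
    rw [e3, inf_eq_left.2 (hkerA.trans (hmono (by omega)))] at e2
    omega
  -- In the stable range the recursion equates the number of chain ends with the dimension of ker A,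
  -- that is, of the space of chain beginnings.
  have hq : finrank K (LinearMap.ker A) = q := by
    have e1 := hrec (n + 1)
    rw [hstab (n + 1 + 1) (by omega), hstab (n + 1) (by omega), ← hstab (n + 1) (by omega),
      hcard, Finset.filter_true_of_mem fun i _ => Nat.lt_succ_of_le (hεn i)] at e1
    simp at e1
    omega
  have hdim : ∀ j, finrank K (U j) = ∑ i, min j (ε i + 1) := by
    intro j
    induction j with
    | zero => simp [hUdef, relIter_zero]
    | succ j ih =>
      have e1 := hrec j
      rw [hq, hcard, ih] at e1
      have e2 := sum_min_succ (fun _ : Fin q => ()) (fun i => ε i + 1) () j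
      have e3 := Finset.card_filter_add_card_filter_not (s := (Finset.univ : Finset (Fin q)))
        (fun i => ε i < j)
      simp only [if_true, true_and, Nat.lt_succ_iff] at e2
      simp only [not_lt, Finset.card_univ, Fintype.card_fin] at e3
      omega
  -- Descending induction on the level `j`, with `m` bounding the distance to the stable range.
  have hlevel : ∀ m j, n ≤ j + m →
      U (j + 1) ≤ U j ⊔ Submodule.span K ((fun i => x i j) '' {i | j ≤ ε i}) := by
    intro m
    induction m with
    | zero =>
      intro j hj
      rw [hstab (j + 1) (by omega), hstab j (by omega)]
      exact le_sup_left
    | succ m ih =>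
      intro j hj z hz
      obtain ⟨y, hy⟩ := hA _ z hz
      have hyU : y ∈ U (j + 1 + 1) := mem_relIter_succ.2 ⟨z, hz, hy.symm⟩
      obtain ⟨k, hk, t, ht, rfl⟩ := Submodule.mem_sup.1 (ih (j + 1) (by omega) hyU)
      obtain ⟨k', hk', hkk'⟩ := mem_relIter_succ.1 hk
      have ht' : ∃ t' ∈ Submodule.span K ((fun i => x i j) '' {i | j ≤ ε i}), B t' = A t := by
        clear hyU hy
        induction ht using Submodule.span_induction with
        | mem t ht =>
          obtain ⟨i, hi, rfl⟩ := ht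
          have hi' : j + 1 ≤ ε i := hi
          exact ⟨x i j, Submodule.subset_span ⟨i, show j ≤ ε i by omega, rfl⟩,
            (h1 i j (by omega)).symm⟩
        | zero => exact ⟨0, zero_mem _, by simp⟩
        | add a b _ _ ha hb =>
          obtain ⟨a', ha', ha''⟩ := ha
          obtain ⟨b', hb', hb''⟩ := hb
          exact ⟨a' + b', add_mem ha' hb', by rw [map_add, map_add, ha'', hb'']⟩
        | smul c a _ ha =>
          obtain ⟨a', ha', ha''⟩ := ha
          exact ⟨c • a', Submodule.smul_mem _ _ ha', by rw [map_smul, map_smul, ha'']⟩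
      obtain ⟨t', ht', htt'⟩ := ht'
      have hspanle : Submodule.span K ((fun i => x i j) '' {i | j ≤ ε i}) ≤ U (j + 1) := by
        rw [Submodule.span_le]
        rintro _ ⟨i, hi, rfl⟩
        exact h2 i j hi
      -- Writing `B z = A y`, the induction hypothesis splits `y` at level `j + 1`. Pulling both
      -- parts back one step leaves a remainder in ker B ∩ U (j + 1), which is spanned by the chain
      -- ends of degree at most `j`.
      have hmem : z - k' - t' ∈ LinearMap.ker B ⊓ U (j + 1) := by
        refine Submodule.mem_inf.2 ⟨LinearMap.mem_ker.2 ?_, sub_mem (sub_mem hz (hmono (Nat.le_succ j) hk')) (hspanle ht')⟩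
        rw [map_sub, map_sub, hkk', htt', ← hy, map_add]
        abel
      have hle : LinearMap.ker B ⊓ U (j + 1) ≤
          U j ⊔ Submodule.span K ((fun i => x i j) '' {i | j ≤ ε i}) := by
        rw [← hspan, Submodule.span_le]
        rintro _ ⟨i, hi, rfl⟩
        rcases Nat.lt_or_ge (ε i) j with h | h
        · exact Submodule.mem_sup_left (hmono (Nat.succ_le_of_lt h) (hu i).2)
        · obtain rfl : j = ε i := le_antisymm h hi
          exact Submodule.mem_sup_right (Submodule.subset_span ⟨i, h, hx i⟩)
      have hz' : z = (z - k' - t') + (k' + t') := by abel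
      rw [hz']
      exact add_mem (hle hmem) (add_mem (Submodule.mem_sup_left hk') (Submodule.mem_sup_right ht'))
  refine ⟨q, ε, x, hε, h0, h1, fun i => ?_, ?_, ?_, hq⟩
  · rw [hx]
    exact (hu i).1
  · have : ∀ j, U j ≤ Submodule.span K (Set.range fun p : Σ i, Fin (ε i + 1) => x p.1 p.2.val) := by
      intro j
      induction j with
      | zero => exact bot_le
      | succ j ih =>
        refine (hlevel n j (by omega)).trans (sup_le ih (Submodule.span_le.2 ?_))
        rintro _ ⟨i, hi, rfl⟩
        exact Submodule.subset_span ⟨⟨i, ⟨j, Nat.lt_succ_of_le hi⟩⟩, rfl⟩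
    exact this n
  · rw [← hstab (n + 1) (by omega), hdim]
    refine Finset.sum_congr rfl fun i _ => ?_
    have := hεn i
    omega

/-- A terminating geometric series: if `A u = B y` and `u'` solves the equation for `y`, then `y + c
• u'` solves it for `u`, and the predecessors of `u` end at zero. -/
theorem exists_sub_smul_eq_of_mem_relIter_bot {A B : V →ₗ[K] W} {n : ℕ}
    (hn : relIter A B ⊥ (n + 1) = relIter A B ⊥ n) (c : K) (j : ℕ) :
    ∀ u ∈ relIter A B ⊥ j, ∃ u' ∈ relIter A B ⊥ n, B u' - c • A u' = A u := by
  have hle : ∀ j, relIter A B ⊥ j ≤ relIter A B ⊥ n := fun j => by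
    rcases le_total j n with h | h
    · exact relIter_bot_mono A B h
    · exact (relIter_stable hn h).le
  induction j with
  | zero =>
    intro u hu
    rw [relIter_zero, Submodule.mem_bot] at hu
    exact ⟨0, zero_mem _, by simp [hu]⟩
  | succ j ih =>
    intro u hu
    obtain ⟨y, hy, h⟩ := mem_relIter_succ.1 hu
    obtain ⟨u', hu', h'⟩ := ih y hy
    refine ⟨y + c • u', add_mem (hle j hy) (Submodule.smul_mem _ _ hu'), ?_⟩
    rw [← h, map_add, map_add, map_smul, map_smul, smul_add, add_sub_add_comm, smul_smul, mul_comm,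
      ← smul_smul, smul_smul c c, ← smul_smul c c (A u'), ← smul_sub, h', sub_add_cancel]

end RowChains

end Pencil

namespace Pencil

open Module

/-! ### Existence of the Kronecker normal form -/

section Existence

variable {K V W : Type*} [Field K] [AddCommGroup V] [Module K V] [AddCommGroup W] [Module K W]

/-- A quotient on which the pencil is invertible lifts to a direct sum of Jordan blocks. -/
theorem exists_jordan_lift [IsAlgClosed K] [FiniteDimensional K V] {A B : V →ₗ[K] W}
    {U O : Submodule K V} (hUO : U ≤ O) (hO : ∀ x ∈ O, ∃ y ∈ O, A y = B x)
    (hU : ∀ x ∈ U, ∃ y ∈ U, A y = B x) (hker : LinearMap.ker A ≤ U)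
    (hsolve : ∀ c : K, ∀ u ∈ U, ∃ u' ∈ U, B u' - c • A u' = A u) :
    ∃ (b : ℕ) (eig : Fin b → K) (size : Fin b → ℕ) (y : Fin b → ℕ → V), (∀ i, 0 < size i) ∧
      (∀ i, y i 0 = 0) ∧
      (∀ i, ∀ k < size i, B (y i (k + 1)) = eig i • A (y i (k + 1)) + A (y i k)) ∧
      O ≤ U ⊔ Submodule.span K (Set.range fun p : Σ i, Fin (size i) => y p.1 (p.2.val + 1)) ∧
      finrank K U + ∑ i, size i = finrank K O := by
  classical
  let A' : O →ₗ[K] O.map A := A.submoduleMap O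
  have hA'surj : LinearMap.range A' = ⊤ := LinearMap.range_eq_top.2 (A.submoduleMap_surjective O)
  -- A section of `A` on `O` makes the relation A⁻¹B a map `f`. The choice only matters modulo ker A
  -- ≤ U, so `f` induces an endomorphism of O/U.
  obtain ⟨s, hs⟩ := LinearMap.exists_rightInverse_of_surjective A' hA'surj
  let B' : O →ₗ[K] O.map A := LinearMap.codRestrict (O.map A) (B ∘ₗ O.subtype)
    fun x => hO x.1 x.2
  let f : O →ₗ[K] O := s ∘ₗ B'
  have hf : ∀ x, A (f x : V) = B x := fun x =>
    congrArg Subtype.val (LinearMap.congr_fun hs (B' x))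
  let U' : Submodule K O := U.comap O.subtype
  have hfU : U' ≤ U'.comap f := by
    intro x hx
    obtain ⟨y, hy, h⟩ := hU x hx
    have h1 : (f x : V) - y ∈ U := hker (by rw [LinearMap.mem_ker, map_sub, hf, h, sub_self])
    have := add_mem h1 hy
    rwa [sub_add_cancel] at this
  obtain ⟨b, eig, size, z, v, hpos, hz0, hz, hv⟩ := exists_jordan_chains (U'.mapQ U' f hfU)
  choose Y hY using fun i k => U'.mkQ_surjective (z i k)
  have hYU : ∀ i, ∀ k < size i, ∃ u ∈ U,
      B (Y i (k + 1)) = eig i • A (Y i (k + 1)) + A (Y i k) + A u := by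
    intro i k hk
    have h1 := hz i k hk
    rw [← hY, ← hY, Submodule.mkQ_apply, Submodule.mapQ_apply, ← Submodule.mkQ_apply,
      ← Submodule.mkQ_apply, ← map_smul, ← map_add, ← sub_eq_zero, ← map_sub,
      Submodule.mkQ_apply, Submodule.Quotient.mk_eq_zero] at h1
    refine ⟨_, h1, ?_⟩
    simp only [Submodule.subtype_apply, map_sub, map_add, map_smul, hf]
    abel
  have hY0 : ∀ i, (Y i 0 : V) ∈ U := by
    intro i
    have h1 := hY i 0
    rw [hz0, Submodule.mkQ_apply, Submodule.Quotient.mk_eq_zero] at h1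
    exact h1
  -- Lifted chains satisfy the Jordan relations only up to A(U). Corrections in `U` are found one
  -- level at a time, starting from `-Y i 0` so that the corrected chain starts at zero.
  have hcorr : ∀ i, ∀ m ≤ size i, ∃ c : ℕ → V, (∀ k, c k ∈ U) ∧ (Y i 0 : V) + c 0 = 0 ∧
      ∀ k < m, B (Y i (k + 1) + c (k + 1)) =
        eig i • A (Y i (k + 1) + c (k + 1)) + A (Y i k + c k) := by
    intro i m
    induction m with
    | zero =>
      intro _
      exact ⟨fun _ => -(Y i 0 : V), fun _ => neg_mem (hY0 i), by simp, by simp⟩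
    | succ m ih =>
      intro hm
      obtain ⟨c, hc, hc0, hck⟩ := ih (by omega)
      obtain ⟨u, hu, hu'⟩ := hYU i m (by omega)
      -- The right-hand side combines the previous correction `c m` with the defect `u` of the
      -- lifted relation.
      obtain ⟨u', hu'', hsol⟩ := hsolve (eig i) (c m - u) (sub_mem (hc m) hu)
      refine ⟨Function.update c (m + 1) u', fun k => ?_, ?_, fun k hk => ?_⟩
      · by_cases hk : k = m + 1
        · subst hk
          simpa using hu''
        · simpa [hk] using hc k
      · simpa using hc0
      · rcases Nat.lt_or_ge k m with h3 | h3
        · have h4 : k + 1 ≠ m + 1 := by omega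
          have h5 : k ≠ m + 1 := by omega
          rw [Function.update_of_ne h4, Function.update_of_ne h5]
          exact hck k h3
        · obtain rfl : k = m := by omega
          rw [Function.update_self, Function.update_of_ne (by omega), map_add, hu', map_add,
            map_add, smul_add, ← sub_eq_zero]
          rw [map_sub, sub_eq_iff_eq_add] at hsol
          rw [hsol]
          abel
  choose c hc hc0 hck using fun i => hcorr i (size i) le_rfl
  refine ⟨b, eig, size, fun i k => Y i k + c i k, hpos, hc0, hck, ?_, ?_⟩
  · intro x hx
    have h1 := v.sum_repr (U'.mkQ ⟨x, hx⟩)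
    simp_rw [hv, ← hY, ← map_smul] at h1
    rw [← map_sum, ← sub_eq_zero, ← map_sub, Submodule.mkQ_apply,
      Submodule.Quotient.mk_eq_zero] at h1
    set r := v.repr (U'.mkQ ⟨x, hx⟩)
    have h2 : (∑ p, r p • (Y p.1 (p.2.val + 1) : V)) - x ∈ U := by
      have : (O.subtype ((∑ p, r p • (Y p.1 (p.2.val + 1))) - ⟨x, hx⟩)) ∈ U := h1
      simpa using this
    have h3 : ∑ p : Σ i, Fin (size i), r p • c p.1 (p.2.val + 1) ∈ U :=
      Submodule.sum_mem _ fun p _ => Submodule.smul_mem _ _ (hc _ _)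
    have h4 : ∑ p : Σ i, Fin (size i), r p • ((Y p.1 (p.2.val + 1) : V) + c p.1 (p.2.val + 1)) ∈
        Submodule.span K (Set.range fun p : Σ i, Fin (size i) =>
          (Y p.1 (p.2.val + 1) : V) + c p.1 (p.2.val + 1)) :=
      Submodule.sum_mem _ fun p _ => Submodule.smul_mem _ _ (Submodule.subset_span ⟨p, rfl⟩)
    have h5 : x = -(((∑ p, r p • (Y p.1 (p.2.val + 1) : V)) - x) +
        ∑ p : Σ i, Fin (size i), r p • c p.1 (p.2.val + 1)) +
        ∑ p : Σ i, Fin (size i), r p • ((Y p.1 (p.2.val + 1) : V) + c p.1 (p.2.val + 1)) := by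
      simp_rw [smul_add, Finset.sum_add_distrib]
      abel
    rw [h5]
    exact Submodule.add_mem_sup (neg_mem (add_mem h2 h3)) h4
  · have h1 := Submodule.finrank_quotient_add_finrank U'
    rw [finrank_eq_card_basis v, (Submodule.comapSubtypeEquivOfLe hUO).finrank_eq] at h1
    simp only [Fintype.card_sigma, Fintype.card_fin] at h1
    omega

/-- A pencil with a basis consisting of Jordan chains, row chains and a column chain. -/
theorem iso_of_chains [FiniteDimensional K V] [FiniteDimensional K W] {A B : V →ₗ[K] W}
    {b q : ℕ} (eig : Fin b → K) (size : Fin b → ℕ) (ε : Fin q → ℕ) (η : ℕ)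
    (y : Fin b → ℕ → V) (x : Fin q → ℕ → V) (v : ℕ → V) (w : W)
    (hy0 : ∀ i, y i 0 = 0)
    (hy : ∀ i, ∀ k < size i, B (y i (k + 1)) = eig i • A (y i (k + 1)) + A (y i k))
    (hx0 : ∀ i, A (x i 0) = 0) (hx : ∀ i, ∀ k < ε i, A (x i (k + 1)) = B (x i k))
    (hxε : ∀ i, B (x i (ε i)) = 0) (hv0 : 0 < η → B (v 0) = w)
    (hv : ∀ k, k + 1 < η → B (v (k + 1)) = A (v k)) (hw : w ∉ LinearMap.range A)
    (hco : finrank K W = finrank K (LinearMap.range A) + 1) (hker : finrank K (LinearMap.ker A) = q)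
    (hspan : ⊤ ≤ Submodule.span K (Set.range fun p : Σ i, Fin (size i) => y p.1 (p.2.val + 1)) ⊔
      (Submodule.span K (Set.range fun p : Σ i, Fin (ε i + 1) => x p.1 p.2.val) ⊔
        Submodule.span K (Set.range fun k : Fin η => v k)))
    (hdim : ∑ i, size i + (∑ i, (ε i + 1) + η) ≤ finrank K V) :
    Iso A B (LinearMap.id.prodMap (chainA K ε η)) ((jordanMap eig size).prodMap (chainB K ε η)) := by
  classical
  let bV : (Σ i, Fin (size i)) ⊕ ColIndex ε η → V :=
    Sum.elim (fun p => y p.1 (p.2.val + 1)) (Sum.elim (fun p => x p.1 p.2.val) fun k => v k)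
  -- The column chain in the target starts with `w`, outside the range of `A`; the rest of the
  -- target basis consists of `A`-images of source basis vectors.
  let w' : Fin (η + 1) → W := Fin.cons w fun k => A (v k)
  let bW : (Σ i, Fin (size i)) ⊕ RowIndex ε η → W :=
    Sum.elim (fun p => A (y p.1 (p.2.val + 1)))
      (Sum.elim (fun p => A (x p.1 (p.2.val + 1))) w')
  have hbV : ⊤ ≤ Submodule.span K (Set.range bV) := by
    rw [Set.Sum.elim_range, Set.Sum.elim_range, Submodule.span_union, Submodule.span_union]
    exact hspan
  have hliV : LinearIndependent K bV := by
    refine linearIndependent_of_top_le_span_of_card_le_finrank hbV ?_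
    simpa using hdim
  -- The nonzero `A`-images span the hyperplane range of `A`, and `w` supplies the missing
  -- direction. Independence then follows by counting, with ker A of dimension `q`.
  have hbW : ⊤ ≤ Submodule.span K (Set.range bW) := by
    have hAle : LinearMap.range A ≤ Submodule.span K (Set.range bW) := by
      rw [← Submodule.map_top, ← top_le_iff.1 hbV, Submodule.map_span, Submodule.span_le]
      rintro _ ⟨_, ⟨p | ⟨i, k⟩ | k, rfl⟩, rfl⟩
      · exact Submodule.subset_span ⟨.inl p, rfl⟩
      · refine Fin.cases ?_ (fun k => ?_) k
        · have : A (bV (.inr (.inl ⟨i, 0⟩))) = 0 := hx0 i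
          rw [this]
          exact zero_mem _
        · exact Submodule.subset_span ⟨.inr (.inl ⟨i, k⟩), rfl⟩
      · exact Submodule.subset_span ⟨.inr (.inr k.succ), rfl⟩
    intro z _
    obtain ⟨c, hc⟩ := exists_sub_smul_mem_of_codim_one hco hw z
    rw [← sub_add_cancel z (c • w)]
    exact add_mem (hAle hc) (Submodule.smul_mem _ _ (Submodule.subset_span ⟨.inr (.inr 0), rfl⟩))
  have hliW : LinearIndependent K bW := by
    refine linearIndependent_of_top_le_span_of_card_le_finrank hbW ?_
    have h1 := LinearMap.finrank_range_add_finrank_ker A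
    simp only [Finset.sum_add_distrib, Finset.sum_const, Finset.card_univ, Fintype.card_fin,
      smul_eq_mul, mul_one] at hdim
    simp only [Fintype.card_sum, Fintype.card_sigma, Fintype.card_fin]
    omega
  let eV := (Basis.mk hliV hbV).equivFun.symm
  let eW := (Basis.mk hliW hbW).equivFun.symm
  have heV : ∀ c : (Σ i, Fin (size i)) ⊕ ColIndex ε η → K, eV c =
      ∑ p, c (.inl p) • y p.1 (p.2.val + 1) +
      (∑ i, ∑ k : Fin (ε i + 1), c (.inr (.inl ⟨i, k⟩)) • x i k.val +
        ∑ k : Fin η, c (.inr (.inr k)) • v k) := by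
    intro c
    simp only [eV, Basis.equivFun_symm_apply, Basis.mk_apply, Fintype.sum_sum_type]
    congr 2
    exact Fintype.sum_sigma _
  have heW : ∀ c : (Σ i, Fin (size i)) ⊕ RowIndex ε η → K, eW c =
      ∑ p, c (.inl p) • A (y p.1 (p.2.val + 1)) +
      (∑ i, ∑ k : Fin (ε i), c (.inr (.inl ⟨i, k⟩)) • A (x i (k.val + 1)) +
        ∑ k : Fin (η + 1), c (.inr (.inr k)) • w' k) := by
    intro c
    simp only [eW, Basis.equivFun_symm_apply, Basis.mk_apply, Fintype.sum_sum_type]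
    congr 2
    exact Fintype.sum_sigma _
  refine Iso.symm ⟨(LinearEquiv.sumArrowLequivProdArrow _ _ K K).symm.trans eV,
    (LinearEquiv.sumArrowLequivProdArrow _ _ K K).symm.trans eW, ?_, ?_⟩
  · rintro ⟨c, d⟩
    simp only [LinearEquiv.trans_apply, heV, heW, LinearMap.prodMap_apply, LinearMap.id_apply,
      LinearEquiv.sumArrowLequivProdArrow_symm_apply_inl,
      LinearEquiv.sumArrowLequivProdArrow_symm_apply_inr, map_add, map_sum, map_smul]
    congr 2
    · refine Finset.sum_congr rfl fun i _ => ?_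
      rw [Fin.sum_univ_succ, Fin.val_zero, hx0, smul_zero, zero_add]
      rfl
    · rw [Fin.sum_univ_succ, chainA_inr, colA_zero, zero_smul, zero_add]
      rfl
  · rintro ⟨c, d⟩
    simp only [LinearEquiv.trans_apply, heV, heW, LinearMap.prodMap_apply,
      LinearEquiv.sumArrowLequivProdArrow_symm_apply_inl,
      LinearEquiv.sumArrowLequivProdArrow_symm_apply_inr, map_add, map_sum, map_smul]
    rw [sum_jordanMap_smul (W := W) eig size (fun i k => A (y i k)) (fun i => by rw [hy0, map_zero])]
    congr 2
    · funext p
      rw [hy _ _ p.2.isLt]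
    · refine Finset.sum_congr rfl fun i _ => ?_
      rw [Fin.sum_univ_castSucc, Fin.val_last, hxε, smul_zero, add_zero]
      refine Finset.sum_congr rfl fun k _ => ?_
      rw [hx _ _ k.isLt]
      rfl
    · rw [Fin.sum_univ_castSucc, chainB_inr, colB_last, zero_smul, add_zero]
      refine Finset.sum_congr rfl fun k _ => ?_
      rw [chainB_inr, colB_castSucc]
      congr 1
      rcases k with ⟨k, hk⟩
      cases k with
      | zero => exact (hv0 hk).symm
      | succ k => exact (hv k hk).symm

/-- The Kronecker normal form of a pencil of maximal rank `finrank K W - 1`. -/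
theorem exists_iso_normal_form [IsAlgClosed K] [FiniteDimensional K V] [FiniteDimensional K W]
    (A B : V →ₗ[K] W) (hmax : ∀ a b : K, finrank K (LinearMap.range (a • A + b • B)) ≤
      finrank K (LinearMap.range A)) (hco : finrank K W = finrank K (LinearMap.range A) + 1) :
    ∃ (b : ℕ) (eig : Fin b → K) (size : Fin b → ℕ) (q : ℕ) (ε : Fin q → ℕ) (η : ℕ),
      (∀ i, 0 < size i) ∧ Antitone ε ∧ finrank K (LinearMap.ker A) = q ∧
      Iso A B (LinearMap.id.prodMap (chainA K ε η))
        ((jordanMap eig size).prodMap (chainB K ε η)) := by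
  have : Infinite K := IsAlgClosed.instInfinite
  have hA := apply_mem_range_of_mem_relIter_bot hmax
  obtain ⟨n, hn⟩ := exists_relIter_bot_stable A B
  obtain ⟨q, ε, x, hε, hx0, hx, hxε, hxspan, hxdim, hker⟩ := exists_row_chains hA hn
  obtain ⟨η, v, w, hw, hv0, hv, hO, hOspan, hOdim⟩ := exists_col_chain A B hco
  have hkerA : LinearMap.ker A ≤ relIter A B ⊥ n := by
    have h1 : LinearMap.ker A ≤ relIter A B ⊥ (n + 1) := fun z hz =>
      mem_relIter_succ.2 ⟨0, zero_mem _, by rw [map_zero, LinearMap.mem_ker.1 hz]⟩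
    rwa [hn] at h1
  obtain ⟨b, eig, size, y, hpos, hy0, hy, hyspan, hydim⟩ := exists_jordan_lift
    (relIter_bot_le_relIter_top hA η n)
    (fun z hz => by
      rw [← hO] at hz
      exact mem_relIter_succ.1 hz)
    (fun z hz => by
      obtain ⟨y, hy⟩ := hA n z hz
      refine ⟨y, ?_, hy⟩
      rw [← hn]
      exact mem_relIter_succ.2 ⟨z, hz, hy.symm⟩) hkerA
    (fun c => exists_sub_smul_eq_of_mem_relIter_bot hn c n)
  refine ⟨b, eig, size, q, ε, η, hpos, hε, hker, iso_of_chains eig size ε η y x v w hy0 hy hx0 hx hxε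
    hv0 hv hw hco hker ?_ ?_⟩
  · refine hOspan.trans (sup_le (hyspan.trans (sup_le (hxspan.trans ?_) le_sup_left)) ?_)
    · exact le_sup_of_le_right le_sup_left
    · exact le_sup_of_le_right le_sup_right
  · omega

end Existence

end Pencil

namespace Pencil

open Module Slocc

/-! ### The staircase numbering of chain bases -/

section Corner

variable {q : ℕ} {ε : Fin q → ℕ} (η : ℕ)

theorem corner_zero (ε : Fin q → ℕ) : corner ε η 0 = ∑ i, ε i + η + q := by
  simp only [corner, Nat.sub_zero, Finset.sum_add_distrib, Finset.sum_const, Finset.card_univ,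
    Fintype.card_fin, smul_eq_mul, mul_one]
  omega

theorem corner_one (ε : Fin q → ℕ) : corner ε η 1 = ∑ i, ε i + η := by
  simp [corner]

/-- Put column `k` of a row chain in layer `k` and column `k` of the column chain in layer `k + 1`.
Then `corner ε η k` counts the columns in layers at least `k`, and the difference of consecutive
corners is the size of a layer. -/
theorem corner_succ_add (ε : Fin q → ℕ) (k : ℕ) : corner ε η (k + 1) +
    ((Finset.univ.filter fun i => k ≤ ε i).card + if 1 ≤ k ∧ k ≤ η then 1 else 0) =
      corner ε η k := by
  have h : ∑ i, (ε i + 1 - k) =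
      ∑ i, (ε i + 1 - (k + 1)) + (Finset.univ.filter fun i => k ≤ ε i).card := by
    rw [Finset.card_filter, ← Finset.sum_add_distrib]
    refine Finset.sum_congr rfl fun i _ => ?_
    split_ifs <;> omega
  rw [corner, corner, h]
  split_ifs <;> omega

theorem corner_anti (ε : Fin q → ℕ) : Antitone (corner ε η) :=
  antitone_nat_of_succ_le fun k => by
    rw [← corner_succ_add η ε k]
    omega

theorem corner_succ_add_le (hε : Antitone ε) {k : ℕ} {i : Fin q} (hk : k ≤ ε i) :
    corner ε η (k + 1) + (i.val + 1) + (if 1 ≤ k ∧ k ≤ η then 1 else 0) ≤ corner ε η k := by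
  rw [← corner_succ_add η ε k]
  have : (Finset.Iic i).card ≤ (Finset.univ.filter fun i => k ≤ ε i).card :=
    Finset.card_le_card fun j hj => by simpa using hk.trans (hε (Finset.mem_Iic.1 hj))
  rw [Fin.card_Iic] at this
  omega

theorem corner_succ_lt {k : ℕ} (ε : Fin q → ℕ) (h1 : 1 ≤ k) (h2 : k ≤ η) :
    corner ε η (k + 1) + 1 ≤ corner ε η k := by
  rw [← corner_succ_add η ε k, if_pos ⟨h1, h2⟩]
  omega

/-- Layer `k` occupies the positions from `corner (k + 1)` up to `corner k`: the column chain takes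
the first place and row chain `i` the place `i + 1` from the end. These fit because, ε being
decreasing, the row chains that reach layer `k` are the first ones. -/
theorem exists_colEquiv (hε : Antitone ε) :
    ∃ e : ColIndex ε η ≃ Fin (∑ i, ε i + η + q),
      (∀ p, (e (.inl p)).val + p.1.val + 1 = corner ε η p.2.val) ∧
      ∀ k, (e (.inr k)).val = corner ε η (k.val + 2) := by
  have hle : ∀ p : Σ i, Fin (ε i + 1), corner ε η (p.2.val + 1) + (p.1.val + 1) +
      (if 1 ≤ p.2.val ∧ p.2.val ≤ η then 1 else 0) ≤ corner ε η p.2.val :=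
    fun p => corner_succ_add_le η hε (Nat.lt_succ_iff.1 p.2.isLt)
  have hlt : ∀ k : Fin η, corner ε η (k.val + 2) + 1 ≤ corner ε η (k.val + 1) :=
    fun k => corner_succ_lt η ε (by omega) (by omega)
  have h0 := corner_zero η ε
  let g : ColIndex ε η → Fin (∑ i, ε i + η + q) :=
    Sum.elim (fun p => ⟨corner ε η p.2.val - (p.1.val + 1), by
        have := corner_anti η ε (Nat.zero_le p.2.val)
        have := hle p
        omega⟩)
      fun k => ⟨corner ε η (k.val + 2), by
        have := corner_anti η ε (Nat.zero_le (k.val + 1))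
        have := hlt k
        omega⟩
  let layer : ColIndex ε η → ℕ := Sum.elim (fun p => p.2.val) fun k => k.val + 1
  have hlayer : ∀ c, corner ε η (layer c + 1) ≤ (g c).val ∧ (g c).val < corner ε η (layer c) := by
    rintro (p | k)
    · have := hle p
      simp only [g, layer, Sum.elim_inl]
      omega
    · have := hlt k
      simp only [g, layer, Sum.elim_inr, Nat.add_assoc, Nat.reduceAdd]
      omega
  have hinj : Function.Injective g := by
    intro c c' h
    have h1 : layer c = layer c' := by
      rcases lt_trichotomy (layer c) (layer c') with h2 | h2 | h2
      · have h3 := corner_anti η ε (Nat.succ_le_of_lt h2)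
        have h4 := hlayer c
        have h5 := hlayer c'
        rw [h] at h4
        simp only [Nat.succ_eq_add_one] at h3
        omega
      · exact h2
      · have h3 := corner_anti η ε (Nat.succ_le_of_lt h2)
        have h4 := hlayer c
        have h5 := hlayer c'
        rw [h] at h4
        simp only [Nat.succ_eq_add_one] at h3
        omega
    have h2 := congrArg Fin.val h
    rcases c with ⟨i, k⟩ | k <;> rcases c' with ⟨i', k'⟩ | k' <;>
      simp only [g, layer, Sum.elim_inl, Sum.elim_inr] at h1 h2
    · have h3 := hle ⟨i, k⟩
      have h4 := hle ⟨i', k'⟩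
      simp only at h3 h4
      rw [h1] at h2 h3
      obtain rfl : i = i' := Fin.ext (by omega)
      obtain rfl : k = k' := Fin.ext h1
      rfl
    · have h3 := hle ⟨i, k⟩
      simp only at h3
      rw [h1] at h2 h3
      rw [if_pos (by omega)] at h3
      simp only [Nat.add_assoc, Nat.reduceAdd] at h2 h3
      omega
    · have h3 := hle ⟨i', k'⟩
      simp only at h3
      rw [← h1] at h2 h3
      rw [if_pos (by omega)] at h3
      simp only [Nat.add_assoc, Nat.reduceAdd] at h2 h3
      omega
    · obtain rfl : k = k' := Fin.ext (by omega)
      rfl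
  refine ⟨Equiv.ofBijective g ((Fintype.bijective_iff_injective_and_card g).2 ⟨hinj, ?_⟩), ?_, ?_⟩
  · simp [Finset.sum_add_distrib]
    omega
  · intro p
    have := hle p
    simp only [Equiv.ofBijective_apply, g, Sum.elim_inl]
    omega
  · intro k
    rfl

/-- Rows receive the positions of the columns that `chainA` links to them; the first row of the
column chain, linked to none, comes last. -/
theorem exists_rowEquiv (hε : Antitone ε) :
    ∃ e : RowIndex ε η ≃ Fin (∑ i, ε i + η + 1),
      (∀ p, (e (.inl p)).val + p.1.val + 1 = corner ε η (p.2.val + 1)) ∧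
      ∀ k, (e (.inr k)).val = corner ε η (k.val + 1) := by
  have hle : ∀ p : Σ i, Fin (ε i), corner ε η (p.2.val + 2) + (p.1.val + 1) +
      (if p.2.val + 1 ≤ η then 1 else 0) ≤ corner ε η (p.2.val + 1) := by
    intro p
    have := corner_succ_add_le η hε (Nat.succ_le_of_lt p.2.isLt)
    simpa using this
  have hlt : ∀ k : Fin (η + 1), 1 ≤ k.val → corner ε η (k.val + 1) + 1 ≤ corner ε η k.val :=
    fun k hk => corner_succ_lt η ε hk (by omega)
  have h0 := corner_one η ε
  let g : RowIndex ε η → Fin (∑ i, ε i + η + 1) :=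
    Sum.elim (fun p => ⟨corner ε η (p.2.val + 1) - (p.1.val + 1), by
        have := corner_anti η ε (show 1 ≤ p.2.val + 1 by omega)
        omega⟩)
      fun k => ⟨corner ε η (k.val + 1), by
        have := corner_anti η ε (show 1 ≤ k.val + 1 by omega)
        omega⟩
  let layer : RowIndex ε η → ℕ := Sum.elim (fun p => p.2.val + 1) fun k => k.val
  have hlayer : ∀ c, corner ε η (layer c + 1) ≤ (g c).val ∧
      (1 ≤ layer c → (g c).val < corner ε η (layer c)) := by
    rintro (p | k)
    · have := hle p
      simp only [g, layer, Sum.elim_inl, Nat.add_assoc, Nat.reduceAdd] at this ⊢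
      omega
    · have := hlt k
      simp only [g, layer, Sum.elim_inr]
      omega
  have hinj : Function.Injective g := by
    intro c c' h
    have h1 : layer c = layer c' := by
      rcases lt_trichotomy (layer c) (layer c') with h2 | h2 | h2
      · have h3 := corner_anti η ε (Nat.succ_le_of_lt h2)
        have h4 := (hlayer c).1
        have h5 := (hlayer c').2 (by omega)
        rw [h] at h4
        simp only [Nat.succ_eq_add_one] at h3
        omega
      · exact h2
      · have h3 := corner_anti η ε (Nat.succ_le_of_lt h2)
        have h4 := (hlayer c).2 (by omega)
        have h5 := (hlayer c').1
        rw [h] at h4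
        simp only [Nat.succ_eq_add_one] at h3
        omega
    have h2 := congrArg Fin.val h
    rcases c with ⟨i, k⟩ | k <;> rcases c' with ⟨i', k'⟩ | k' <;>
      simp only [g, layer, Sum.elim_inl, Sum.elim_inr] at h1 h2
    · have h3 := hle ⟨i, k⟩
      have h4 := hle ⟨i', k'⟩
      simp only at h3 h4
      obtain h1 : k.val = k'.val := by omega
      rw [h1] at h2 h3
      obtain rfl : i = i' := Fin.ext (by omega)
      obtain rfl : k = k' := Fin.ext h1
      rfl
    · have h3 := hle ⟨i, k⟩
      simp only at h3
      rw [if_pos (by omega)] at h3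
      rw [← h1] at h2
      simp only [Nat.add_assoc, Nat.reduceAdd] at h2 h3
      omega
    · have h3 := hle ⟨i', k'⟩
      simp only at h3
      rw [if_pos (by omega)] at h3
      rw [h1] at h2
      simp only [Nat.add_assoc, Nat.reduceAdd] at h2 h3
      omega
    · obtain rfl : k = k' := Fin.ext (by omega)
      rfl
  refine ⟨Equiv.ofBijective g ((Fintype.bijective_iff_injective_and_card g).2 ⟨hinj, ?_⟩), ?_, ?_⟩
  · simp
    omega
  · intro p
    have := hle p
    simp only [Equiv.ofBijective_apply, g, Sum.elim_inl]
    omega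
  · intro k
    rfl

end Corner

/-! ### Matrices of the blocks in the staircase numbering -/

section Blocks

variable {q : ℕ} {ε : Fin q → ℕ} {η : ℕ} {eC : ColIndex ε η ≃ Fin (∑ i, ε i + η + q)}
  {eR : RowIndex ε η ≃ Fin (∑ i, ε i + η + 1)}

theorem sum_matrix_eq_chainB {K : Type*} [Field K] (m : RowIndex ε η → ColIndex ε η → K)
    (P : RowIndex ε η → ColIndex ε η → Prop) [∀ r c, Decidable (P r c)]
    (hm : ∀ r c, m r c = if P r c then 1 else 0)
    (hP : ∀ r c, P r c ↔ (∃ p : Σ i, Fin (ε i), r = .inl p ∧ c = .inl ⟨p.1, p.2.castSucc⟩) ∨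
      ∃ k : Fin η, r = .inr k.castSucc ∧ c = .inr k) (x : ColIndex ε η → K) (r : RowIndex ε η) :
    ∑ c, m r c * x c = chainB K ε η x r := by
  classical
  simp_rw [hm, hP]
  rcases r with p | k
  · simp only [Sum.inl.injEq, reduceCtorEq, false_and, exists_false, or_false,
      exists_eq_left', ite_mul, one_mul, zero_mul, Finset.sum_ite_eq', Finset.mem_univ, if_true,
      chainB_inl]
  · refine Fin.lastCases ?_ (fun k => ?_) k
    · simp [(Fin.castSucc_lt_last _).ne']
    · simp

theorem sum_matrix_eq_chainA {K : Type*} [Field K] (m : RowIndex ε η → ColIndex ε η → K)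
    (P : RowIndex ε η → ColIndex ε η → Prop) [∀ r c, Decidable (P r c)]
    (hm : ∀ r c, m r c = if P r c then 1 else 0)
    (hP : ∀ r c, P r c ↔ (∃ p : Σ i, Fin (ε i), r = .inl p ∧ c = .inl ⟨p.1, p.2.succ⟩) ∨
      ∃ k : Fin η, r = .inr k.succ ∧ c = .inr k) (x : ColIndex ε η → K) (r : RowIndex ε η) :
    ∑ c, m r c * x c = chainA K ε η x r := by
  classical
  simp_rw [hm, hP]
  rcases r with p | k
  · simp only [Sum.inl.injEq, reduceCtorEq, false_and, exists_false, or_false,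
      exists_eq_left', ite_mul, one_mul, zero_mul, Finset.sum_ite_eq', Finset.mem_univ, if_true,
      chainA_inl]
  · refine Fin.cases ?_ (fun k => ?_) k
    · simp [(Fin.succ_ne_zero _).symm]
    · simp

theorem sum_blockB (hC : (∀ p, (eC (.inl p)).val + p.1.val + 1 = corner ε η p.2.val) ∧
      ∀ k, (eC (.inr k)).val = corner ε η (k.val + 2))
    (hR : (∀ p, (eR (.inl p)).val + p.1.val + 1 = corner ε η (p.2.val + 1)) ∧
      ∀ k, (eR (.inr k)).val = corner ε η (k.val + 1)) (x : ColIndex ε η → ℂ)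
    (r : RowIndex ε η) : ∑ c, blockB ε η (eR r) (eC c) * x c = chainB ℂ ε η x r := by
  classical
  refine sum_matrix_eq_chainB (fun r c => blockB ε η (eR r) (eC c)) (fun r c => (∃ i : Fin q, ∃ j < ε i,
      (eR r).val + i.val + 1 = corner ε η (j + 1) ∧ (eC c).val + i.val + 1 = corner ε η j) ∨
      (∃ j < η, (eR r).val = corner ε η (j + 1) ∧ (eC c).val = corner ε η (j + 2))) ?_ ?_ x r
  · intro r c
    simp only [blockB, Matrix.of_apply]
  · intro r c
    constructor
    · rintro (⟨i, j, hj, h1, h2⟩ | ⟨j, hj, h1, h2⟩)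
      · left
        refine ⟨⟨i, ⟨j, hj⟩⟩, eR.injective (Fin.ext ?_), eC.injective (Fin.ext ?_)⟩
        · have := hR.1 ⟨i, ⟨j, hj⟩⟩
          simp only at this
          omega
        · change (eC c).val = (eC (.inl ⟨i, Fin.castSucc ⟨j, hj⟩⟩)).val
          have := hC.1 ⟨i, Fin.castSucc ⟨j, hj⟩⟩
          simp only [Fin.val_castSucc] at this
          omega
      · right
        refine ⟨⟨j, hj⟩, eR.injective (Fin.ext ?_), eC.injective (Fin.ext ?_)⟩
        · rw [h1, hR.2]
          rfl
        · rw [h2, hC.2]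
    · rintro (⟨⟨i, k⟩, rfl, rfl⟩ | ⟨k, rfl, rfl⟩)
      · left
        exact ⟨i, k.val, k.isLt, hR.1 ⟨i, k⟩, hC.1 ⟨i, k.castSucc⟩⟩
      · right
        exact ⟨k.val, k.isLt, hR.2 _, hC.2 _⟩

/-- The numberings of rows and columns agree along every link of `chainA`, so its ones lie on the
diagonal; the bound excludes the last row. -/
theorem sum_diagonal (hC : (∀ p, (eC (.inl p)).val + p.1.val + 1 = corner ε η p.2.val) ∧
      ∀ k, (eC (.inr k)).val = corner ε η (k.val + 2))
    (hR : (∀ p, (eR (.inl p)).val + p.1.val + 1 = corner ε η (p.2.val + 1)) ∧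
      ∀ k, (eR (.inr k)).val = corner ε η (k.val + 1)) (x : ColIndex ε η → ℂ)
    (r : RowIndex ε η) :
    ∑ c, (if (eR r).val = (eC c).val ∧ (eR r).val < ∑ i, ε i + η then 1 else 0) * x c =
      chainA ℂ ε η x r := by
  classical
  refine sum_matrix_eq_chainA (fun r c => if (eR r).val = (eC c).val ∧
    (eR r).val < ∑ i, ε i + η then 1 else 0) (fun r c => (eR r).val = (eC c).val ∧
    (eR r).val < ∑ i, ε i + η) (fun _ _ => rfl) ?_ x r
  have e1 : ∀ p : Σ i, Fin (ε i), (eR (.inl p)).val = (eC (.inl ⟨p.1, p.2.succ⟩)).val := by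
    intro p
    have h1 := hR.1 p
    have h2 := hC.1 ⟨p.1, p.2.succ⟩
    simp only [Fin.val_succ] at h2
    omega
  have e2 : ∀ k : Fin η, (eR (.inr k.succ)).val = (eC (.inr k)).val := by
    intro k
    rw [hR.2, hC.2]
    rfl
  have h1 := corner_one η ε
  intro r c
  constructor
  · rintro ⟨h, hlt⟩
    rcases r with p | k
    · exact Or.inl ⟨p, rfl, eC.injective (Fin.ext (h.symm.trans (e1 p)))⟩
    · induction k using Fin.cases with
      | zero =>
        have := hR.2 0
        simp only [Fin.val_zero, zero_add] at this
        omega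
      | succ k => exact Or.inr ⟨k, rfl, eC.injective (Fin.ext (h.symm.trans (e2 k)))⟩
  · rintro (⟨p, rfl, rfl⟩ | ⟨k, rfl, rfl⟩)
    · refine ⟨e1 p, ?_⟩
      have h2 := hR.1 p
      have h3 := corner_anti η ε (show 1 ≤ p.2.val + 1 by omega)
      omega
    · refine ⟨e2 k, ?_⟩
      have h2 := hR.2 k.succ
      have h3 := corner_succ_lt η ε (show 1 ≤ k.succ.val by simp) (show k.succ.val ≤ η by simp)
      have h4 := corner_anti η ε (show 1 ≤ k.succ.val by simp)
      omega

theorem sum_jordanBlock (s : ℕ) (c : ℂ) (x : Fin s → ℂ) (k : Fin s) :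
    ∑ k', jordanBlock s c k k' * x k' =
      c * x k + if h : k.val + 1 < s then x ⟨k.val + 1, h⟩ else 0 := by
  have h1 : ∀ k', jordanBlock s c k k' * x k' =
      (if k' = k then c * x k' else 0) + if k.val + 1 = k'.val then x k' else 0 := by
    intro k'
    simp only [jordanBlock, Matrix.of_apply]
    by_cases h : k = k'
    · subst h
      simp
    · simp [h, Ne.symm h]
  simp_rw [h1, Finset.sum_add_distrib]
  congr 1
  · simp
  · split_ifs with h
    · rw [Finset.sum_eq_single ⟨k.val + 1, h⟩]
      · simp
      · intro k' _ hk'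
        rw [if_neg]
        intro h2
        exact hk' (Fin.ext h2.symm)
      · simp
    · refine Finset.sum_eq_zero fun k' _ => ?_
      rw [if_neg]
      intro h2
      have := k'.isLt
      omega

theorem sum_jordanMatrix {b : ℕ} (eig : Fin b → ℂ) (size : Fin b → ℕ)
    (x : (Σ i, Fin (size i)) → ℂ) (p : Σ i, Fin (size i)) :
    ∑ p', jordanMatrix eig size (finSigmaFinEquiv p) (finSigmaFinEquiv p') * x p' =
      jordanMap eig size x p := by
  simp only [jordanMatrix, Matrix.reindex_apply, Matrix.submatrix_apply, Equiv.symm_apply_apply]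
  obtain ⟨i, k⟩ := p
  rw [Fintype.sum_sigma, Finset.sum_eq_single i]
  · simp_rw [Matrix.blockDiagonal'_apply_eq]
    exact sum_jordanBlock _ _ (fun k => x ⟨i, k⟩) k
  · intro j _ hj
    refine Finset.sum_eq_zero fun k' _ => ?_
    rw [Matrix.blockDiagonal'_apply_ne _ _ _ hj.symm, zero_mul]
  · simp

end Blocks

/-! ### From matrices in normal form to direct sums of chains -/

section NormalForm

variable {M N : ℕ}

/-- The state of a normal form is strictly equivalent to a direct sum of blocks. -/
theorem iso_state (F : NormalForm M N) :
    Iso (F.state 0).toLin' (F.state 1).toLin' (LinearMap.id.prodMap (chainA ℂ F.ε F.η))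
      ((jordanMap F.eig F.size).prodMap (chainB ℂ F.ε F.η)) := by
  classical
  obtain ⟨eC, hC⟩ := exists_colEquiv F.η F.ε_anti
  obtain ⟨eR, hR⟩ := exists_rowEquiv F.η F.ε_anti
  let gC : (Σ i, Fin (F.size i)) ⊕ ColIndex F.ε F.η ≃ Fin N :=
    (Equiv.sumCongr finSigmaFinEquiv eC).trans (finSumFinEquiv.trans (finCongr F.cols))
  let gR : (Σ i, Fin (F.size i)) ⊕ RowIndex F.ε F.η ≃ Fin M :=
    (Equiv.sumCongr finSigmaFinEquiv eR).trans (finSumFinEquiv.trans (finCongr F.rows))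
  have hgC1 : ∀ p, (gC (.inl p)).val = (finSigmaFinEquiv p).val := fun _ => rfl
  have hgC2 : ∀ c, (gC (.inr c)).val = ∑ i, F.size i + (eC c).val := fun _ => rfl
  have hgR1 : ∀ p, (gR (.inl p)).val = (finSigmaFinEquiv p).val := fun _ => rfl
  have hgR2 : ∀ c, (gR (.inr c)).val = ∑ i, F.size i + (eR c).val := fun _ => rfl
  have hrows := F.rows
  have hmul : ∀ (A : Matrix (Fin M) (Fin N) ℂ) x r, A.mulVec x (gR r) =
      ∑ p, A (gR r) (gC (.inl p)) * x (gC (.inl p)) +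
        ∑ c, A (gR r) (gC (.inr c)) * x (gC (.inr c)) := by
    intro A x r
    rw [Matrix.mulVec, dotProduct, ← gC.sum_comp, Fintype.sum_sum_type]
  refine ⟨(LinearEquiv.funCongrLeft ℂ ℂ gC).trans (LinearEquiv.sumArrowLequivProdArrow _ _ ℂ ℂ),
    (LinearEquiv.funCongrLeft ℂ ℂ gR).trans (LinearEquiv.sumArrowLequivProdArrow _ _ ℂ ℂ),
    fun x => ?_, fun x => ?_⟩
  · refine Prod.ext ?_ ?_
    · ext p
      refine (hmul (Lam M N) x (.inl p)).trans ?_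
      have h1 : ∀ p', Lam M N (gR (.inl p)) (gC (.inl p')) = if p' = p then 1 else 0 := by
        intro p'
        have h2 := (finSigmaFinEquiv p).isLt
        rw [Lam, Matrix.of_apply]
        refine if_congr ?_ rfl rfl
        rw [hgC1, hgR1]
        constructor
        · rintro ⟨h, -⟩
          exact (finSigmaFinEquiv.injective (Fin.ext h)).symm
        · rintro rfl
          exact ⟨rfl, by omega⟩
      have h3 : ∀ c, Lam M N (gR (.inl p)) (gC (.inr c)) = 0 := by
        intro c
        have h2 := (finSigmaFinEquiv p).isLt
        rw [Lam, Matrix.of_apply, if_neg]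
        rw [hgC2, hgR1]
        omega
      simp_rw [h1, h3]
      simp
    · ext r
      refine (hmul (Lam M N) x (.inr r)).trans ?_
      have h1 : ∀ p', Lam M N (gR (.inr r)) (gC (.inl p')) = 0 := by
        intro p'
        have h2 := (finSigmaFinEquiv p').isLt
        rw [Lam, Matrix.of_apply, if_neg]
        rw [hgC1, hgR2]
        omega
      have h3 : ∀ c, Lam M N (gR (.inr r)) (gC (.inr c)) =
          if (eR r).val = (eC c).val ∧ (eR r).val < ∑ i, F.ε i + F.η then 1 else 0 := by
        intro c
        rw [Lam, Matrix.of_apply]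
        refine if_congr ?_ rfl rfl
        rw [hgC2, hgR2]
        omega
      simp_rw [h1, h3, zero_mul, Finset.sum_const_zero, zero_add]
      exact sum_diagonal hC hR (fun c => x (gC (.inr c))) r
  · have hG : ∀ r c, F.Gam (gR r) (gC c) = Matrix.fromBlocks F.J 0 0 (blockB F.ε F.η)
        (Equiv.sumCongr finSigmaFinEquiv eR r) (Equiv.sumCongr finSigmaFinEquiv eC c) := by
      intro r c
      simp only [NormalForm.Gam, Matrix.reindex_apply, Matrix.submatrix_apply, gR, gC,
        Equiv.trans_apply, Equiv.symm_trans_apply, Equiv.symm_apply_apply]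
    refine Prod.ext ?_ ?_
    · ext p
      refine (hmul F.Gam x (.inl p)).trans ?_
      simp_rw [hG]
      simp only [Equiv.sumCongr_apply, Sum.map_inl, Sum.map_inr, Matrix.fromBlocks_apply₁₁,
        Matrix.fromBlocks_apply₁₂, Matrix.zero_apply, zero_mul, Finset.sum_const_zero, add_zero]
      exact sum_jordanMatrix F.eig F.size (fun p => x (gC (.inl p))) p
    · ext r
      refine (hmul F.Gam x (.inr r)).trans ?_
      simp_rw [hG]
      simp only [Equiv.sumCongr_apply, Sum.map_inl, Sum.map_inr, Matrix.fromBlocks_apply₂₁,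
        Matrix.fromBlocks_apply₂₂, Matrix.zero_apply, zero_mul, Finset.sum_const_zero, zero_add]
      exact sum_blockB hC hR (fun c => x (gC (.inr c))) r

end NormalForm

end Pencil

namespace Pencil

open Module

/-! ### Equivalence up to a change of generators -/

section PairEquiv

variable {K : Type*} [Field K]
variable {V W V' W' V'' W'' : Type*} [AddCommGroup V] [Module K V] [AddCommGroup W] [Module K W]
  [AddCommGroup V'] [Module K V'] [AddCommGroup W'] [Module K W']
  [AddCommGroup V''] [Module K V''] [AddCommGroup W''] [Module K W'']

/-- Equivalence of pencils up to an invertible change of the two generators. -/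
def PairEquiv (A B : V →ₗ[K] W) (A' B' : V' →ₗ[K] W') : Prop :=
  ∃ a b c d : K, a * d - b * c ≠ 0 ∧ Iso (a • A + b • B) (c • A + d • B) A' B'

theorem Iso.pairEquiv {A B : V →ₗ[K] W} {A' B' : V' →ₗ[K] W'} (h : Iso A B A' B') :
    PairEquiv A B A' B' :=
  ⟨1, 0, 0, 1, by simp, by simpa using h⟩

theorem smul_add_smul_comb (A B : V →ₗ[K] W) (a b c d x y : K) :
    x • (a • A + b • B) + y • (c • A + d • B) = (x * a + y * c) • A + (x * b + y * d) • B := by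
  module

theorem PairEquiv.symm {A B : V →ₗ[K] W} {A' B' : V' →ₗ[K] W'} (h : PairEquiv A B A' B') :
    PairEquiv A' B' A B := by
  obtain ⟨a, b, c, d, hdet, h⟩ := h
  set D := a * d - b * c with hD
  have h1 := (h.comb (d / D) (-b / D) (-c / D) (a / D)).symm
  rw [smul_add_smul_comb, smul_add_smul_comb] at h1
  have e1 : d / D * a + -b / D * c = 1 := by
    rw [div_mul_eq_mul_div, div_mul_eq_mul_div, ← add_div, div_eq_one_iff_eq hdet]
    ring
  have e2 : d / D * b + -b / D * d = 0 := by ring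
  have e3 : -c / D * a + a / D * c = 0 := by ring
  have e4 : -c / D * b + a / D * d = 1 := by
    rw [div_mul_eq_mul_div, div_mul_eq_mul_div, ← add_div, div_eq_one_iff_eq hdet]
    ring
  rw [e1, e2, e3, e4, one_smul, one_smul, zero_smul, zero_smul, zero_add, add_zero] at h1
  refine ⟨_, _, _, _, ?_, h1⟩
  have : d / D * (a / D) - -b / D * (-c / D) = D / (D * D) := by
    rw [div_mul_div_comm, div_mul_div_comm, ← sub_div]
    congr 1
    rw [hD]
    ring
  rw [this]
  exact div_ne_zero hdet (mul_ne_zero hdet hdet)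

theorem PairEquiv.trans {A B : V →ₗ[K] W} {A' B' : V' →ₗ[K] W'} {A'' B'' : V'' →ₗ[K] W''}
    (h : PairEquiv A B A' B') (h' : PairEquiv A' B' A'' B'') : PairEquiv A B A'' B'' := by
  obtain ⟨a, b, c, d, hdet, h⟩ := h
  obtain ⟨a', b', c', d', hdet', h'⟩ := h'
  have h1 := (h.comb a' b' c' d').trans h'
  rw [smul_add_smul_comb, smul_add_smul_comb] at h1
  refine ⟨_, _, _, _, ?_, h1⟩
  have : (a' * a + b' * c) * (c' * b + d' * d) - (a' * b + b' * d) * (c' * a + d' * c) =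
      (a' * d' - b' * c') * (a * d - b * c) := by ring
  rw [this]
  exact mul_ne_zero hdet' hdet

theorem Iso.finrank_range {A B : V →ₗ[K] W} {A' B' : V' →ₗ[K] W'} (h : Iso A B A' B') :
    finrank K (LinearMap.range A) = finrank K (LinearMap.range A') := by
  obtain ⟨e, f, h1, -⟩ := h
  refine LinearEquiv.finrank_eq ((f.submoduleMap _).trans (LinearEquiv.ofEq _ _ ?_))
  ext z
  constructor
  · rintro ⟨_, ⟨x, rfl⟩, rfl⟩
    exact ⟨e x, (h1 x).symm⟩
  · rintro ⟨x, rfl⟩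
    obtain ⟨x, rfl⟩ := e.surjective x
    exact ⟨A x, ⟨x, rfl⟩, h1 x⟩

theorem PairEquiv.ker_inf_ker {A B : V →ₗ[K] W} {A' B' : V' →ₗ[K] W'} (h : PairEquiv A B A' B')
    (hk : LinearMap.ker A' ⊓ LinearMap.ker B' = ⊥) : LinearMap.ker A ⊓ LinearMap.ker B = ⊥ := by
  obtain ⟨a, b, c, d, -, e, f, h1, h2⟩ := h
  rw [eq_bot_iff]
  rintro x ⟨hA, hB⟩
  have hA : A x = 0 := hA
  have hB : B x = 0 := hB
  have : e x ∈ LinearMap.ker A' ⊓ LinearMap.ker B' := by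
    refine Submodule.mem_inf.2 ⟨?_, ?_⟩
    · rw [LinearMap.mem_ker, ← h1]
      simp [hA, hB]
    · rw [LinearMap.mem_ker, ← h2]
      simp [hA, hB]
  rw [hk, Submodule.mem_bot] at this
  simpa using this

theorem PairEquiv.range_sup_range {A B : V →ₗ[K] W} {A' B' : V' →ₗ[K] W'}
    (h : PairEquiv A B A' B') (hk : LinearMap.range A' ⊔ LinearMap.range B' = ⊤) :
    LinearMap.range A ⊔ LinearMap.range B = ⊤ := by
  obtain ⟨a, b, c, d, -, e, f, h1, h2⟩ := h
  rw [eq_top_iff]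
  rintro w -
  have hw : f w ∈ LinearMap.range A' ⊔ LinearMap.range B' := hk ▸ Submodule.mem_top
  obtain ⟨_, ⟨x, rfl⟩, _, ⟨y, rfl⟩, hxy⟩ := Submodule.mem_sup.1 hw
  obtain ⟨x, rfl⟩ := e.surjective x
  obtain ⟨y, rfl⟩ := e.surjective y
  rw [← h1, ← h2, ← map_add] at hxy
  rw [← f.injective hxy]
  have : (a • A + b • B) x + (c • A + d • B) y = A (a • x + c • y) + B (b • x + d • y) := by
    simp only [LinearMap.add_apply, LinearMap.smul_apply, map_add, map_smul]
    abel
  rw [this]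
  exact Submodule.add_mem_sup ⟨_, rfl⟩ ⟨_, rfl⟩

theorem smul_prodMap_add (A B : V →ₗ[K] W) (A' B' : V' →ₗ[K] W') (a b : K) :
    a • A.prodMap A' + b • B.prodMap B' = (a • A + b • B).prodMap (a • A' + b • B') := by
  ext <;> simp

end PairEquiv

/-! ### Kernels, ranges and invariants of the normal form -/

section Model

variable {K : Type*} [Field K] {ι : Type*}
variable {E E' : Type*} [AddCommGroup E] [Module K E] [AddCommGroup E'] [Module K E']

theorem mem_range_id_prodMap_chainA (ε : ι → ℕ) (η : ℕ) (w : E × (RowIndex ε η → K)) :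
    w ∈ LinearMap.range (LinearMap.id.prodMap (chainA K ε η) : E × _ →ₗ[K] E × _) ↔
      w.2 (.inr 0) = 0 := by
  constructor
  · rintro ⟨x, rfl⟩
    rfl
  · intro h
    refine ⟨(w.1, Sum.elim (fun p => if hk : 0 < p.2.val then
      w.2 (.inl ⟨p.1, ⟨p.2.val - 1, by omega⟩⟩) else 0) fun k => w.2 (.inr k.succ)),
      Prod.ext rfl ?_⟩
    ext (p | k)
    · simp
    · refine Fin.cases ?_ (fun k => ?_) k
      · exact h.symm
      · rfl

theorem chainA_not_surjective (ε : ι → ℕ) (η : ℕ) :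
    ¬ Function.Surjective (chainA K ε η) := by
  classical
  intro h
  obtain ⟨x, hx⟩ := h (Pi.single (.inr 0) 1)
  have := congrFun hx (.inr 0)
  simp at this

/-- A row chain of length zero is a zero column of both maps. Otherwise `B` sees the first
coordinate of each row chain and `A` sees all the others. -/
theorem ker_inf_ker_chain_eq_bot_iff (g : E →ₗ[K] E) (ε : ι → ℕ) (η : ℕ) :
    LinearMap.ker (LinearMap.id.prodMap (chainA K ε η)) ⊓
      LinearMap.ker (g.prodMap (chainB K ε η)) = ⊥ ↔ ∀ i, 1 ≤ ε i := by
  classical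
  constructor
  · intro h i
    by_contra hi
    have hi : ε i = 0 := by omega
    have hne : ∀ p : Σ i, Fin (ε i), p.1 ≠ i := by
      rintro p rfl
      have := p.2.isLt
      omega
    have hmem : ((0, Pi.single (.inl ⟨i, 0⟩) 1) : E × (ColIndex ε η → K)) ∈
        LinearMap.ker (LinearMap.id.prodMap (chainA K ε η)) ⊓
          LinearMap.ker (g.prodMap (chainB K ε η)) := by
      have hz : (fun k : Fin η => (Pi.single (.inl ⟨i, 0⟩) 1 : ColIndex ε η → K) (.inr k)) = 0 := by
        ext k
        simp
      have hzA : chainA K ε η (Pi.single (.inl ⟨i, 0⟩) 1) = 0 := by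
        ext (p | k)
        · rw [chainA_inl, Pi.single_eq_of_ne, Pi.zero_apply]
          intro h2
          exact hne p (congrArg Sigma.fst (Sum.inl_injective h2))
        · rw [chainA_inr, hz, map_zero]
          rfl
      have hzB : chainB K ε η (Pi.single (.inl ⟨i, 0⟩) 1) = 0 := by
        ext (p | k)
        · rw [chainB_inl, Pi.single_eq_of_ne, Pi.zero_apply]
          intro h2
          exact hne p (congrArg Sigma.fst (Sum.inl_injective h2))
        · rw [chainB_inr, hz, map_zero]
          rfl
      exact Submodule.mem_inf.2 ⟨LinearMap.mem_ker.2 (Prod.ext rfl hzA),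
        LinearMap.mem_ker.2 (Prod.ext (map_zero g) hzB)⟩
    rw [h, Submodule.mem_bot] at hmem
    have := congrFun (congrArg Prod.snd hmem) (.inl ⟨i, 0⟩)
    simp at this
  · intro hε
    rw [eq_bot_iff]
    rintro ⟨u, x⟩ ⟨hA, hB⟩
    have hA1 : u = 0 := congrArg Prod.fst hA
    have hA2 : chainA K ε η x = 0 := congrArg Prod.snd hA
    have hB2 : chainB K ε η x = 0 := congrArg Prod.snd hB
    refine Prod.ext hA1 ?_
    ext (⟨i, k⟩ | k)
    · refine Fin.cases ?_ (fun k => ?_) k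
      · exact congrFun hB2 (.inl ⟨i, ⟨0, hε i⟩⟩)
      · exact congrFun hA2 (.inl ⟨i, k⟩)
    · exact congrFun hA2 (.inr k.succ)

/-- A column chain of length zero is a zero row of both maps. Otherwise the one coordinate missed by
`A` is hit by `B`. -/
theorem range_sup_range_chain_eq_top_iff (g : E →ₗ[K] E) (ε : ι → ℕ) (η : ℕ) :
    LinearMap.range (LinearMap.id.prodMap (chainA K ε η)) ⊔
      LinearMap.range (g.prodMap (chainB K ε η)) = ⊤ ↔ 1 ≤ η := by
  classical
  constructor
  · intro h
    by_contra hη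
    obtain rfl : η = 0 := by omega
    have hmem : ((0, Pi.single (.inr 0) 1) : E × (RowIndex ε 0 → K)) ∈
        LinearMap.range (LinearMap.id.prodMap (chainA K ε 0)) ⊔
          LinearMap.range (g.prodMap (chainB K ε 0)) := h ▸ Submodule.mem_top
    obtain ⟨_, ⟨x, rfl⟩, _, ⟨y, rfl⟩, hxy⟩ := Submodule.mem_sup.1 hmem
    have h1 := congrFun (congrArg Prod.snd hxy) (.inr 0)
    have h2 : colB K 0 (fun k => y.2 (.inr k)) 0 = 0 := colB_last K 0 _
    simp [h2] at h1
  · intro hη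
    rw [eq_top_iff]
    rintro w -
    have h1 : (w - (0, Pi.single (.inr 0) (w.2 (.inr 0)))) ∈
        LinearMap.range (LinearMap.id.prodMap (chainA K ε η) : E × _ →ₗ[K] E × _) := by
      rw [mem_range_id_prodMap_chainA]
      simp
    have h2 : (0, Pi.single (.inr 0) (w.2 (.inr 0))) ∈
        LinearMap.range (g.prodMap (chainB K ε η)) := by
      refine ⟨(0, Pi.single (.inr ⟨0, hη⟩) (w.2 (.inr 0))), Prod.ext (map_zero g) ?_⟩
      change chainB K ε η (Pi.single (.inr ⟨0, hη⟩) (w.2 (.inr 0))) =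
        Pi.single (.inr 0) (w.2 (.inr 0))
      ext (p | k)
      · simp
      · rw [chainB_inr]
        refine Fin.lastCases ?_ (fun k => ?_) k
        · rw [colB_last, Pi.single_eq_of_ne]
          intro h
          have := congrArg Fin.val (Sum.inr_injective h)
          simp at this
          omega
        · rw [colB_castSucc]
          by_cases hk : k = ⟨0, hη⟩
          · subst hk
            have : (Fin.castSucc ⟨0, hη⟩ : Fin (η + 1)) = 0 := rfl
            rw [this, Pi.single_eq_same, Pi.single_eq_same]
          · rw [Pi.single_eq_of_ne (by simpa using hk), Pi.single_eq_of_ne]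
            intro h
            refine hk (Fin.ext ?_)
            simpa using congrArg Fin.val (Sum.inr_injective h)
    rw [← sub_add_cancel w (0, Pi.single (.inr 0) (w.2 (.inr 0)))]
    exact Submodule.add_mem_sup h1 h2

/-- The invariants of a pencil in normal form under strict equivalence. -/
theorem Iso.invariants {q : ℕ} [FiniteDimensional K E] [FiniteDimensional K E']
    {ε ε' : Fin q → ℕ} {η η' : ℕ} {g : E →ₗ[K] E} {g' : E' →ₗ[K] E'}
    (hε : Antitone ε) (hε' : Antitone ε')
    (h : Iso (LinearMap.id.prodMap (chainA K ε η)) (g.prodMap (chainB K ε η))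
      (LinearMap.id.prodMap (chainA K ε' η')) (g'.prodMap (chainB K ε' η'))) :
    ε = ε' ∧ η = η' ∧ ∀ (c : K) (j : ℕ), finrank K (LinearMap.ker ((g - c • LinearMap.id) ^ j)) =
      finrank K (LinearMap.ker ((g' - c • LinearMap.id) ^ j)) := by
  have h1 : ∀ j, ∑ i, min j (ε i + 1) = ∑ i, min j (ε' i + 1) := by
    intro j
    have := h.finrank_relIter_bot j
    rwa [finrank_relIter_bot_prodMap, finrank_relIter_bot_prodMap, relIter_id_bot, relIter_id_bot,
      finrank_bot, finrank_bot, zero_add, zero_add, finrank_relIter_chain_bot,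
      finrank_relIter_chain_bot] at this
  obtain ⟨σ, hσ⟩ := exists_equiv_of_sum_min_eq (fun _ : Fin q => ()) (fun i => ε i + 1)
    (fun _ : Fin q => ()) (fun i => ε' i + 1) (fun _ => Nat.succ_pos _) (fun _ => Nat.succ_pos _)
    fun c j => by simpa using h1 j
  obtain rfl : ε = ε' := antitone_eq_of_perm hε hε' σ fun i => by
    have := (hσ i).2
    omega
  have h2 : ∀ j, min j η = min j η' := by
    intro j
    have e1 := h.swap.finrank_relIter_top j
    rw [finrank_relIter_top_prodMap, finrank_relIter_top_prodMap, relIter_id_top, relIter_id_top,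
      finrank_top, finrank_top] at e1
    have e2 := finrank_relIter_chain_top_add K ε η j
    have e3 := finrank_relIter_chain_top_add K ε η' j
    obtain ⟨e, -, -, -⟩ := h
    have e4 := e.finrank_eq
    rw [finrank_prod, finrank_prod, Module.finrank_pi, Module.finrank_pi] at e4
    omega
  obtain rfl : η = η' := by
    have e1 := h2 η
    have e2 := h2 η'
    omega
  refine ⟨rfl, rfl, fun c j => ?_⟩
  -- Passing to `(B - c A, A)` turns the iterates on the Jordan part into kernels of powers. The
  -- chain parts of both sides are now identical and cancel.
  have hc := h.comb (-c) 1 1 0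
  rw [smul_prodMap_add, smul_prodMap_add, smul_prodMap_add, smul_prodMap_add] at hc
  have e1 := hc.finrank_relIter_bot j
  rw [finrank_relIter_bot_prodMap, finrank_relIter_bot_prodMap, add_left_inj] at e1
  rw [← relIter_id_eq_ker_pow, ← relIter_id_eq_ker_pow]
  have e3 : -c • LinearMap.id + (1 : K) • g = g - c • LinearMap.id := by module
  have e4 : -c • LinearMap.id + (1 : K) • g' = g' - c • LinearMap.id := by module
  have e5 : (1 : K) • LinearMap.id + (0 : K) • g = LinearMap.id := by module
  have e6 : (1 : K) • LinearMap.id + (0 : K) • g' = LinearMap.id := by module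
  rwa [e3, e4, e5, e6] at e1

end Model

/-! ### Fractional linear images of Jordan matrices -/

section JordanMobius

variable {K : Type*} [Field K] {ι : Type*} [Fintype ι]

theorem jordanMap_comb_injective_iff (eig : ι → K) (size : ι → ℕ) (hs : ∀ i, 0 < size i) (a b : K)
    (hab : a ≠ 0 ∨ b ≠ 0) :
    Function.Injective (a • LinearMap.id + b • jordanMap eig size :
      ((Σ i, Fin (size i)) → K) →ₗ[K] ((Σ i, Fin (size i)) → K)) ↔ ∀ i, a + b * eig i ≠ 0 := by
  classical
  have h := finrank_ker_pow_jordanMap eig size b a hab.symm 1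
  rw [pow_one, add_comm] at h
  rw [← LinearMap.ker_eq_bot, ← Submodule.finrank_eq_zero (R := K), h,
    Finset.sum_eq_zero_iff_of_nonneg (fun _ _ => Nat.zero_le _)]
  refine forall_congr' fun i => ?_
  have := hs i
  rw [add_comm (b * eig i)]
  by_cases hi : a + b * eig i = 0
  · simp [hi]
    omega
  · simp [hi]

/-- The fractional linear image of a Jordan matrix has the Jordan form obtained by transforming the
eigenvalues. -/
theorem exists_iso_mobius (eig : ι → K) (size : ι → ℕ) (hs : ∀ i, 0 < size i) (a b c d : K)
    (hdet : a * d - b * c ≠ 0) (h0 : ∀ i, a + b * eig i ≠ 0) :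
    ∃ g : ((Σ i, Fin (size i)) → K) →ₗ[K] ((Σ i, Fin (size i)) → K),
      Iso (a • LinearMap.id + b • jordanMap eig size) (c • LinearMap.id + d • jordanMap eig size)
        LinearMap.id g ∧
      ∀ (m : K) (j : ℕ), finrank K (LinearMap.ker ((g - m • LinearMap.id) ^ j)) =
        finrank K (LinearMap.ker
          ((jordanMap (fun i => (c + d * eig i) / (a + b * eig i)) size - m • LinearMap.id) ^ j)) := by
  classical
  have hab : a ≠ 0 ∨ b ≠ 0 := by
    by_contra! h
    simp [h.1, h.2] at hdet
  have hinj := (jordanMap_comb_injective_iff eig size hs a b hab).2 h0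
  let u := LinearEquiv.ofInjectiveEndo _ hinj
  have hu : ∀ x, u x = a • x + b • jordanMap eig size x := fun _ => rfl
  let g : ((Σ i, Fin (size i)) → K) →ₗ[K] ((Σ i, Fin (size i)) → K) :=
    u.symm.toLinearMap ∘ₗ (c • LinearMap.id + d • jordanMap eig size)
  have hg : ∀ x, u (g x) = c • x + d • jordanMap eig size x := by
    intro x
    simp [g]
  refine ⟨g, ⟨LinearEquiv.refl _ _, u.symm, fun x => ?_, fun x => rfl⟩, fun m j => ?_⟩
  · exact u.symm_apply_apply x
  · have hrs : d - m * b ≠ 0 ∨ c - m * a ≠ 0 := by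
      by_contra! h
      refine hdet ?_
      rw [sub_eq_zero.1 h.1, sub_eq_zero.1 h.2]
      ring
    -- With `u = a + b J` and `u g = c + d J`, multiplying `g - m` by the commuting invertible `u`
    -- clears the denominator without changing the kernels of powers.
    have h1 : LinearMap.ker ((g - m • LinearMap.id) ^ j) = LinearMap.ker
        (((d - m * b) • jordanMap eig size + (c - m * a) • LinearMap.id) ^ j) := by
      have e1 : ((d - m * b) • jordanMap eig size + (c - m * a) • LinearMap.id) =
          u.toLinearMap * (g - m • LinearMap.id) := by
        refine LinearMap.ext fun x => ?_
        change _ = u (g x - m • x)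
        rw [map_sub, hg, map_smul, hu]
        simp only [LinearMap.add_apply, LinearMap.smul_apply, LinearMap.id_apply]
        module
      have hcomm : Commute u.toLinearMap (g - m • LinearMap.id) := by
        refine LinearMap.ext fun x => ?_
        change u (g x - m • x) = g (u x) - m • u x
        have e2 : u (g (u x)) = u (u (g x)) := by
          rw [hg, hg, hu, hu]
          simp only [map_add, map_smul]
          module
        rw [u.injective e2, map_sub, map_smul]
      rw [e1, hcomm.mul_pow]
      ext x
      rw [LinearMap.mem_ker, LinearMap.mem_ker, Module.End.mul_apply]
      have hinj' : Function.Injective (u.toLinearMap ^ j) := by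
        rw [Module.End.coe_pow]
        exact u.injective.iterate j
      rw [map_eq_zero_iff _ hinj']
    have h2 := finrank_ker_pow_jordanMap (fun i => (c + d * eig i) / (a + b * eig i)) size 1 (-m)
      (Or.inl one_ne_zero) j
    have e3 : (1 : K) • jordanMap (fun i => (c + d * eig i) / (a + b * eig i)) size +
        (-m) • LinearMap.id =
          jordanMap (fun i => (c + d * eig i) / (a + b * eig i)) size - m • LinearMap.id := by
      refine LinearMap.ext fun x => ?_
      rw [LinearMap.add_apply, LinearMap.sub_apply, LinearMap.smul_apply, LinearMap.smul_apply,
        LinearMap.smul_apply, one_smul, neg_smul, sub_eq_add_neg]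
    rw [e3] at h2
    rw [h1, h2, finrank_ker_pow_jordanMap _ _ _ _ hrs]
    refine Finset.sum_congr rfl fun i _ => if_congr ?_ rfl rfl
    rw [one_mul, ← sub_eq_add_neg, sub_eq_zero, div_eq_iff (h0 i)]
    constructor <;> intro h <;> linear_combination h

end JordanMobius

/-! ### Classification of pencils in normal form -/

section Classification

variable {K : Type*} [Field K] {q : ℕ} {ι ι' : Type*} [Fintype ι] [Fintype ι']

theorem iso_comb_normal_form {eig : ι → K} {size : ι → ℕ} (hs : ∀ i, 0 < size i) (ε : Fin q → ℕ)
    (η : ℕ) {a b c d : K} (hdet : a * d - b * c ≠ 0) (h0 : ∀ i, a + b * eig i ≠ 0) :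
    ∃ g : ((Σ i, Fin (size i)) → K) →ₗ[K] ((Σ i, Fin (size i)) → K),
      Iso (a • LinearMap.id.prodMap (chainA K ε η) +
          b • (jordanMap eig size).prodMap (chainB K ε η))
        (c • LinearMap.id.prodMap (chainA K ε η) + d • (jordanMap eig size).prodMap (chainB K ε η))
        (LinearMap.id.prodMap (chainA K ε η)) (g.prodMap (chainB K ε η)) ∧
      ∀ (m : K) (j : ℕ), finrank K (LinearMap.ker ((g - m • LinearMap.id) ^ j)) =
        finrank K (LinearMap.ker
          ((jordanMap (fun i => (c + d * eig i) / (a + b * eig i)) size - m • LinearMap.id) ^ j)) := by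
  obtain ⟨g, hg, hg'⟩ := exists_iso_mobius eig size hs a b c d hdet h0
  refine ⟨g, ?_, hg'⟩
  rw [smul_prodMap_add, smul_prodMap_add]
  exact hg.prodMap (iso_chain_comb ε η a b c d hdet)

/-- Equivalence of pencils in normal form. -/
theorem pairEquiv_normal_form_iff [IsAlgClosed K] {eig : ι → K} {size : ι → ℕ}
    (hs : ∀ i, 0 < size i) {eig' : ι' → K} {size' : ι' → ℕ} (hs' : ∀ i, 0 < size' i)
    {ε ε' : Fin q → ℕ} (hε : Antitone ε) (hε' : Antitone ε') (η η' : ℕ) :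
    PairEquiv (LinearMap.id.prodMap (chainA K ε η)) ((jordanMap eig size).prodMap (chainB K ε η))
      (LinearMap.id.prodMap (chainA K ε' η')) ((jordanMap eig' size').prodMap (chainB K ε' η')) ↔
    (ε = ε' ∧ η = η') ∧ ∃ a b c d : K, a * d - b * c ≠ 0 ∧ ∃ σ : ι ≃ ι', ∀ i,
      size' (σ i) = size i ∧ a + b * eig i ≠ 0 ∧
        eig' (σ i) = (c + d * eig i) / (a + b * eig i) := by
  classical
  constructor
  · rintro ⟨a, b, c, d, hdet, h⟩
    have hab : a ≠ 0 ∨ b ≠ 0 := by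
      by_contra! h
      simp [h.1, h.2] at hdet
    -- The range of the new first map is a hyperplane, and the chain part alone already fails to be
    -- surjective at some `z`. Hence (0, z) spans the quotient by that hyperplane, and the Jordan
    -- part `a + b J` must be surjective.
    have h0 : ∀ i, a + b * eig i ≠ 0 := by
      rw [← jordanMap_comb_injective_iff eig size hs a b hab]
      refine LinearMap.injective_iff_surjective.2 fun w => ?_
      have hns : ∃ z, z ∉ LinearMap.range (a • chainA K ε η + b • chainB K ε η) := by
        by_contra! hall
        obtain ⟨e, f, h1, -⟩ := iso_chain_comb (K := K) ε η a b c d hdet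
        refine chainA_not_surjective (K := K) ε η fun z => ?_
        obtain ⟨x, hx⟩ := hall (f.symm z)
        exact ⟨e x, by rw [← h1, hx, LinearEquiv.apply_symm_apply]⟩
      obtain ⟨z, hz⟩ := hns
      obtain ⟨e, f, h1, -⟩ := h
      rw [smul_prodMap_add] at h1
      have hrange : ∀ y, f y ∈ LinearMap.range (LinearMap.id.prodMap (chainA K ε' η')) ↔
          y ∈ LinearMap.range ((a • LinearMap.id + b • jordanMap eig size).prodMap
            (a • chainA K ε η + b • chainB K ε η)) := by
        intro y
        constructor
        · rintro ⟨x, hx⟩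
          obtain ⟨x, rfl⟩ := e.surjective x
          rw [← h1] at hx
          exact ⟨x, f.injective hx⟩
        · rintro ⟨x, rfl⟩
          exact ⟨e x, (h1 x).symm⟩
      have hz' : (f (0, z)).2 (.inr 0) ≠ 0 := by
        intro h2
        rw [← mem_range_id_prodMap_chainA, hrange] at h2
        obtain ⟨x, hx⟩ := h2
        exact hz ⟨x.2, congrArg Prod.snd hx⟩
      have h3 : f ((w, 0) - ((f (w, 0)).2 (.inr 0) / (f (0, z)).2 (.inr 0)) • (0, z)) ∈
          LinearMap.range (LinearMap.id.prodMap (chainA K ε' η')) := by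
        rw [mem_range_id_prodMap_chainA, map_sub, map_smul]
        simp [div_mul_cancel₀ _ hz']
      rw [hrange] at h3
      obtain ⟨x, hx⟩ := h3
      exact ⟨x.1, by simpa using congrArg Prod.fst hx⟩
    obtain ⟨g, hg, hg'⟩ := iso_comb_normal_form (K := K) (eig := eig) hs ε η hdet h0
    obtain ⟨h1, h2, h3⟩ := (hg.symm.trans h).invariants hε hε'
    obtain ⟨σ, hσ⟩ := exists_equiv_of_finrank_ker_pow _ size eig' size' hs hs'
      fun m j => (hg' m j).symm.trans (h3 m j)
    exact ⟨⟨h1, h2⟩, a, b, c, d, hdet, σ, fun i => ⟨(hσ i).2, h0 i, (hσ i).1⟩⟩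
  · rintro ⟨⟨rfl, rfl⟩, a, b, c, d, hdet, σ, hσ⟩
    obtain ⟨g, hg, hg'⟩ := iso_comb_normal_form (K := K) (eig := eig) hs ε η hdet
      fun i => (hσ i).2.1
    obtain ⟨e, he⟩ := exists_equiv_jordanMap_perm
      (fun i => (c + d * eig i) / (a + b * eig i)) size eig' size' σ
      fun i => ⟨(hσ i).2.2, (hσ i).1⟩
    obtain ⟨e', he'⟩ := exists_equiv_of_finrank_ker_pow_eq g (jordanMap eig' size') fun m j => by
      rw [hg']
      exact finrank_ker_pow_congr _ _ e (fun x => by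
        rw [LinearMap.sub_apply, LinearMap.sub_apply, map_sub, he]
        simp) j
    refine ⟨a, b, c, d, hdet, hg.trans (Iso.prodMap ⟨e', e', fun _ => rfl, he'⟩ (Iso.refl _ _))⟩

end Classification

end Pencil

namespace Pencil

open Module Slocc

/-! ### Nonsingular reduced density matrices -/

section Gram

variable {m n : Type*} [Fintype m] [Fintype n]

/-- The quadratic form of the matrix at `v` is the sum of the squared norms of the vectors `ψ i v`.
-/
theorem det_sum_conjTranspose_mul_ne_zero_iff [DecidableEq n]
    (ψ : Fin 2 → Matrix m n ℂ) :
    (∑ i, (ψ i).conjTranspose * ψ i).det ≠ 0 ↔ ∀ v, (∀ i, (ψ i).mulVec v = 0) → v = 0 := by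
  open scoped ComplexOrder in
  rw [← not_iff_not, not_not, ← Matrix.exists_mulVec_eq_zero_iff]
  push Not
  refine exists_congr fun v => ?_
  rw [and_comm]
  refine and_congr_left fun _ => ?_
  constructor
  · intro h
    have h1 : ∑ i, star ((ψ i).mulVec v) ⬝ᵥ (ψ i).mulVec v = 0 := by
      rw [← dotProduct_zero (star v), ← h, Matrix.sum_mulVec, dotProduct_sum]
      refine Finset.sum_congr rfl fun i _ => ?_
      rw [← Matrix.mulVec_mulVec, Matrix.star_mulVec, Matrix.dotProduct_mulVec,
        Matrix.dotProduct_mulVec, Matrix.dotProduct_mulVec]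
    rw [Finset.sum_eq_zero_iff_of_nonneg fun i _ => dotProduct_star_self_nonneg _] at h1
    exact fun i => dotProduct_star_self_eq_zero.1 (h1 i (Finset.mem_univ i))
  · intro h
    rw [Matrix.sum_mulVec]
    exact Finset.sum_eq_zero fun i _ => by rw [← Matrix.mulVec_mulVec, h, Matrix.mulVec_zero]

theorem det_sum_conjTranspose_mul_ne_zero_iff_ker [DecidableEq n]
    (ψ : Fin 2 → Matrix m n ℂ) :
    (∑ i, (ψ i).conjTranspose * ψ i).det ≠ 0 ↔
      LinearMap.ker (ψ 0).toLin' ⊓ LinearMap.ker (ψ 1).toLin' = ⊥ := by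
  rw [det_sum_conjTranspose_mul_ne_zero_iff, Submodule.eq_bot_iff]
  refine forall_congr' fun v => imp_congr_left ?_
  rw [Fin.forall_fin_two, Submodule.mem_inf, LinearMap.mem_ker, LinearMap.mem_ker,
    Matrix.toLin'_apply, Matrix.toLin'_apply]

/-- Dual to the kernel criterion: a common kernel vector of the adjoints is a linear functional
vanishing on both ranges. -/
theorem det_sum_mul_conjTranspose_ne_zero_iff_range [DecidableEq m] [DecidableEq n]
    (ψ : Fin 2 → Matrix m n ℂ) :
    (∑ i, ψ i * (ψ i).conjTranspose).det ≠ 0 ↔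
      LinearMap.range (ψ 0).toLin' ⊔ LinearMap.range (ψ 1).toLin' = ⊤ := by
  open scoped ComplexOrder in
  have h := det_sum_conjTranspose_mul_ne_zero_iff fun i => (ψ i).conjTranspose
  simp only [Matrix.conjTranspose_conjTranspose] at h
  rw [h]
  constructor
  · intro h
    by_contra hne
    obtain ⟨f, hf, hle⟩ := Submodule.exists_le_ker_of_lt_top _ (lt_top_iff_ne_top.2 hne)
    have hf' : ∀ x, f x = (fun k => f (Pi.single k 1)) ⬝ᵥ x := by
      intro x
      rw [LinearMap.pi_apply_eq_sum_univ f x, dotProduct]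
      refine Finset.sum_congr rfl fun k _ => ?_
      rw [smul_eq_mul, mul_comm]
      congr 2
      ext j
      simp [Pi.single_apply, eq_comm]
    refine hf (LinearMap.ext fun x => ?_)
    rw [hf', ← star_star (fun k => f (Pi.single k 1)),
      h (star fun k => f (Pi.single k 1)) fun i => ?_, star_zero, zero_dotProduct]
    · rfl
    · rw [Matrix.mulVec_conjTranspose, star_star]
      rw [star_eq_zero]
      ext k
      have h1 : f ((ψ i).toLin' (Pi.single k 1)) = 0 := by
        refine hle ?_
        have h2 : ∀ i, (ψ i).toLin' (Pi.single k 1) ∈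
            LinearMap.range (ψ 0).toLin' ⊔ LinearMap.range (ψ 1).toLin' :=
          Fin.forall_fin_two.2 ⟨Submodule.mem_sup_left ⟨_, rfl⟩, Submodule.mem_sup_right ⟨_, rfl⟩⟩
        exact h2 i
      rw [hf', Matrix.toLin'_apply, Matrix.dotProduct_mulVec] at h1
      simpa using h1
  · intro h v hv
    have hv' : ∀ i x, star v ⬝ᵥ (ψ i).mulVec x = 0 := by
      intro i x
      have := congrArg star (hv i)
      rw [Matrix.mulVec_conjTranspose, star_star, star_zero] at this
      rw [Matrix.dotProduct_mulVec, this, zero_dotProduct]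
    have hmem : v ∈ LinearMap.range (ψ 0).toLin' ⊔ LinearMap.range (ψ 1).toLin' :=
      h ▸ Submodule.mem_top
    obtain ⟨_, ⟨x, rfl⟩, _, ⟨y, rfl⟩, hxy⟩ := Submodule.mem_sup.1 hmem
    refine dotProduct_star_self_eq_zero.1 ?_
    nth_rw 2 [← hxy]
    rw [dotProduct_add, Matrix.toLin'_apply, Matrix.toLin'_apply, hv', hv', add_zero]

/-- This is a Gram matrix for the trace inner product: a kernel vector gives a combination
orthogonal to both matrices, hence to itself. -/
theorem det_gram_ne_zero (ψ : Fin 2 → Matrix m n ℂ)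
    (h : ∀ v : Fin 2 → ℂ, ∑ i, v i • ψ i = 0 → v = 0) :
    (Matrix.of fun i j : Fin 2 => (ψ i * (ψ j).conjTranspose).trace).det ≠ 0 := by
  open scoped ComplexOrder in
  intro hdet
  obtain ⟨v, hv, h0⟩ := Matrix.exists_mulVec_eq_zero_iff.2 hdet
  refine hv (star_eq_zero.1 (h (star v) ?_))
  rw [← Matrix.trace_mul_conjTranspose_self_eq_zero_iff]
  have h1 : ∀ i, (ψ i * (∑ j, star v j • ψ j).conjTranspose).trace = 0 := by
    intro i
    have := congrFun h0 i
    rw [Matrix.mulVec, dotProduct] at this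
    rw [Matrix.conjTranspose_sum, Matrix.mul_sum, Matrix.trace_sum]
    refine Eq.trans (Finset.sum_congr rfl fun j _ => ?_) this
    rw [Matrix.conjTranspose_smul, Matrix.mul_smul, Matrix.trace_smul, Matrix.of_apply, smul_eq_mul,
      Pi.star_apply, star_star, mul_comm]
  rw [Matrix.sum_mul, Matrix.trace_sum]
  exact Finset.sum_eq_zero fun i _ => by
    rw [Matrix.smul_mul, Matrix.trace_smul, h1, smul_zero]

end Gram

/-! ### Transfer to states -/

section State

variable {M N : ℕ}

theorem equivalent_iff_pairEquiv {ψ φ : State M N} :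
    Equivalent ψ φ ↔ PairEquiv (ψ 0).toLin' (ψ 1).toLin' (φ 0).toLin' (φ 1).toLin' := by
  constructor
  · rintro ⟨T, P, Q, h⟩
    refine ⟨T.val 0 0, T.val 0 1, T.val 1 0, T.val 1 1, ?_,
      Matrix.toLin'OfInv (Units.mul_inv Q) (Units.inv_mul Q),
      Matrix.toLin'OfInv (Units.inv_mul P) (Units.mul_inv P), fun x => ?_, fun x => ?_⟩
    · rw [← Matrix.det_fin_two]
      exact ((Matrix.isUnit_iff_isUnit_det _).1 T.isUnit).ne_zero
    all_goals
      change P.val.mulVec _ = (φ _).mulVec ((Q⁻¹).val.mulVec x)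
      rw [h, Matrix.mulVec_mulVec, Fin.sum_univ_two, Matrix.add_mul, Matrix.smul_mul,
        Matrix.smul_mul, Matrix.mul_assoc _ Q.val, Matrix.mul_assoc _ Q.val, Units.mul_inv,
        Matrix.mul_one, Matrix.mul_one, Matrix.add_mulVec, Matrix.smul_mulVec, Matrix.smul_mulVec,
        ← Matrix.mulVec_mulVec, ← Matrix.mulVec_mulVec, LinearMap.add_apply, LinearMap.smul_apply,
        LinearMap.smul_apply, Matrix.mulVec_add, Matrix.mulVec_smul, Matrix.mulVec_smul,
        Matrix.toLin'_apply, Matrix.toLin'_apply]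
  · rintro ⟨a, b, c, d, hdet, e, f, h0, h1⟩
    let P : GL (Fin M) ℂ := ⟨LinearMap.toMatrix' f.toLinearMap, LinearMap.toMatrix' f.symm.toLinearMap,
      by rw [← LinearMap.toMatrix'_comp]; simp, by rw [← LinearMap.toMatrix'_comp]; simp⟩
    let Q : GL (Fin N) ℂ := ⟨LinearMap.toMatrix' e.symm.toLinearMap, LinearMap.toMatrix' e.toLinearMap,
      by rw [← LinearMap.toMatrix'_comp]; simp, by rw [← LinearMap.toMatrix'_comp]; simp⟩
    refine ⟨Matrix.GeneralLinearGroup.mkOfDetNeZero !![a, b; c, d] (by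
      rwa [Matrix.det_fin_two_of]), P, Q, Fin.forall_fin_two.2 ⟨?_, ?_⟩⟩
    all_goals
      refine Matrix.toLin'.injective (LinearMap.ext fun x => ?_)
      obtain ⟨x, rfl⟩ := e.surjective x
      rw [Fin.sum_univ_two]
      have hP : ∀ y, P.val.mulVec y = f y := fun y => LinearMap.toMatrix'_mulVec _ _
      have hQ : Q.val.mulVec (e x) = x :=
        (LinearMap.toMatrix'_mulVec _ _).trans (e.symm_apply_apply x)
      first | rw [← h0] | rw [← h1]
      simp only [map_add, map_smul, LinearMap.add_apply, LinearMap.smul_apply, Matrix.toLin'_apply,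
        ← Matrix.mulVec_mulVec, hP, hQ]
      rfl

theorem rank_eq_finrank_range_toLin' (A : Matrix (Fin M) (Fin N) ℂ) :
    A.rank = finrank ℂ (LinearMap.range A.toLin') := rfl

theorem rank_comb (ψ : State M N) (α β : ℂ) : (α • ψ 0 + β • ψ 1).rank =
    finrank ℂ (LinearMap.range (α • (ψ 0).toLin' + β • (ψ 1).toLin')) := by
  rw [rank_eq_finrank_range_toLin', map_add, map_smul, map_smul]

theorem combRanks_subset_of_pairEquiv {ψ φ : State M N}
    (h : PairEquiv (ψ 0).toLin' (ψ 1).toLin' (φ 0).toLin' (φ 1).toLin') :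
    combRanks φ ⊆ combRanks ψ := by
  obtain ⟨a, b, c, d, hdet, h⟩ := h
  rintro _ ⟨α, β, h0, rfl⟩
  refine ⟨α * a + β * c, α * b + β * d, ?_, ?_⟩
  · by_contra! h1
    have h2 : α * (a * d - b * c) = 0 := by linear_combination d * h1.1 - c * h1.2
    have h3 : β * (a * d - b * c) = 0 := by linear_combination a * h1.2 - b * h1.1
    simp_all
  · rw [rank_comb, rank_comb, ← (h.comb α β α β).finrank_range, smul_add_smul_comb]

theorem Equivalent.symm {ψ φ : State M N} (h : Equivalent ψ φ) : Equivalent φ ψ :=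
  equivalent_iff_pairEquiv.2 (equivalent_iff_pairEquiv.1 h).symm

theorem Equivalent.trans {ψ φ χ : State M N} (h : Equivalent ψ φ) (h' : Equivalent φ χ) :
    Equivalent ψ χ :=
  equivalent_iff_pairEquiv.2 ((equivalent_iff_pairEquiv.1 h).trans (equivalent_iff_pairEquiv.1 h'))

theorem combRanks_eq_of_equivalent {ψ φ : State M N} (h : Equivalent ψ φ) :
    combRanks φ = combRanks ψ :=
  (combRanks_subset_of_pairEquiv (equivalent_iff_pairEquiv.1 h)).antisymm
    (combRanks_subset_of_pairEquiv (equivalent_iff_pairEquiv.1 h).symm)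

theorem mem_C_of_equivalent {ψ φ : State M N} {n l : ℕ} (h : Equivalent ψ φ) (hψ : ψ ∈ C M N n l) :
    φ ∈ C M N n l := by
  rw [C, Set.mem_ofPred_eq, combRanks_eq_of_equivalent h]
  exact hψ

/-- An invertible combination of the two matrices attains both extreme ranks. -/
theorem exists_comb_rank_eq {ψ : State M N} {n l : ℕ} (h : ψ ∈ C M N n l) :
    ∃ a b c d : ℂ, a * d - b * c ≠ 0 ∧ (a • ψ 0 + b • ψ 1).rank = n ∧
      (c • ψ 0 + d • ψ 1).rank = l := by
  obtain ⟨⟨⟨a, b, hab, hn⟩, hmax⟩, ⟨⟨c, d, hcd, hl⟩, hmin⟩⟩ := h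
  by_cases hdet : a * d - b * c = 0
  -- If the two extremal combinations are proportional, their ranks agree, so all nontrivial
  -- combinations have the same rank and the given generators already serve.
  · have hle : n ≤ l := by
      obtain ⟨t, ht, h1, h2⟩ : ∃ t : ℂ, t ≠ 0 ∧ a = t * c ∧ b = t * d := by
        by_cases hc : c = 0
        · subst hc
          have hd : d ≠ 0 := by simpa using hcd
          have ha : a = 0 := by simpa [hd] using hdet
          subst ha
          have hb : b ≠ 0 := by simpa using hab
          exact ⟨b / d, div_ne_zero hb hd, by simp, by field_simp⟩
        · have hb : b = a / c * d := by
            field_simp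
            linear_combination -hdet
          refine ⟨a / c, ?_, by field_simp, hb⟩
          intro h0
          rw [h0, zero_mul] at hb
          rw [div_eq_zero_iff, or_iff_left hc] at h0
          simp [h0, hb] at hab
      subst h1 h2
      rw [hn, hl, mul_smul, mul_smul, ← smul_add]
      have : t • (c • ψ 0 + d • ψ 1) = (t • (1 : Matrix (Fin M) (Fin M) ℂ)) * (c • ψ 0 + d • ψ 1) := by
        rw [Matrix.smul_mul, Matrix.one_mul]
      rw [this]
      exact Matrix.rank_mul_le_right _ _
    have hmem : ∀ α β : ℂ, (α ≠ 0 ∨ β ≠ 0) → (α • ψ 0 + β • ψ 1).rank = n ∧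
        (α • ψ 0 + β • ψ 1).rank = l := by
      intro α β h0
      have h1 : _ ≤ n := hmax ⟨α, β, h0, rfl⟩
      have h2 : l ≤ _ := hmin ⟨α, β, h0, rfl⟩
      omega
    exact ⟨1, 0, 0, 1, by simp, (hmem 1 0 (by simp)).1, (hmem 0 1 (by simp)).2⟩
  · exact ⟨a, b, c, d, hdet, hn.symm, hl.symm⟩

theorem exists_normalForm (hM : 1 ≤ M) (hMN : M ≤ N) {l : ℕ} {ψ : State M N}
    (hψ : ψ ∈ C M N (M - 1) l) : ∃ F ∈ normalForms M N l, Equivalent ψ F.state := by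
  obtain ⟨a, b, c, d, hdet, hn, hl⟩ := exists_comb_rank_eq hψ
  have hle : ∀ α β : ℂ, (α • ψ 0 + β • ψ 1).rank ≤ M - 1 := by
    intro α β
    by_cases h0 : α ≠ 0 ∨ β ≠ 0
    · exact hψ.1.2 ⟨α, β, h0, rfl⟩
    · push Not at h0
      simp [h0.1, h0.2]
  rw [rank_comb] at hn hl
  obtain ⟨m, eig, size, q, ε, η, hs, hε, hq, hiso⟩ := exists_iso_normal_form
    (a • (ψ 0).toLin' + b • (ψ 1).toLin') (c • (ψ 0).toLin' + d • (ψ 1).toLin')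
    (fun x y => by
      rw [hn, smul_add_smul_comb, ← rank_comb]
      exact hle _ _)
    (by
      rw [hn, finrank_fin_fun]
      omega)
  have hrk := LinearMap.finrank_range_add_finrank_ker (a • (ψ 0).toLin' + b • (ψ 1).toLin')
  rw [hn, hq, finrank_fin_fun] at hrk
  -- Rank-nullity for the generator of rank `M - 1` fixes the number of row chains.
  obtain rfl : q = N + 1 - M := by omega
  obtain ⟨e, f, -, -⟩ := id hiso
  have hrows := f.finrank_eq
  have hcols := e.finrank_eq
  rw [finrank_prod, finrank_fin_fun, finrank_pi, finrank_pi] at hrows hcols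
  simp only [Fintype.card_sigma, Fintype.card_fin, RowIndex, ColIndex, Fintype.card_sum,
    Finset.sum_add_distrib, Finset.sum_const, Finset.card_univ, smul_eq_mul, mul_one] at hrows hcols
  let F : NormalForm M N := ⟨m, eig, size, hs, ε, hε, η, by omega, by omega⟩
  have hF := hiso.trans (iso_state F).symm
  have hE : Equivalent ψ F.state := equivalent_iff_pairEquiv.2 ⟨a, b, c, d, hdet, hF⟩
  refine ⟨F, ⟨?_, mem_C_of_equivalent hE hψ⟩, hE⟩
  rw [← hl, hF.swap.finrank_range]
  rfl

/-- A linear dependence would force the minimal rank to be zero, hence Γ = 0; but `M ≤ N` provides a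
row chain, and being nonempty it puts a one into Γ. -/
theorem eq_zero_of_sum_smul_eq_zero {F : NormalForm M N} {l : ℕ} (hMN : M ≤ N)
    (hF : F ∈ normalForms M N l) (hε : ∀ i, 1 ≤ F.ε i) {ψ : State M N}
    (hψ : ψ ∈ C M N (M - 1) l) (v : Fin 2 → ℂ) (h : ∑ i, v i • ψ i = 0) : v = 0 := by
  by_contra hv
  have hv' : v 0 ≠ 0 ∨ v 1 ≠ 0 := by
    by_contra! h0
    exact hv (funext (Fin.forall_fin_two.2 h0))
  rw [Fin.sum_univ_two] at h
  have hl : l ≤ 0 := hψ.2.2 ⟨v 0, v 1, hv', by rw [h, Matrix.rank_zero]⟩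
  have hrank := hF.1
  rw [Nat.le_zero.1 hl, rank_eq_finrank_range_toLin'] at hrank
  have h1 := (iso_state F).swap.finrank_range
  have h2 : finrank ℂ (LinearMap.range ((jordanMap F.eig F.size).prodMap (chainB ℂ F.ε F.η))) = 0 :=
    h1.symm.trans hrank
  rw [Submodule.finrank_eq_zero, LinearMap.range_eq_bot] at h2
  let i : Fin (N + 1 - M) := ⟨0, by omega⟩
  have h3 := congrFun (congrArg Prod.snd (LinearMap.congr_fun h2 (0, fun _ => 1)))
    (.inl ⟨i, ⟨0, hε i⟩⟩)
  exact one_ne_zero h3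

theorem trulyEntangled_iff {F : NormalForm M N} {l : ℕ} (hMN : M ≤ N)
    (hF : F ∈ normalForms M N l) {ψ : State M N} (hψ : ψ ∈ C M N (M - 1) l)
    (h : Equivalent ψ F.state) : TrulyEntangled ψ ↔ (∀ i, 1 ≤ F.ε i) ∧ 1 ≤ F.η := by
  have hP := (equivalent_iff_pairEquiv.1 h).trans (iso_state F).pairEquiv
  have hker : LinearMap.ker (ψ 0).toLin' ⊓ LinearMap.ker (ψ 1).toLin' = ⊥ ↔ ∀ i, 1 ≤ F.ε i := by
    rw [← ker_inf_ker_chain_eq_bot_iff (jordanMap F.eig F.size) F.ε F.η]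
    exact ⟨hP.symm.ker_inf_ker, hP.ker_inf_ker⟩
  have hrange : LinearMap.range (ψ 0).toLin' ⊔ LinearMap.range (ψ 1).toLin' = ⊤ ↔ 1 ≤ F.η := by
    rw [← range_sup_range_chain_eq_top_iff (jordanMap F.eig F.size) F.ε F.η]
    exact ⟨hP.symm.range_sup_range, hP.range_sup_range⟩
  rw [TrulyEntangled, det_sum_conjTranspose_mul_ne_zero_iff_ker,
    det_sum_mul_conjTranspose_ne_zero_iff_range, hker, hrange]
  constructor
  · rintro ⟨-, h1, h2⟩
    exact ⟨h2, h1⟩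
  · rintro ⟨h2, h1⟩
    exact ⟨det_gram_ne_zero ψ (eq_zero_of_sum_smul_eq_zero hMN hF h2 hψ), h1, h2⟩

theorem equivalent_state_iff (F F' : NormalForm M N) :
    Equivalent F.state F'.state ↔ (F.ε = F'.ε ∧ F.η = F'.η) ∧ F.JordanEquivalent F' := by
  rw [equivalent_iff_pairEquiv]
  have h1 := (iso_state F).pairEquiv
  have h2 := (iso_state F').pairEquiv
  have h3 := pairEquiv_normal_form_iff F.size_pos F'.size_pos (eig := F.eig) (eig' := F'.eig)
    F.ε_anti F'.ε_anti F.η F'.η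
  refine Iff.trans ⟨fun h => (h1.symm.trans h).trans h2, fun h => (h1.trans h).trans h2.symm⟩
    (h3.trans (and_congr_right fun _ => ?_))
  constructor
  · rintro ⟨a, b, c, d, hdet, σ, hσ⟩
    exact ⟨Matrix.GeneralLinearGroup.mkOfDetNeZero !![a, b; c, d] (by
      rwa [Matrix.det_fin_two_of]), σ, hσ⟩
  · rintro ⟨T, σ, hσ⟩
    refine ⟨T.val 0 0, T.val 0 1, T.val 1 0, T.val 1 1, ?_, σ, hσ⟩
    rw [← Matrix.det_fin_two]
    exact ((Matrix.isUnit_iff_isUnit_det _).1 T.isUnit).ne_zero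

end State

end Pencil

end

theorem theorem2 (M N l : ℕ) (hM : 1 ≤ M) (hMN : M ≤ N) :
    -- every element of `C_{M-1,l}` has a normal form; for truly entangled states, and only for
    -- them, no chain of its block `B` is empty
    (∀ ψ ∈ Slocc.C M N (M - 1) l, ∃ F ∈ Slocc.normalForms M N l,
      Slocc.Equivalent ψ F.state ∧
      (Slocc.TrulyEntangled ψ ↔ (∀ i, 1 ≤ F.ε i) ∧ 1 ≤ F.η)) ∧
    -- (i) equivalence means having a normal form in common
    (∀ ψ ∈ Slocc.C M N (M - 1) l, ∀ φ ∈ Slocc.C M N (M - 1) l,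
      Slocc.Equivalent ψ φ ↔ ∃ F ∈ Slocc.normalForms M N l,
        Slocc.Equivalent ψ F.state ∧ Slocc.Equivalent φ F.state) ∧
    -- (ii) the normal form is unique: same block `B`, equivalent Jordan forms `J`
    (∀ F ∈ Slocc.normalForms M N l, ∀ F' ∈ Slocc.normalForms M N l,
      Slocc.Equivalent F.state F'.state ↔
        (F.ε = F'.ε ∧ F.η = F'.η) ∧ F.JordanEquivalent F') := by
  refine ⟨fun ψ hψ => ?_, fun ψ hψ φ hφ => ⟨fun h => ?_, ?_⟩,
    fun F _ F' _ => Pencil.equivalent_state_iff F F'⟩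
  · obtain ⟨F, hF, hE⟩ := Pencil.exists_normalForm hM hMN hψ
    exact ⟨F, hF, hE, Pencil.trulyEntangled_iff hMN hF hψ hE⟩
  · obtain ⟨F, hF, hE⟩ := Pencil.exists_normalForm hM hMN hψ
    exact ⟨F, hF, hE, Pencil.Equivalent.trans (Pencil.Equivalent.symm h) hE⟩
  · rintro ⟨F, -, h1, h2⟩
    exact Pencil.Equivalent.trans h1 (Pencil.Equivalent.symm h2)
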